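/- **Setting.** For $u_1>u_2>u_3$ and $n\ge 0$ let $P_n(\xi,u_1,u_2,u_3)$ be the unique monic polynomial in $\xi$ of degree $n+1$ such that, with $R(\xi)=(\xi-u_1)(\xi-u_2)(\xi-u_3)$, $$\frac{P_n(\xi,u_1,u_2,u_3)}{\sqrt{R(\xi)}}=\xi^{n-1/2}+O(\xi^{-3/2})\ \ (\xi\to\infty),\qquad \int_{u_3}^{u_2}\frac{P_n(\xi,u_1,u_2,u_3)}{\sqrt{R(\xi)}}\,d\xi=0 .$$ For $m\ge 1$ put $$\mu_i^{(m)}(u_1,u_2,u_3)=4^m(2m+1)\frac{P_m(u_i,u_1,u_2,u_3)}{P_0(u_i,u_1,u_2,u_3)}\quad(i=1,2,3),\qquad C_m=\frac{2^m(2m+1)!!}{m!},$$ $$q(u_1,u_2,u_3)=\frac{C_m}{2\sqrt2\,\pi}\int_{-1}^1\!\int_{-1}^1\frac{\big(\frac{1+\mu}{2}\frac{1+\nu}{2}u_1+\frac{1+\mu}{2}\frac{1-\nu}{2}u_2+\frac{1-\mu}{2}u_3\big)^m}{\sqrt{(1-\mu)(1-\nu^2)}}\,d\nu\,d\mu,$$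 $\operatorname{div}q=\sum_i\partial q/\partial u_i$ and $p_1(u_1,u_2,u_3)=2(u_1-u_2)\,\partial_{u_2}\operatorname{div}q-\operatorname{div}q$. The Whitham equations are $\partial_tu_i+\mu_i^{(m)}(u_1,u_2,u_3)\,\partial_xu_i=0$, $i=1,2,3$, for $u_1>u_2>u_3$, and the Burgers type equation is $\partial_tu+\partial_x\big(\tfrac{C_m}{m+1}u^{m+1}\big)=0$. Values of $\mu_2^{(m)}$ at $u_2=u_3$ or at $u_1=u_2$ are limits from the domain $u_1>u_2>u_3$. **Theorem 3.1.** Let $m\ge2$. The function $\xi\mapsto p_1(1,\xi,\xi)$ has a unique zero $u^*$ in $(0,1)$, and $\xi\mapsto\mu_2^{(m)}(1,\xi,0)-\mu_3^{(m)}(1,\xi,0)$ has a unique zero $u^{**}$ in $(0,1)$. The limits $\alpha=\mu_2^{(m)}(1,u^*,u^*)$ and $\mu_2^{(m)}(1,1,0)$ exist; with $\beta=\mu_2^{(m)}(1,u^{**},0)$ we have $\mu_2^{(m)}(1,1,0)=q(1,1,0)=4^m$ and $\alpha<\beta<4^m$. For the step initial data ($u=1$ for $x<0$, $u=0$ for $x>0$)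 the Whitham equations have, for $t>0$, the following self-similar solution, in which $u_1=1$ and $u_2,u_3$ are functions of $x/t$. 1. For $\alpha t<x\le\beta t$, $(u_2,u_3)$ is the unique pair with $0\le u_3<u_2<1$ and $x/t=\mu_2^{(m)}(1,u_2,u_3)=\mu_3^{(m)}(1,u_2,u_3)$. 2. For $\beta t\le x<4^mt$, $u_3=0$ and $u_2$ is the unique number in $[u^{**},1)$ with $x/t=\mu_2^{(m)}(1,u_2,0)$. 3. As functions of $x/t$, $u_2$ is strictly increasing on $[\alpha,4^m]$ and $u_3$ is strictly decreasing on $[\alpha,\beta]$, and both are continuous on $[\alpha,4^m]$, with $u_2=u_3=u^*$ at $\alpha$, and $u_2=1$, $u_3=0$ at $4^m$. 4. In $\alpha t<x<4^mt$, $x\ne\beta t$, the functions $u_1>u_2>u_3$ are $C^1$ and satisfy the Whitham equations. 5. Outside, the solution of the Burgers type equation is $u\equiv1$ for $x\le\alpha t$ and $u\equiv0$ for $x\ge4^mt$; it takes the step initial data as $t\to0^+$ at every $x\neq0$. At $x=\alpha t$ one has $u_2=u_3$ and $u_1=u$; at $x=4^mt$ one has $u_1=u_2$ and $u_3=u$.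 -/

import Mathlib

open Set Filter Topology Asymptotics

noncomputable section

namespace Whitham

/-- `(ξ - u₁)(ξ - u₂)(ξ - u₃)`. -/
def cubic (u₁ u₂ u₃ ξ : ℝ) : ℝ := (ξ - u₁) * (ξ - u₂) * (ξ - u₃)

/-- The defining conditions of the polynomial `P_n(ξ, u₁, u₂, u₃)`, for `u₁ > u₂ > u₃`: it is monic
of degree `n + 1`, it satisfies `P_n / √((ξ - u₁)(ξ - u₂)(ξ - u₃)) = ξ ^ (n - 1/2) + O(ξ ^ (-3/2))`
for large `ξ` (comparing the coefficients of the expansion in powers of `ξ` shows that real `ξ → +∞`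
suffices), and the integral of `P_n / √((ξ - u₁)(ξ - u₂)(ξ - u₃))` over `(u₃, u₂)` vanishes.
On `(u₃, u₂)` the cubic is positive; the branch of the square root with cuts along `(-∞, u₃)` and
`(u₂, u₁)` differs there from the positive square root only by the constant factor `-1`, which is
irrelevant for the vanishing of the integral. -/
structure IsWhithamPoly (n : ℕ) (u₁ u₂ u₃ : ℝ) (p : Polynomial ℝ) : Prop where
  monic : p.Monic
  natDegree_eq : p.natDegree = n + 1
  asymptotics : (fun ξ : ℝ => p.eval ξ / √(cubic u₁ u₂ u₃ ξ) - ξ ^ ((n : ℝ) - 1 / 2))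
    =O[atTop] fun ξ : ℝ => ξ ^ (-(3 / 2) : ℝ)
  integral_eq_zero : ∫ ξ in u₃..u₂, p.eval ξ / √(cubic u₁ u₂ u₃ ξ) = 0

open Classical in
/-- The polynomial `P_n(·, u₁, u₂, u₃)`; it is used for `u₁ > u₂ > u₃`, where the conditions
above determine it uniquely. -/
def P (n : ℕ) (u₁ u₂ u₃ : ℝ) : Polynomial ℝ :=
  if h : ∃ p, IsWhithamPoly n u₁ u₂ u₃ p then h.choose else 0

/-- The domain `u₁ > u₂ > u₃` of the Whitham equations. -/
def domain : Set (ℝ × ℝ × ℝ) := {u | u.2.2 < u.2.1 ∧ u.2.1 < u.1}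

/-- The eigenspeed `μ₁⁽ᵐ⁾(u₁, u₂, u₃)`, for `u₁ > u₂ > u₃`. -/
def speed₁ (m : ℕ) (u₁ u₂ u₃ : ℝ) : ℝ :=
  4 ^ m * (2 * m + 1) * ((P m u₁ u₂ u₃).eval u₁ / (P 0 u₁ u₂ u₃).eval u₁)

/-- The eigenspeed `μ₂⁽ᵐ⁾(u₁, u₂, u₃)`, for `u₁ > u₂ > u₃`. -/
def speed₂ (m : ℕ) (u₁ u₂ u₃ : ℝ) : ℝ :=
  4 ^ m * (2 * m + 1) * ((P m u₁ u₂ u₃).eval u₂ / (P 0 u₁ u₂ u₃).eval u₂)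

/-- The eigenspeed `μ₃⁽ᵐ⁾(u₁, u₂, u₃)`, for `u₁ > u₂ > u₃`. -/
def speed₃ (m : ℕ) (u₁ u₂ u₃ : ℝ) : ℝ :=
  4 ^ m * (2 * m + 1) * ((P m u₁ u₂ u₃).eval u₃ / (P 0 u₁ u₂ u₃).eval u₃)

/-- `C_m = 2 ^ m (2 m + 1)!! / m!`. -/
def C (m : ℕ) : ℝ := 2 ^ m * (Nat.doubleFactorial (2 * m + 1) : ℝ) / (Nat.factorial m : ℝ)

/-- The solution `q` of the Euler-Poisson-Darboux equations
`2 (u_i - u_j) ∂_i ∂_j q = ∂_i q - ∂_j q` with `q(u, u, u) = C_m u ^ m`, by its integral formula. -/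
def q (m : ℕ) (u₁ u₂ u₃ : ℝ) : ℝ :=
  C m / (2 * √2 * Real.pi) * ∫ μ in (-1 : ℝ)..1, ∫ ν in (-1 : ℝ)..1,
    ((1 + μ) / 2 * ((1 + ν) / 2) * u₁ + (1 + μ) / 2 * ((1 - ν) / 2) * u₂ + (1 - μ) / 2 * u₃) ^ m
      / √((1 - μ) * (1 - ν ^ 2))

/-- `div q = ∂q/∂u₁ + ∂q/∂u₂ + ∂q/∂u₃`. -/
def divq (m : ℕ) (u₁ u₂ u₃ : ℝ) : ℝ :=
  deriv (fun y => q m y u₂ u₃) u₁ + deriv (fun y => q m u₁ y u₃) u₂ +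
    deriv (fun y => q m u₁ u₂ y) u₃

/-- `p₁ = 2 (u₁ - u₂) ∂(div q)/∂u₂ - div q`. -/
def p₁ (m : ℕ) (u₁ u₂ u₃ : ℝ) : ℝ :=
  2 * (u₁ - u₂) * deriv (fun y => divq m u₁ y u₃) u₂ - divq m u₁ u₂ u₃

/-- `w` is continuously differentiable on the open set `Ω` of points `(x, t)`, and satisfies there
`w_t + c w_x = 0` with the speed `c(x, t)`. -/
def Transported (w c : ℝ → ℝ → ℝ) (Ω : Set (ℝ × ℝ)) : Prop :=
  ContDiffOn ℝ 1 (fun z : ℝ × ℝ => w z.1 z.2) Ω ∧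
    ∀ x t, (x, t) ∈ Ω → deriv (fun s => w x s) t + c x t * deriv (fun y => w y t) x = 0

/-- `u₁ > u₂ > u₃` is a classical solution of the Whitham equations
`∂_t u_i + μ_i⁽ᵐ⁾(u₁, u₂, u₃) ∂_x u_i = 0`, `i = 1, 2, 3`, on the open set `Ω` of points `(x, t)`. -/
structure IsWhithamSolution (m : ℕ) (u₁ u₂ u₃ : ℝ → ℝ → ℝ) (Ω : Set (ℝ × ℝ)) : Prop where
  isOpen : IsOpen Ω
  mem_domain : ∀ x t, (x, t) ∈ Ω → (u₁ x t, u₂ x t, u₃ x t) ∈ domain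
  eq₁ : Transported u₁ (fun x t => speed₁ m (u₁ x t) (u₂ x t) (u₃ x t)) Ω
  eq₂ : Transported u₂ (fun x t => speed₂ m (u₁ x t) (u₂ x t) (u₃ x t)) Ω
  eq₃ : Transported u₃ (fun x t => speed₃ m (u₁ x t) (u₂ x t) (u₃ x t)) Ω

/-- `u` is a classical solution of the Burgers type equation `u_t + (C_m / (m + 1) u ^ (m + 1))_x = 0`
on the open set `Ω` of points `(x, t)`. -/
structure IsBurgersSolution (m : ℕ) (u : ℝ → ℝ → ℝ) (Ω : Set (ℝ × ℝ)) : Prop where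
  isOpen : IsOpen Ω
  contDiffOn : ContDiffOn ℝ 1 (fun z : ℝ × ℝ => u z.1 z.2) Ω
  eq : ∀ x t, (x, t) ∈ Ω →
    deriv (fun s => u x s) t + deriv (fun y => C m / (m + 1) * u y t ^ (m + 1)) x = 0

end Whitham

end

/-! Write a = u₂, b = u₃, m = n + 1. Since ξ^(m-1/2) √R = ξ^(m-1) (ξ-a)(ξ-b)
√((ξ-u₁)ξ/((ξ-a)(ξ-b))), expanding the last root in powers of 1/ξ with coefficients w_k gives P_m =
(ξ-a)(ξ-b) `wPoly` + w_m ξ + κ, where κ is fixed by the period condition (`P_eq_explicitP`). At a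
and b the first summand vanishes, and one finds (`speed₂_eq`, `speed₃_eq`) μ₂ = 4^m (2m+1) (w_m +
F/(2(a-b) J(b,a))), μ₃ = 4^m (2m+1) (w_m - F/(2(a-b) J(a,b))), with F = `ellF` the integral of
`wPoly` √((a-ξ)(ξ-b)/(u₁-ξ)) over (b,a) and J = `ellJ` > 0. Hence μ₂ = μ₃ exactly where F = 0.

Everything rests on ∂F/∂a = (a-b) σ J(a,b) and ∂w_m/∂a = σ/2 with the same factor σ = `wPoly` at ξ =
a (`hasDerivAt_ellF`, `hasDerivAt_wCoeff_succ`). For u₁ = 1, σ is the coefficient of X^n in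
(1-aX)^(-3/2) (1-X)^(1/2) (1-bX)^(-1/2). As a polynomial in a it has a positive leading coefficient
and negative other ones, so it changes sign at most once on a > 0 (`descartes`, `signPoly_lt`). On
the diagonal `p₁` is a negative multiple of σ, whose zero is u*.

F is symmetric in a, b and vanishes for a = b. The sign rule for σ, applied in each variable, shows
that F is negative for a ≤ u* and that its zeros in the triangle 0 ≤ b < a < 1 form the graph of a
decreasing function b = B(a), running from the diagonal point (u*, u*), which is not itself in the
triangle, to (u**, 0) (`IsZeroCurve`). On this curve both speeds are a constant times w_m, and
implicit differentiation gives w_m' = (σ/2)(1 + J(a,b)/J(b,a)) > 0. On the axis b = 0 beyond u**,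
the derivative of μ₂ is a positive multiple of σ J(0,a) - `ellN`, which is positive by `ellN_lt`. So
x/t is a continuous increasing function of u₂ from α to 4^m; its inverse is v₂, and v₃ = B ∘ v₂. -/

noncomputable section

namespace Whitham

/-! ### Formal powers (1 - uX)^r and the signs of their coefficients. -/

section PowerSeries

/-- The coefficients of `(1 - X) ^ r`. -/
def powCoeff (r : ℝ) (k : ℕ) : ℝ := (-1) ^ k * Ring.choose r k

/-- The formal power series `(1 - u X) ^ r`. -/
def pow1 (r u : ℝ) : PowerSeries ℝ := PowerSeries.mk fun k => powCoeff r k * u ^ k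

open PowerSeries

@[simp] lemma coeff_pow1 (r u : ℝ) (k : ℕ) : coeff k (pow1 r u) = powCoeff r k * u ^ k :=
  coeff_mk _ _

lemma pow1_eq_rescale (r u : ℝ) : pow1 r u = rescale (-u) (binomialSeries ℝ r) := by
  ext k
  simp only [coeff_pow1, powCoeff, coeff_rescale, binomialSeries_coeff, smul_eq_mul, mul_one]
  rw [neg_pow]; ring

lemma pow1_add (r s u : ℝ) : pow1 (r + s) u = pow1 r u * pow1 s u := by
  simp only [pow1_eq_rescale, binomialSeries_add, map_mul]

@[simp] lemma pow1_zero (u : ℝ) : pow1 0 u = 1 := by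
  simp [pow1_eq_rescale]

@[simp] lemma pow1_zero_right (r : ℝ) : pow1 r 0 = 1 := by
  ext k
  cases k <;> simp [powCoeff, coeff_one]

@[simp] lemma powCoeff_zero (r : ℝ) : powCoeff r 0 = 1 := by simp [powCoeff]

lemma powCoeff_succ (r : ℝ) (k : ℕ) :
    ((k : ℝ) + 1) * powCoeff r (k + 1) = (k - r) * powCoeff r k := by
  have hk : ((k.factorial : ℝ)) ≠ 0 := by positivity
  have hk1 : ((k : ℝ) + 1) ≠ 0 := by positivity
  simp only [powCoeff, Ring.choose_eq_smul, smul_eq_mul, descPochhammer_succ_right,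
    Polynomial.smeval_mul, Polynomial.smeval_sub, Polynomial.smeval_X, Polynomial.smeval_natCast,
    Nat.factorial_succ, Nat.cast_mul, Nat.cast_succ, pow_succ]
  field_simp
  ring

/-- Coefficientwise form of d/dX (1 - X)^r = -r (1 - X)^(r-1). -/
lemma powCoeff_succ' (r : ℝ) (k : ℕ) :
    ((k : ℝ) + 1) * powCoeff r (k + 1) = -r * powCoeff (r - 1) k := by
  induction k with
  | zero => have := powCoeff_succ r 0; simpa using this
  | succ k ih =>
    have h1 := powCoeff_succ r (k + 1)
    have h2 := powCoeff_succ (r - 1) k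
    have hk1 : ((k : ℝ) + 1) ≠ 0 := by positivity
    apply mul_left_cancel₀ hk1
    push_cast at h1 ⊢
    linear_combination ((k : ℝ) + 1) * h1 + ((k : ℝ) + 1 - r) * ih + r * h2

lemma pow1_one (u : ℝ) : pow1 1 u = 1 - PowerSeries.C u * X := by
  rw [pow1_eq_rescale]
  have := binomialSeries_nat (R := ℝ) (A := ℝ) 1
  simp only [Nat.cast_one, pow_one] at this
  rw [this]
  simp [rescale_X, sub_eq_add_neg]

lemma powCoeff_pos {r : ℝ} (hr : r < 0) (k : ℕ) : 0 < powCoeff r k := by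
  induction k with
  | zero => simp
  | succ k ih =>
    have h := powCoeff_succ r k
    have h1 : 0 < ((k : ℝ) - r) * powCoeff r k :=
      mul_pos (by have : (0 : ℝ) ≤ k := by positivity
                  linarith) ih
    rw [← h] at h1
    exact pos_of_mul_pos_right h1 (by positivity)

@[simp] lemma powCoeff_neg_one (k : ℕ) : powCoeff (-1) k = 1 := by
  induction k with
  | zero => simp
  | succ k ih =>
    have h := powCoeff_succ (-1) k
    have hk1 : ((k : ℝ) + 1) ≠ 0 := by positivity
    rw [ih] at h
    apply mul_left_cancel₀ hk1
    linarith

lemma pow1_mul_neg_one (u : ℝ) : pow1 1 u * pow1 (-1) u = 1 := by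
  rw [← pow1_add]; simp

/-- Differentiation of the coefficients with respect to the parameter. -/
lemma hasDerivAt_coeff_pow1_mul (r u : ℝ) (Z : PowerSeries ℝ) (n : ℕ) :
    HasDerivAt (fun y => coeff n (pow1 r y * Z)) (-r * coeff n (X * (pow1 (r - 1) u * Z))) u := by
  have key : ∀ k : ℕ, HasDerivAt (fun y => coeff k (pow1 r y))
      (-r * coeff k (X * pow1 (r - 1) u)) u := by
    intro k
    cases k with
    | zero => simpa using hasDerivAt_const u (1 : ℝ)
    | succ k =>
      simp only [coeff_pow1, coeff_succ_X_mul]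
      have h := (hasDerivAt_pow (k + 1) u).const_mul (powCoeff r (k + 1))
      refine h.congr_deriv ?_
      have := powCoeff_succ' r k
      push_cast
      linear_combination u ^ k * this
  rw [← mul_assoc X, coeff_mul, Finset.mul_sum]
  rw [show (fun y => coeff n (pow1 r y * Z)) = fun y => ∑ p ∈ Finset.HasAntidiagonal.antidiagonal n,
    coeff p.1 (pow1 r y) * coeff p.2 Z from funext fun y => coeff_mul _ _ _]
  apply HasDerivAt.fun_sum
  intro p _
  rw [← mul_assoc]
  exact (key p.1).mul_const _

lemma continuous_coeff_pow1 (r : ℝ) (k : ℕ) : Continuous fun u => coeff k (pow1 r u) := by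
  simp only [coeff_pow1]; fun_prop

lemma continuous_coeff_mul {T : Type*} [TopologicalSpace T] {f g : T → PowerSeries ℝ}
    (hf : ∀ k, Continuous fun x => coeff k (f x)) (hg : ∀ k, Continuous fun x => coeff k (g x))
    (k : ℕ) : Continuous fun x => coeff k (f x * g x) := by
  simp only [coeff_mul]
  exact continuous_finsetSum _ fun p _ => (hf p.1).mul (hg p.2)

lemma continuous_coeff_pow1_comp {T : Type*} [TopologicalSpace T] {f : T → ℝ} (hf : Continuous f)
    (r : ℝ) (k : ℕ) : Continuous fun x => coeff k (pow1 r (f x)) :=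
  (continuous_coeff_pow1 r k).comp hf

/-- The square root of a power series `1 - N`, where `N` has nonnegative coefficients, has negative
coefficients beyond the constant one. -/
lemma coeff_neg_of_sq_eq {f N : PowerSeries ℝ} (hf : coeff 0 f = 1) (h : f * f = 1 - N)
    (hN : ∀ k, 0 ≤ coeff k N) (hN1 : 0 < coeff 1 N) (k : ℕ) : coeff (k + 1) f < 0 := by
  induction k using Nat.strong_induction_on with
  | _ k ih =>
    have hk := congrArg (coeff (k + 1)) h
    rw [coeff_mul, Finset.Nat.sum_antidiagonal_eq_sum_range_succ_mk, Finset.sum_range_succ',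
      Finset.sum_range_succ] at hk
    simp only [Nat.sub_self, hf, mul_one, map_sub, coeff_one, Nat.succ_ne_zero, if_false, one_mul,
      Nat.sub_zero, Nat.add_sub_add_right] at hk
    cases k with
    | zero => simp at hk; linarith
    | succ k =>
      -- One product of earlier coefficients is split off the convolution: it is strictly positive,
      -- which keeps the conclusion strict even where N has a zero coefficient.
      rw [Finset.sum_range_succ] at hk
      have h0 : 0 ≤ ∑ i ∈ Finset.range k, coeff (i + 1) f * coeff (k + 1 - i) f := by
        apply Finset.sum_nonneg
        intro i hi
        have hi := Finset.mem_range.1 hi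
        have h1 := ih i (by omega)
        have h2 := ih (k - i) (by omega)
        rw [show k + 1 - i = k - i + 1 by omega]
        exact (mul_pos_of_neg_of_neg h1 h2).le
      have h1 := ih k (by omega)
      have h2 := ih 0 (by omega)
      rw [show k + 1 - k = 0 + 1 by omega] at hk
      have h3 := mul_pos_of_neg_of_neg h1 h2
      have h4 := hN (k + 1 + 1)
      linarith

/-- The series is a square root of (1 - X)/(1 - bX) = 1 - (1-b) X/(1 - bX). -/
lemma coeff_half_mul_neg {b : ℝ} (hb : 0 ≤ b) (hb1 : b < 1) (k : ℕ) :
    coeff (k + 1) (pow1 (1 / 2) 1 * pow1 (-1 / 2) b) < 0 := by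
  refine coeff_neg_of_sq_eq (N := PowerSeries.C (1 - b) * (X * pow1 (-1) b)) ?_ ?_ ?_ ?_ k
  · simp [coeff_mul]
  · have h1 : pow1 (1 / 2) 1 * pow1 (1 / 2) 1 = pow1 1 1 := by rw [← pow1_add]; norm_num
    have h2 : pow1 (-1 / 2) b * pow1 (-1 / 2) b = pow1 (-1) b := by rw [← pow1_add]; norm_num
    have h3 := pow1_mul_neg_one b
    rw [pow1_one] at h1 h3
    have hC : PowerSeries.C (1 - b) = (1 : PowerSeries ℝ) - PowerSeries.C b := by simp
    have hC1 : PowerSeries.C (1 : ℝ) = (1 : PowerSeries ℝ) := by simp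
    rw [hC]
    rw [hC1] at h1
    linear_combination (pow1 (-1 / 2) b * pow1 (-1 / 2) b) * h1 + (1 - X) * h2 + h3
  · intro k
    rw [coeff_C_mul]
    cases k with
    | zero => simp
    | succ k =>
      rw [coeff_succ_X_mul]
      simp only [coeff_pow1, powCoeff_neg_one, one_mul]
      have : 0 < 1 - b := by linarith
      positivity
  · rw [coeff_C_mul, show (1 : ℕ) = 0 + 1 from rfl, coeff_succ_X_mul]
    simp [hb1]

/-- A polynomial with positive leading coefficient and negative other coefficients changes sign
exactly once on the positive axis. -/
lemma descartes {c : ℕ → ℝ} {n : ℕ} (hn : 1 ≤ n) (hc : ∀ j < n, c j < 0) {x y : ℝ} (hx : 0 ≤ x)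
    (hxy : x < y) :
    y ^ n * ∑ j ∈ Finset.range (n + 1), c j * x ^ j <
      x ^ n * ∑ j ∈ Finset.range (n + 1), c j * y ^ j := by
  rw [Finset.mul_sum, Finset.mul_sum]
  have key : ∀ j ≤ n, x ^ n * y ^ j ≤ y ^ n * x ^ j := by
    intro j hj
    obtain ⟨d, rfl⟩ := Nat.exists_eq_add_of_le hj
    have h1 : x ^ d ≤ y ^ d := pow_le_pow_left₀ hx hxy.le d
    have hy : 0 ≤ y := by linarith
    calc x ^ (j + d) * y ^ j = (x ^ j * y ^ j) * x ^ d := by ring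
      _ ≤ (x ^ j * y ^ j) * y ^ d := by gcongr
      _ = _ := by ring
  apply Finset.sum_lt_sum
  · intro j hj
    have hj := Nat.lt_succ_iff.1 (Finset.mem_range.1 hj)
    rcases hj.lt_or_eq with h | rfl
    · nlinarith [hc j h, key j hj]
    · apply le_of_eq; ring
  · refine ⟨0, by simp, ?_⟩
    have h1 : x ^ n < y ^ n := pow_lt_pow_left₀ hxy hx (by omega)
    have h2 := hc 0 (by omega)
    simp only [pow_zero, mul_one]
    nlinarith

/-- The coefficient of `X ^ n` in `(1 - x X) ^ r (1 - X) ^ (1/2) (1 - b X) ^ (-1/2)`. -/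
def signPoly (n : ℕ) (r b x : ℝ) : ℝ := coeff n (pow1 r x * (pow1 (1 / 2) 1 * pow1 (-1 / 2) b))

lemma signPoly_eq (n : ℕ) (r b x : ℝ) : signPoly n r b x = ∑ j ∈ Finset.range (n + 1),
    (powCoeff r j * coeff (n - j) (pow1 (1 / 2) 1 * pow1 (-1 / 2) b)) * x ^ j := by
  rw [signPoly, coeff_mul, Finset.Nat.sum_antidiagonal_eq_sum_range_succ_mk]
  refine Finset.sum_congr rfl fun j _ => ?_
  rw [coeff_pow1]; ring

/-- For j < n the coefficient of x^j is a positive `powCoeff r j` times a coefficient that is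
negative by `coeff_half_mul_neg`. -/
lemma signPoly_lt {n : ℕ} (hn : 1 ≤ n) {r b : ℝ} (hr : r < 0) (hb : 0 ≤ b) (hb1 : b < 1) {x y : ℝ}
    (hx : 0 ≤ x) (hxy : x < y) : y ^ n * signPoly n r b x < x ^ n * signPoly n r b y := by
  rw [signPoly_eq, signPoly_eq]
  refine descartes hn ?_ hx hxy
  intro j hj
  obtain ⟨d, rfl⟩ : ∃ d, n = j + (d + 1) := ⟨n - j - 1, by omega⟩
  rw [Nat.add_sub_cancel_left]
  exact mul_neg_of_pos_of_neg (powCoeff_pos hr j) (coeff_half_mul_neg hb hb1 d)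

lemma signPoly_zero_neg {n : ℕ} (hn : 1 ≤ n) {r b : ℝ} (hb : 0 ≤ b) (hb1 : b < 1) :
    signPoly n r b 0 < 0 := by
  obtain ⟨d, rfl⟩ : ∃ d, n = d + 1 := ⟨n - 1, by omega⟩
  simpa [signPoly] using coeff_half_mul_neg hb hb1 d

lemma signPoly_pos_of_nonneg {n : ℕ} (hn : 1 ≤ n) {r b : ℝ} (hr : r < 0) (hb : 0 ≤ b) (hb1 : b < 1)
    {x y : ℝ} (hx : 0 ≤ x) (hxy : x < y) (h : 0 ≤ signPoly n r b x) : 0 < signPoly n r b y := by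
  have h1 := signPoly_lt hn hr hb hb1 hx hxy
  have hy : 0 < y := by linarith
  have h2 : 0 ≤ y ^ n * signPoly n r b x := by positivity
  exact pos_of_mul_pos_right (lt_of_le_of_lt h2 h1) (by positivity)

lemma signPoly_neg_of_nonpos {n : ℕ} (hn : 1 ≤ n) {r b : ℝ} (hr : r < 0) (hb : 0 ≤ b) (hb1 : b < 1)
    {x y : ℝ} (hx : 0 ≤ x) (hxy : x < y) (h : signPoly n r b y ≤ 0) : signPoly n r b x < 0 := by
  by_contra h0
  exact absurd (signPoly_pos_of_nonneg hn hr hb hb1 hx hxy (not_lt.1 h0)) (not_lt.2 h)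

lemma signPoly_lt_of_nonneg {n : ℕ} (hn : 1 ≤ n) {r b : ℝ} (hr : r < 0) (hb : 0 ≤ b) (hb1 : b < 1)
    {x y : ℝ} (hx : 0 ≤ x) (hxy : x < y) (h : 0 ≤ signPoly n r b x) :
    signPoly n r b x < signPoly n r b y := by
  have h1 := signPoly_lt hn hr hb hb1 hx hxy
  have h2 := signPoly_pos_of_nonneg hn hr hb hb1 hx hxy h
  have hy : 0 < y := by linarith
  have h3 : x ^ n ≤ y ^ n := pow_le_pow_left₀ hx hxy.le n
  have h4 : y ^ n * signPoly n r b x < y ^ n * signPoly n r b y :=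
    h1.trans_le (by gcongr)
  exact lt_of_mul_lt_mul_left h4 (by positivity)

lemma continuous_signPoly (n : ℕ) (r : ℝ) :
    Continuous fun z : ℝ × ℝ => signPoly n r z.1 z.2 := by
  unfold signPoly
  refine continuous_coeff_mul (continuous_coeff_pow1_comp continuous_snd r)
    (continuous_coeff_mul (fun k => continuous_const)
      (continuous_coeff_pow1_comp continuous_fst _)) n

end PowerSeries

/-! ### The angular parametrization of (b, a) and integrals depending on an end point. -/

open Real

/-- The point of the segment between `b` and `a` with parameter `sin θ ^ 2`. -/
def arc (a b θ : ℝ) : ℝ := a * sin θ ^ 2 + b * cos θ ^ 2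

lemma arc_eq_add (a b θ : ℝ) : arc a b θ = b + (a - b) * sin θ ^ 2 := by
  have := sin_sq_add_cos_sq θ
  unfold arc; linear_combination b * this

lemma sub_arc (a b θ : ℝ) : a - arc a b θ = (a - b) * cos θ ^ 2 := by
  have := sin_sq_add_cos_sq θ
  unfold arc; linear_combination -a * this

lemma arc_sub (a b θ : ℝ) : arc a b θ - b = (a - b) * sin θ ^ 2 := by
  rw [arc_eq_add]; ring

lemma arc_pi_div_two_sub (a b θ : ℝ) : arc a b (π / 2 - θ) = arc b a θ := by
  simp only [arc, sin_pi_div_two_sub, cos_pi_div_two_sub]; ring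

lemma arc_lt {a b u : ℝ} (ha : a < u) (hb : b < u) (θ : ℝ) : arc a b θ < u := by
  have h := sin_sq_add_cos_sq θ
  have : u - arc a b θ = (u - a) * sin θ ^ 2 + (u - b) * cos θ ^ 2 := by
    unfold arc; linear_combination -u * h
  have h1 : 0 ≤ (u - a) * sin θ ^ 2 := mul_nonneg (by linarith) (sq_nonneg _)
  have h2 : 0 ≤ (u - b) * cos θ ^ 2 := mul_nonneg (by linarith) (sq_nonneg _)
  rcases eq_or_ne (sin θ) 0 with h0 | h0
  · have : cos θ ^ 2 = 1 := by rw [h0] at h; linarith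
    nlinarith
  · have : 0 < (u - a) * sin θ ^ 2 := mul_pos (by linarith) (by positivity)
    linarith

lemma le_arc {a b u : ℝ} (ha : u ≤ a) (hb : u ≤ b) (θ : ℝ) : u ≤ arc a b θ := by
  have h := sin_sq_add_cos_sq θ
  have : arc a b θ - u = (a - u) * sin θ ^ 2 + (b - u) * cos θ ^ 2 := by
    unfold arc; linear_combination u * h
  have h1 : 0 ≤ (a - u) * sin θ ^ 2 := mul_nonneg (by linarith) (sq_nonneg _)
  have h2 : 0 ≤ (b - u) * cos θ ^ 2 := mul_nonneg (by linarith) (sq_nonneg _)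
  linarith

@[fun_prop]
lemma continuous_arc : Continuous fun z : ℝ × ℝ × ℝ => arc z.1 z.2.1 z.2.2 := by
  unfold arc; fun_prop

/-- Differentiation of a parametric integral over a compact interval. -/
lemma hasDerivAt_integral_of_continuousOn {g g' : ℝ → ℝ → ℝ} {O : Set ℝ} (hO : IsOpen O)
    (p q : ℝ) (hg : ∀ y ∈ O, ∀ θ, HasDerivAt (fun y => g y θ) (g' y θ) y)
    (hc : ∀ y ∈ O, Continuous (g y))
    (hc' : ContinuousOn (fun z : ℝ × ℝ => g' z.1 z.2) (O ×ˢ univ)) {x : ℝ} (hx : x ∈ O) :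
    HasDerivAt (fun y => ∫ θ in p..q, g y θ) (∫ θ in p..q, g' x θ) x := by
  obtain ⟨ε, hε, hball⟩ := Metric.isOpen_iff.1 hO x hx
  have hsub : Metric.closedBall x (ε / 2) ⊆ O :=
    (Metric.closedBall_subset_ball (by linarith)).trans hball
  have hcomp : IsCompact (Metric.closedBall x (ε / 2) ×ˢ uIcc p q) :=
    (isCompact_closedBall _ _).prod isCompact_uIcc
  obtain ⟨M, hM⟩ := hcomp.exists_bound_of_continuousOn
    (hc'.mono (prod_mono hsub (subset_univ _)))
  have hgx : Continuous (g' x) := by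
    have : ContinuousOn (fun θ : ℝ => g' x θ) univ :=
      hc'.comp (f := fun θ : ℝ => (x, θ)) (by fun_prop) fun θ _ => ⟨hx, mem_univ _⟩
    exact continuousOn_univ.1 this
  refine (intervalIntegral.hasDerivAt_integral_of_dominated_loc_of_deriv_le
    (s := Metric.closedBall x (ε / 2)) (bound := fun _ => M)
    (Metric.closedBall_mem_nhds x (by linarith)) ?_ ((hc x hx).intervalIntegrable _ _)
    hgx.aestronglyMeasurable ?_ (by simp) ?_).2
  · filter_upwards [hO.mem_nhds hx] with y hy using (hc y hy).aestronglyMeasurable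
  · refine MeasureTheory.ae_of_all _ fun θ hθ y hy => ?_
    exact hM (y, θ) ⟨hy, uIoc_subset_uIcc hθ⟩
  · exact MeasureTheory.ae_of_all _ fun θ _ y hy => hg y (hsub hy) θ

/-- With ξ = `arc a b θ` this differentiates ∫_b^a √(a-ξ) (ξ-b)^(j-1/2) f(ξ) dξ in a: the boundary
term vanishes and √(a-ξ) turns into 1/(2√(a-ξ)). The angle removes the end point singularities at
the price of an integration by parts. -/
lemma hasDerivAt_arc_integral (j : ℕ) {f f' : ℝ → ℝ} {u : ℝ}
    (hf : ∀ x < u, HasDerivAt f (f' x) x) (hf' : ContinuousOn f' (Iio u)) {a b : ℝ} (ha : a < u)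
    (hb : b < u) :
    HasDerivAt (fun y => 2 * (y - b) ^ (j + 1) *
        ∫ θ in 0..π / 2, cos θ ^ 2 * sin θ ^ (2 * j) * f (arc y b θ))
      ((a - b) ^ j * ∫ θ in 0..π / 2, sin θ ^ (2 * j) * f (arc a b θ)) a := by
  have hfc : ContinuousOn f (Iio u) := fun x hx => (hf x hx).continuousAt.continuousWithinAt
  have hcf : ∀ y < u, Continuous fun θ => f (arc y b θ) := fun y hy =>
    hfc.comp_continuous (by fun_prop) fun θ => arc_lt hy hb θ
  have hcf' : ∀ y < u, Continuous fun θ => f' (arc y b θ) := fun y hy =>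
    hf'.comp_continuous (by fun_prop) fun θ => arc_lt hy hb θ
  have h1 : HasDerivAt (fun y => ∫ θ in 0..π / 2, cos θ ^ 2 * sin θ ^ (2 * j) * f (arc y b θ))
      (∫ θ in 0..π / 2, cos θ ^ 2 * sin θ ^ (2 * j) * (f' (arc a b θ) * sin θ ^ 2)) a := by
    refine hasDerivAt_integral_of_continuousOn
      (g' := fun y θ => cos θ ^ 2 * sin θ ^ (2 * j) * (f' (arc y b θ) * sin θ ^ 2))
      isOpen_Iio 0 (π / 2) ?_ ?_ ?_ ha
    · intro y hy θ
      have harc : HasDerivAt (fun y => arc y b θ) (sin θ ^ 2) y := by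
        unfold arc
        simpa using ((hasDerivAt_id y).mul_const (sin θ ^ 2)).add_const (b * cos θ ^ 2)
      exact ((hf _ (arc_lt hy hb θ)).comp y harc).const_mul _
    · intro y hy
      exact (by fun_prop : Continuous fun θ => cos θ ^ 2 * sin θ ^ (2 * j)).mul (hcf y hy)
    · have : ContinuousOn (fun z : ℝ × ℝ => f' (arc z.1 b z.2)) (Iio u ×ˢ univ) :=
        hf'.comp (Continuous.continuousOn (by fun_prop)) fun z hz => arc_lt hz.1 hb z.2
      exact (by fun_prop : Continuous fun z : ℝ × ℝ =>
        cos z.2 ^ 2 * sin z.2 ^ (2 * j)).continuousOn.mul (this.mul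
        (by fun_prop : Continuous fun z : ℝ × ℝ => sin z.2 ^ 2).continuousOn)
  -- The integral of the derivative of cos θ sin^(2j+1) θ f(arc), which vanishes at both ends; it
  -- eliminates f'.
  have hibp : ∫ θ in 0..π / 2, ((-sin θ ^ (2 * j + 2) +
      (2 * j + 1) * (cos θ ^ 2 * sin θ ^ (2 * j))) * f (arc a b θ) +
      cos θ * sin θ ^ (2 * j + 1) * (f' (arc a b θ) * ((a - b) * (2 * sin θ * cos θ)))) = 0 := by
    have hder : ∀ θ ∈ uIcc 0 (π / 2), HasDerivAt (fun θ => cos θ * sin θ ^ (2 * j + 1) *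
        f (arc a b θ)) ((-sin θ ^ (2 * j + 2) +
        (2 * j + 1) * (cos θ ^ 2 * sin θ ^ (2 * j))) * f (arc a b θ) +
        cos θ * sin θ ^ (2 * j + 1) * (f' (arc a b θ) * ((a - b) * (2 * sin θ * cos θ)))) θ := by
      intro θ _
      have harc : HasDerivAt (fun θ => arc a b θ) ((a - b) * (2 * sin θ * cos θ)) θ := by
        simp only [arc_eq_add]
        have := (((hasDerivAt_sin θ).pow 2).const_mul (a - b)).const_add b
        refine this.congr_deriv ?_
        simp
      have h := ((hasDerivAt_cos θ).mul ((hasDerivAt_sin θ).pow (2 * j + 1))).mul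
        ((hf _ (arc_lt ha hb θ)).comp θ harc)
      refine h.congr_deriv ?_
      simp only [Pi.mul_apply, Pi.pow_apply, Function.comp_apply, Nat.add_sub_cancel]
      push_cast
      ring
    rw [intervalIntegral.integral_eq_sub_of_hasDerivAt hder]
    · simp
    · apply Continuous.intervalIntegrable
      exact ((by fun_prop : Continuous fun θ => (-sin θ ^ (2 * j + 2) +
        (2 * j + 1) * (cos θ ^ 2 * sin θ ^ (2 * j)))).mul (hcf a ha)).add
        ((by fun_prop : Continuous fun θ => cos θ * sin θ ^ (2 * j + 1)).mul
        ((hcf' a ha).mul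
          (by fun_prop : Continuous fun θ => (a - b) * (2 * sin θ * cos θ))))
  have h2 := ((((hasDerivAt_id a).sub_const b).pow (j + 1)).const_mul 2).mul h1
  refine h2.congr_deriv ?_
  have e1 := hcf a ha
  have e2 := hcf' a ha
  simp only [Pi.pow_apply, id, Nat.add_sub_cancel]
  have i1 : Continuous fun θ => cos θ ^ 2 * sin θ ^ (2 * j) * f (arc a b θ) :=
    (by fun_prop : Continuous fun θ => cos θ ^ 2 * sin θ ^ (2 * j)).mul e1
  have i2 : Continuous fun θ => cos θ ^ 2 * sin θ ^ (2 * j) * (f' (arc a b θ) * sin θ ^ 2) :=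
    (by fun_prop : Continuous fun θ => cos θ ^ 2 * sin θ ^ (2 * j)).mul
      (e2.mul (by fun_prop : Continuous fun θ => sin θ ^ 2))
  have i3 : Continuous fun θ => sin θ ^ (2 * j) * f (arc a b θ) :=
    (by fun_prop : Continuous fun θ => sin θ ^ (2 * j)).mul e1
  rw [← sub_eq_zero]
  refine Eq.trans ?_ ((congrArg (fun y => (a - b) ^ j * y) hibp).trans (mul_zero _))
  simp only [← intervalIntegral.integral_const_mul]
  rw [← intervalIntegral.integral_add, ← intervalIntegral.integral_sub]
  · refine intervalIntegral.integral_congr fun θ _ => ?_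
    have hs := sin_sq_add_cos_sq θ
    have hc : cos θ ^ 2 = 1 - sin θ ^ 2 := by linarith
    push_cast
    have e3 : sin θ ^ (2 * j + 2) = sin θ ^ (2 * j) * sin θ ^ 2 := by ring
    have e4 : cos θ * sin θ ^ (2 * j + 1) * (f' (arc a b θ) * ((a - b) * (2 * sin θ * cos θ))) =
      2 * (a - b) * f' (arc a b θ) * sin θ ^ (2 * j) * cos θ ^ 2 * sin θ ^ 2 := by ring
    simp only [e3, e4, hc]
    ring
  · exact ((i1.const_mul _).add (i2.const_mul _)).intervalIntegrable _ _
  · exact (i3.const_mul _).intervalIntegrable _ _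
  · exact (i1.const_mul _).intervalIntegrable _ _
  · exact (i2.const_mul _).intervalIntegrable _ _

/-! ### The expansion of the square root and its polynomial part. -/

/-- The expansion of `√((ξ - u) ξ / ((ξ - a) (ξ - b)))` in powers of `X = 1 / ξ`. -/
def wSeries (u a b : ℝ) : PowerSeries ℝ := pow1 (-1 / 2) a * (pow1 (1 / 2) u * pow1 (-1 / 2) b)

/-- The coefficients of `wSeries`. -/
def wCoeff (k : ℕ) (u a b : ℝ) : ℝ := PowerSeries.coeff k (wSeries u a b)

/-- The polynomial part of `ξ ^ (m - 1) √((ξ - u) ξ / ((ξ - a) (ξ - b)))`. -/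
def wPoly (m : ℕ) (u a b ξ : ℝ) : ℝ := ∑ k ∈ Finset.range m, wCoeff k u a b * ξ ^ (m - 1 - k)

lemma wSeries_symm (u a b : ℝ) : wSeries u a b = wSeries u b a := by
  unfold wSeries; ring

lemma wCoeff_symm (k : ℕ) (u a b : ℝ) : wCoeff k u a b = wCoeff k u b a := by
  rw [wCoeff, wSeries_symm, wCoeff]

lemma wPoly_symm (m : ℕ) (u a b ξ : ℝ) : wPoly m u a b ξ = wPoly m u b a ξ := by
  simp only [wPoly, wCoeff_symm _ u a b]

@[simp] lemma wCoeff_zero (u a b : ℝ) : wCoeff 0 u a b = 1 := by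
  simp [wCoeff, wSeries, PowerSeries.coeff_mul]

lemma coeff_pow1_neg_one_mul (n : ℕ) (x : ℝ) (Z : PowerSeries ℝ) :
    PowerSeries.coeff n (pow1 (-1) x * Z) =
      ∑ k ∈ Finset.range (n + 1), PowerSeries.coeff k Z * x ^ (n - k) := by
  rw [mul_comm, PowerSeries.coeff_mul, Finset.Nat.sum_antidiagonal_eq_sum_range_succ_mk]
  simp

/-- Multiplication by the geometric series (1 - ξX)^(-1) collects the truncated sum in one
coefficient. At ξ = a it merges with (1 - aX)^(-1/2), whence the exponent -3/2 in `wPoly_self`. -/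
lemma wPoly_succ_eq_coeff (n : ℕ) (u a b ξ : ℝ) :
    wPoly (n + 1) u a b ξ = PowerSeries.coeff n (pow1 (-1) ξ * wSeries u a b) := by
  rw [coeff_pow1_neg_one_mul]; simp [wPoly, wCoeff]

lemma wPoly_succ_zero (n : ℕ) (a ξ : ℝ) : wPoly (n + 1) 1 a 0 ξ = signPoly n (-1) a ξ := by
  rw [wPoly_succ_eq_coeff, signPoly, wSeries, pow1_zero_right, mul_one,
    mul_comm (pow1 (-1 / 2) a)]

lemma wPoly_self (n : ℕ) (a b : ℝ) : wPoly (n + 1) 1 a b a = signPoly n (-3 / 2) b a := by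
  rw [wPoly_succ_eq_coeff, signPoly, wSeries, ← mul_assoc, ← pow1_add]
  norm_num

lemma continuous_wCoeff (k : ℕ) :
    Continuous fun p : ℝ × ℝ × ℝ => wCoeff k p.1 p.2.1 p.2.2 := by
  unfold wCoeff wSeries
  exact continuous_coeff_mul (continuous_coeff_pow1_comp (by fun_prop) _)
    (continuous_coeff_mul (continuous_coeff_pow1_comp (by fun_prop) _)
      (continuous_coeff_pow1_comp (by fun_prop) _)) k

lemma continuous_wPoly (m : ℕ) :
    Continuous fun p : (ℝ × ℝ × ℝ) × ℝ => wPoly m p.1.1 p.1.2.1 p.1.2.2 p.2 := by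
  unfold wPoly
  exact continuous_finsetSum _ fun k _ =>
    ((continuous_wCoeff k).comp continuous_fst).mul (continuous_snd.pow _)

lemma hasDerivAt_wCoeff (k : ℕ) (u a b : ℝ) :
    HasDerivAt (fun y => wCoeff k u y b) (1 / 2 * PowerSeries.coeff k (PowerSeries.X *
      (pow1 (-3 / 2) a * (pow1 (1 / 2) u * pow1 (-1 / 2) b)))) a := by
  unfold wCoeff wSeries
  refine (hasDerivAt_coeff_pow1_mul (-1 / 2) a _ k).congr_deriv ?_
  norm_num

lemma hasDerivAt_wCoeff_succ (n : ℕ) (a b : ℝ) :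
    HasDerivAt (fun y => wCoeff (n + 1) 1 y b) (1 / 2 * signPoly n (-3 / 2) b a) a := by
  have := hasDerivAt_wCoeff (n + 1) 1 a b
  rwa [PowerSeries.coeff_succ_X_mul] at this

/-- Since (a-x)X + (1-aX) = 1 - xX, the geometric factor in x cancels and the result no longer
depends on x. This is why σ comes out of the integral in `hasDerivAt_ellF`. -/
lemma wPoly_add_deriv (n : ℕ) (u a b x : ℝ) :
    ∑ k ∈ Finset.range (n + 1), ((a - x) * PowerSeries.coeff k (PowerSeries.X *
      (pow1 (-3 / 2) a * (pow1 (1 / 2) u * pow1 (-1 / 2) b))) + wCoeff k u a b) * x ^ (n - k) =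
    PowerSeries.coeff n (pow1 (-3 / 2) a * (pow1 (1 / 2) u * pow1 (-1 / 2) b)) := by
  set Z := pow1 (1 / 2) u * pow1 (-1 / 2) b with hZ
  have h := coeff_pow1_neg_one_mul n x
    (PowerSeries.C (a - x) * (PowerSeries.X * (pow1 (-3 / 2) a * Z)) + pow1 (-1 / 2) a * Z)
  simp only [map_add, PowerSeries.coeff_C_mul] at h
  simp only [wCoeff, wSeries, ← hZ]
  rw [← h]
  congr 1
  have h1 : pow1 (-1 / 2) a = pow1 1 a * pow1 (-3 / 2) a := by rw [← pow1_add]; norm_num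
  have h2 := pow1_mul_neg_one x
  rw [pow1_one] at h1 h2
  rw [h1, map_sub]
  linear_combination (pow1 (-3 / 2) a * Z) * h2

/-! ### The elliptic integrals and their derivatives. -/

/-- `(√(u - arc a b θ))⁻¹` -/
def ker (u a b θ : ℝ) : ℝ := (√(u - arc a b θ))⁻¹

lemma ker_pos {u a b : ℝ} (ha : a < u) (hb : b < u) (θ : ℝ) : 0 < ker u a b θ := by
  have := arc_lt ha hb θ
  exact inv_pos.2 (Real.sqrt_pos.2 (by linarith))

lemma continuous_ker {u a b : ℝ} (ha : a < u) (hb : b < u) : Continuous (ker u a b) := by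
  unfold ker
  refine Continuous.inv₀ (by fun_prop) fun θ => ?_
  have := arc_lt ha hb θ
  exact (Real.sqrt_pos.2 (by linarith)).ne'

/-- Half of the integral of `√((ξ - b) / ((a - ξ) (u - ξ))) / (a - b)` between `b` and `a`. -/
def ellJ (u a b : ℝ) : ℝ := ∫ θ in 0..π / 2, sin θ ^ 2 * ker u a b θ

/-- Half of the integral of `1 / √((a - ξ) (ξ - b) (u - ξ))` between `b` and `a`. -/
def ellK (u a b : ℝ) : ℝ := ∫ θ in 0..π / 2, ker u a b θ

/-- Half of the integral of `wPoly m u a b ξ √((a - ξ) (ξ - b) / (u - ξ)) / (a - b) ^ 2`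
between `b` and `a`. -/
def ellN (m : ℕ) (u a b : ℝ) : ℝ :=
  ∫ θ in 0..π / 2, cos θ ^ 2 * sin θ ^ 2 * (wPoly m u a b (arc a b θ) * ker u a b θ)

/-- The integral of `wPoly m u a b ξ √((a - ξ) (ξ - b) / (u - ξ))` between `b` and `a`. -/
def ellF (m : ℕ) (u a b : ℝ) : ℝ := 2 * (a - b) ^ 2 * ellN m u a b

lemma integral_reflect (g : ℝ → ℝ) :
    ∫ θ in 0..π / 2, g (π / 2 - θ) = ∫ θ in 0..π / 2, g θ := by
  rw [intervalIntegral.integral_comp_sub_left]; simp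

lemma ker_reflect (u a b θ : ℝ) : ker u a b (π / 2 - θ) = ker u b a θ := by
  rw [ker, arc_pi_div_two_sub, ker]

lemma ellJ_symm (u a b : ℝ) : ellJ u b a = ∫ θ in 0..π / 2, cos θ ^ 2 * ker u a b θ := by
  rw [ellJ, ← integral_reflect]
  simp only [ker_reflect, sin_pi_div_two_sub]

lemma ellN_symm (m : ℕ) (u a b : ℝ) : ellN m u b a = ellN m u a b := by
  rw [ellN, ← integral_reflect, ellN]
  simp only [ker_reflect, sin_pi_div_two_sub, cos_pi_div_two_sub, arc_pi_div_two_sub,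
    wPoly_symm m u b a, mul_comm (sin _ ^ 2)]

lemma ellF_symm (m : ℕ) (u a b : ℝ) : ellF m u b a = ellF m u a b := by
  rw [ellF, ellN_symm, ellF]; ring

@[simp] lemma ellF_self (m : ℕ) (u a : ℝ) : ellF m u a a = 0 := by simp [ellF]

lemma ellJ_add {u a b : ℝ} (ha : a < u) (hb : b < u) : ellJ u a b + ellJ u b a = ellK u a b := by
  have hk := continuous_ker ha hb
  rw [ellJ_symm u a b, ellJ, ← intervalIntegral.integral_add, ellK]
  · refine intervalIntegral.integral_congr fun θ _ => ?_
    simp only [← add_mul, sin_sq_add_cos_sq, one_mul]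
  · exact Continuous.intervalIntegrable (by fun_prop) _ _
  · exact Continuous.intervalIntegrable (by fun_prop) _ _

lemma ellJ_pos {u a b : ℝ} (ha : a < u) (hb : b < u) : 0 < ellJ u a b := by
  have hk := continuous_ker ha hb
  have hpi := Real.pi_pos
  refine intervalIntegral.intervalIntegral_pos_of_pos_on
    (Continuous.intervalIntegrable (by fun_prop) _ _) (fun θ hθ => ?_) (by linarith)
  have h1 : 0 < sin θ := sin_pos_of_pos_of_lt_pi hθ.1 (by linarith [hθ.2])
  exact mul_pos (by positivity) (ker_pos ha hb θ)

lemma ellK_pos {u a b : ℝ} (ha : a < u) (hb : b < u) : 0 < ellK u a b := by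
  rw [← ellJ_add ha hb]; exact add_pos (ellJ_pos ha hb) (ellJ_pos hb ha)

/-- The region in which the elliptic integrals are continuous. -/
def region : Set (ℝ × ℝ × ℝ) := {p | p.2.1 < p.1 ∧ p.2.2 < p.1}

lemma isOpen_region : IsOpen region :=
  (isOpen_lt (f := fun p : ℝ × ℝ × ℝ => p.2.1) (by fun_prop) continuous_fst).inter
    (isOpen_lt (f := fun p : ℝ × ℝ × ℝ => p.2.2) (by fun_prop) continuous_fst)

lemma continuousOn_integral_ker {h : ℝ → ℝ} (hh : Continuous h) {G : (ℝ × ℝ × ℝ) × ℝ → ℝ}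
    (hG : Continuous G) :
    ContinuousOn (fun p : ℝ × ℝ × ℝ => ∫ θ in 0..π / 2,
      h θ * (G (p, arc p.2.1 p.2.2 θ) * ker p.1 p.2.1 p.2.2 θ)) region := by
  rw [continuousOn_iff_continuous_domRestrict]
  have : Continuous fun z : region × ℝ =>
      h z.2 * (G (z.1.1, arc z.1.1.2.1 z.1.1.2.2 z.2) * ker z.1.1.1 z.1.1.2.1 z.1.1.2.2 z.2) := by
    refine (hh.comp continuous_snd).mul ((hG.comp (by fun_prop)).mul ?_)
    unfold ker
    refine Continuous.inv₀ (by fun_prop) fun z => ?_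
    have := arc_lt z.1.2.1 z.1.2.2 z.2
    exact (Real.sqrt_pos.2 (by linarith)).ne'
  exact intervalIntegral.continuous_parametric_intervalIntegral_of_continuous' this _ _

lemma continuousOn_ellJ : ContinuousOn (fun p : ℝ × ℝ × ℝ => ellJ p.1 p.2.1 p.2.2) region := by
  have := continuousOn_integral_ker (h := fun θ => sin θ ^ 2) (by fun_prop) (G := fun _ => 1)
    continuous_const
  simpa [ellJ] using this

lemma continuousOn_ellN (m : ℕ) :
    ContinuousOn (fun p : ℝ × ℝ × ℝ => ellN m p.1 p.2.1 p.2.2) region :=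
  continuousOn_integral_ker (h := fun θ => cos θ ^ 2 * sin θ ^ 2) (by fun_prop)
    (continuous_wPoly m)

lemma hasDerivAt_inv_sqrt {u x : ℝ} (hx : x < u) :
    HasDerivAt (fun x => (√(u - x))⁻¹) (1 / 2 * (√(u - x))⁻¹ ^ 3) x := by
  have h0 : 0 < √(u - x) := Real.sqrt_pos.2 (by linarith)
  have h1 : HasDerivAt (fun x => u - x) (-1) x := by
    simpa using (hasDerivAt_id x).const_sub u
  refine ((h1.sqrt (by linarith)).inv h0.ne').congr_deriv ?_
  field_simp

lemma continuousOn_inv_sqrt (u : ℝ) : ContinuousOn (fun x => (√(u - x))⁻¹) (Iio u) :=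
  fun _ hx => (hasDerivAt_inv_sqrt hx).continuousAt.continuousWithinAt

/-- The integral of `√((a - ξ) / ((ξ - b) (u - ξ)))` between `b` and `a`, differentiated in `a`. -/
lemma hasDerivAt_ellJ {u a b : ℝ} (ha : a < u) (hb : b < u) :
    HasDerivAt (fun y => 2 * (y - b) * ellJ u b y) (ellK u a b) a := by
  have h := hasDerivAt_arc_integral 0 (fun x hx => hasDerivAt_inv_sqrt hx)
    (((continuousOn_inv_sqrt u).pow 3).const_mul (1 / 2)) ha hb
  simp only [mul_zero, pow_zero, mul_one, one_mul, zero_add, pow_one] at h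
  simp only [ellJ_symm, ellK, ker]
  exact h

/-- F is expanded over the powers of ξ and each is differentiated by `hasDerivAt_arc_integral` with
j = 1. Together with the derivatives of the w_k, `wPoly_add_deriv` leaves the constant σ times sin²
θ `ker`, the integrand of J. -/
lemma hasDerivAt_ellF (n : ℕ) {u a b : ℝ} (ha : a < u) (hb : b < u) :
    HasDerivAt (fun y => ellF (n + 1) u y b)
      ((a - b) * PowerSeries.coeff n (pow1 (-3 / 2) a * (pow1 (1 / 2) u * pow1 (-1 / 2) b)) *
        ellJ u a b) a := by
  have hE : ∀ k, HasDerivAt (fun y => 2 * (y - b) ^ (1 + 1) *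
      ∫ θ in 0..π / 2, cos θ ^ 2 * sin θ ^ (2 * 1) * (arc y b θ ^ (n - k) * ker u y b θ))
      ((a - b) ^ 1 * ∫ θ in 0..π / 2, sin θ ^ (2 * 1) * (arc a b θ ^ (n - k) * ker u a b θ)) a := by
    intro k
    refine hasDerivAt_arc_integral 1 (f := fun x => x ^ (n - k) * (√(u - x))⁻¹)
      (fun x hx => (hasDerivAt_pow _ x).mul (hasDerivAt_inv_sqrt hx)) ?_ ha hb
    have := continuousOn_inv_sqrt u
    fun_prop
  have hF : ∀ y < u, ellF (n + 1) u y b = ∑ k ∈ Finset.range (n + 1), wCoeff k u y b *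
      (2 * (y - b) ^ (1 + 1) *
      ∫ θ in 0..π / 2, cos θ ^ 2 * sin θ ^ (2 * 1) * (arc y b θ ^ (n - k) * ker u y b θ)) := by
    intro y hy
    have hk := continuous_ker hy hb
    rw [ellF, ellN]
    simp only [← intervalIntegral.integral_const_mul]
    rw [← intervalIntegral.integral_finsetSum]
    · refine intervalIntegral.integral_congr fun θ _ => ?_
      simp only [wPoly, Nat.add_sub_cancel, Finset.sum_mul, Finset.mul_sum]
      exact Finset.sum_congr rfl fun k _ => by ring
    · intro k _
      exact Continuous.intervalIntegrable (by fun_prop) _ _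
  have hsum := HasDerivAt.fun_sum (u := Finset.range (n + 1))
    fun k _ => (hasDerivAt_wCoeff k u a b).mul (hE k)
  refine (hsum.congr_of_eventuallyEq
    (by filter_upwards [isOpen_Iio.mem_nhds ha] with y hy using hF y hy)).congr_deriv ?_
  have hk := continuous_ker ha hb
  rw [ellJ, ← intervalIntegral.integral_const_mul]
  simp only [← intervalIntegral.integral_const_mul]
  rw [← Finset.sum_congr rfl fun k _ => intervalIntegral.integral_add ?_ ?_,
    ← intervalIntegral.integral_finsetSum]
  · refine intervalIntegral.integral_congr fun θ _ => ?_
    rw [← wPoly_add_deriv n u a b (arc a b θ), Finset.mul_sum, Finset.sum_mul]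
    refine Finset.sum_congr rfl fun k _ => ?_
    rw [sub_arc]
    ring
  · intro k _
    exact Continuous.intervalIntegrable (by fun_prop) _ _
  · exact Continuous.intervalIntegrable (by fun_prop) _ _
  · exact Continuous.intervalIntegrable (by fun_prop) _ _

lemma hasDerivAt_ellF_one (n : ℕ) {a b : ℝ} (ha : a < 1) (hb : b < 1) :
    HasDerivAt (fun y => ellF (n + 1) 1 y b)
      ((a - b) * signPoly n (-3 / 2) b a * ellJ 1 a b) a :=
  hasDerivAt_ellF n ha hb

/-! ### Change of variables in the period integrals. -/

section Integrals

variable {u a b : ℝ}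

lemma arc_image (hab : b < a) : arc a b '' Ioo 0 (π / 2) = Ioo b a := by
  have hd : 0 < a - b := by linarith
  ext x
  constructor
  · rintro ⟨θ, hθ, rfl⟩
    have h1 : 0 < sin θ := sin_pos_of_pos_of_lt_pi hθ.1 (by linarith [hθ.2, pi_pos])
    have h2 : 0 < cos θ := cos_pos_of_mem_Ioo ⟨by linarith [hθ.1, pi_pos], hθ.2⟩
    have e1 := arc_sub a b θ
    have e2 := sub_arc a b θ
    have : 0 < (a - b) * sin θ ^ 2 := by positivity
    have : 0 < (a - b) * cos θ ^ 2 := by positivity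
    exact ⟨by linarith, by linarith⟩
  · rintro ⟨h1, h2⟩
    have h3 : 0 < (x - b) / (a - b) := div_pos (by linarith) hd
    have h4 : (x - b) / (a - b) < 1 := (div_lt_one hd).2 (by linarith)
    have h5 : 0 < √((x - b) / (a - b)) := Real.sqrt_pos.2 h3
    have h6 : √((x - b) / (a - b)) < 1 := by
      rw [Real.sqrt_lt' one_pos]; simpa using h4
    refine ⟨arcsin (√((x - b) / (a - b))), ⟨arcsin_pos.2 h5, arcsin_lt_pi_div_two.2 h6⟩, ?_⟩
    rw [arc_eq_add, sin_arcsin (by linarith) h6.le, Real.sq_sqrt h3.le]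
    field_simp
    ring

lemma hasDerivAt_arc (a b θ : ℝ) : HasDerivAt (arc a b) ((a - b) * (2 * sin θ * cos θ)) θ := by
  have h := (((hasDerivAt_sin θ).pow 2).const_mul (a - b)).const_add b
  have e : arc a b = fun θ => b + (a - b) * (sin ^ 2) θ := by
    funext θ; rw [arc_eq_add]; rfl
  rw [e]
  refine h.congr_deriv ?_
  simp

lemma arc_injOn (hab : b < a) : InjOn (arc a b) (Ioo 0 (π / 2)) := by
  intro x hx y hy h
  rw [arc_eq_add, arc_eq_add] at h
  have hd : a - b ≠ 0 := by linarith
  have h1 : sin x ^ 2 = sin y ^ 2 := mul_left_cancel₀ hd (by linarith)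
  have hx1 : 0 < sin x := sin_pos_of_pos_of_lt_pi hx.1 (by linarith [hx.2, pi_pos])
  have hy1 : 0 < sin y := sin_pos_of_pos_of_lt_pi hy.1 (by linarith [hy.2, pi_pos])
  have h2 : sin x = sin y := by
    rw [pow_left_inj₀ hx1.le hy1.le two_ne_zero] at h1; exact h1
  exact injOn_sin ⟨by linarith [hx.1, pi_pos], hx.2.le⟩ ⟨by linarith [hy.1, pi_pos], hy.2.le⟩ h2

/-- On the arc the cubic equals (u-ξ) ((a-b) sin θ cos θ)², so its root cancels the Jacobian up to
`ker` and the factor 2. -/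
lemma abs_deriv_mul_div_sqrt_cubic (hab : b < a) (g : ℝ → ℝ) {θ : ℝ}
    (hθ : θ ∈ Ioo 0 (π / 2)) :
    |(a - b) * (2 * sin θ * cos θ)| • (g (arc a b θ) / √(cubic u a b (arc a b θ))) =
      2 * (g (arc a b θ) * ker u a b θ) := by
  have hd : 0 < a - b := by linarith
  have h1 : 0 < sin θ := sin_pos_of_pos_of_lt_pi hθ.1 (by linarith [hθ.2, pi_pos])
  have h2 : 0 < cos θ := cos_pos_of_mem_Ioo ⟨by linarith [hθ.1, pi_pos], hθ.2⟩
  have e : cubic u a b (arc a b θ) = (u - arc a b θ) * ((a - b) * (sin θ * cos θ)) ^ 2 := by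
    have e1 := arc_sub a b θ
    have e2 := sub_arc a b θ
    calc cubic u a b (arc a b θ) =
        (u - arc a b θ) * ((a - arc a b θ) * (arc a b θ - b)) := by unfold cubic; ring
      _ = _ := by rw [e1, e2]; ring
  rw [e, Real.sqrt_mul' _ (sq_nonneg _), Real.sqrt_sq (by positivity), abs_of_pos (by positivity),
    ker, smul_eq_mul, div_eq_mul_inv, mul_inv]
  field_simp

lemma integral_div_sqrt_cubic (hab : b < a) (g : ℝ → ℝ) :
    ∫ ξ in b..a, g ξ / √(cubic u a b ξ) =
      2 * ∫ θ in 0..π / 2, g (arc a b θ) * ker u a b θ := by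
  rw [intervalIntegral.integral_of_le hab.le, MeasureTheory.integral_Ioc_eq_integral_Ioo,
    ← arc_image hab, MeasureTheory.integral_image_eq_integral_abs_deriv_smul measurableSet_Ioo
      (fun θ _ => (hasDerivAt_arc a b θ).hasDerivWithinAt) (arc_injOn hab),
    MeasureTheory.setIntegral_congr_fun measurableSet_Ioo
      fun θ hθ => abs_deriv_mul_div_sqrt_cubic hab g hθ,
    ← intervalIntegral.integral_const_mul,
    intervalIntegral.integral_of_le (by positivity : (0 : ℝ) ≤ π / 2),
    MeasureTheory.integral_Ioc_eq_integral_Ioo]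

lemma intervalIntegrable_div_sqrt_cubic (hab : b < a) (hau : a < u) {g : ℝ → ℝ}
    (hg : Continuous g) :
    IntervalIntegrable (fun ξ => g ξ / √(cubic u a b ξ)) MeasureTheory.volume b a := by
  have hk := continuous_ker hau (hab.trans hau)
  rw [intervalIntegrable_iff_integrableOn_Ioo_of_le hab.le, ← arc_image hab,
    MeasureTheory.integrableOn_image_iff_integrableOn_abs_deriv_smul measurableSet_Ioo
      (fun θ _ => (hasDerivAt_arc a b θ).hasDerivWithinAt) (arc_injOn hab),
    MeasureTheory.integrableOn_congr_fun
      (fun θ hθ => abs_deriv_mul_div_sqrt_cubic hab g hθ) measurableSet_Ioo,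
    ← intervalIntegrable_iff_integrableOn_Ioo_of_le (by positivity : (0 : ℝ) ≤ π / 2)]
  exact Continuous.intervalIntegrable (by fun_prop) _ _

/-- The first moment of `ker`. -/
lemma integral_arc_mul_ker (hau : a < u) (hbu : b < u) :
    ∫ θ in 0..π / 2, arc a b θ * ker u a b θ = a * ellK u a b - (a - b) * ellJ u b a := by
  have hk := continuous_ker hau hbu
  rw [ellJ_symm, ellK, ← intervalIntegral.integral_const_mul, ← intervalIntegral.integral_const_mul,
    ← intervalIntegral.integral_sub]
  · refine intervalIntegral.integral_congr fun θ _ => ?_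
    have := sub_arc a b θ
    linear_combination (-ker u a b θ) * this
  · exact Continuous.intervalIntegrable (by fun_prop) _ _
  · exact Continuous.intervalIntegrable (by fun_prop) _ _

end Integrals

/-! ### The explicit Whitham polynomial: existence and uniqueness. -/

section Polynomial

open Polynomial

/-- The Whitham polynomial up to the choice of its constant term. -/
def explicitP (n : ℕ) (u a b κ : ℝ) : ℝ[X] :=
  (X - Polynomial.C a) * (X - Polynomial.C b) *
    ∑ k ∈ Finset.range n, Polynomial.C (wCoeff k u a b) * X ^ (n - 1 - k) +
    Polynomial.C (wCoeff n u a b) * X + Polynomial.C κ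

lemma eval_explicitP (n : ℕ) (u a b κ x : ℝ) : (explicitP n u a b κ).eval x =
    (x - a) * (x - b) * wPoly n u a b x + wCoeff n u a b * x + κ := by
  simp [explicitP, wPoly, eval_finsetSum]

lemma explicitP_monic_natDegree (n : ℕ) (u a b κ : ℝ) :
    (explicitP n u a b κ).Monic ∧ (explicitP n u a b κ).natDegree = n + 1 := by
  cases n with
  | zero =>
    simp only [explicitP, Finset.range_zero, Finset.sum_empty, mul_zero, zero_add, wCoeff_zero,
      map_one, one_mul]
    exact ⟨monic_X_add_C κ, natDegree_X_add_C κ⟩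
  | succ n =>
    have hrest : (∑ k ∈ Finset.range n, Polynomial.C (wCoeff (k + 1) u a b) *
        X ^ (n - (k + 1)) : ℝ[X]).degree < n := by
      rw [← mem_degreeLT]
      refine Submodule.sum_mem _ fun k hk => ?_
      rw [mem_degreeLT]
      refine (degree_C_mul_X_pow_le _ _).trans_lt ?_
      have := Finset.mem_range.1 hk
      exact_mod_cast (by omega : n - (k + 1) < n)
    have hT : (∑ k ∈ Finset.range (n + 1), Polynomial.C (wCoeff k u a b) *
        X ^ (n + 1 - 1 - k) : ℝ[X]) = X ^ n + ∑ k ∈ Finset.range n,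
          Polynomial.C (wCoeff (k + 1) u a b) * X ^ (n - (k + 1)) := by
      rw [Finset.sum_range_succ', add_comm]
      simp
    have hTm := monic_X_pow_add hrest
    have hTd := natDegree_eq_of_degree_eq_some
      ((degree_add_eq_left_of_degree_lt ((degree_X_pow (R := ℝ) n).symm ▸ hrest)).trans
        (degree_X_pow n))
    have hAm : ((X - Polynomial.C a) * (X - Polynomial.C b)).Monic :=
      (monic_X_sub_C a).mul (monic_X_sub_C b)
    have hBm := hAm.mul hTm
    have hBd : ((X - Polynomial.C a) * (X - Polynomial.C b) * (X ^ n + ∑ k ∈ Finset.range n,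
          Polynomial.C (wCoeff (k + 1) u a b) * X ^ (n - (k + 1)))).natDegree = n + 2 := by
      rw [hAm.natDegree_mul hTm, (monic_X_sub_C a).natDegree_mul (monic_X_sub_C b), hTd,
        natDegree_X_sub_C, natDegree_X_sub_C]
      ring
    have hlow : (Polynomial.C (wCoeff (n + 1) u a b) * X + Polynomial.C κ).degree <
        ((X - Polynomial.C a) * (X - Polynomial.C b) * (X ^ n + ∑ k ∈ Finset.range n,
          Polynomial.C (wCoeff (k + 1) u a b) * X ^ (n - (k + 1)))).degree := by
      rw [degree_eq_natDegree hBm.ne_zero, hBd]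
      refine degree_linear_le.trans_lt ?_
      exact_mod_cast (by omega : 1 < n + 2)
    rw [explicitP, hT, add_assoc]
    exact ⟨hBm.add_of_left hlow, by rw [natDegree_add_eq_left_of_degree_lt hlow, hBd]⟩

/-- The truncation of `wSeries` is an approximate square root. -/
lemma exists_trunc_wSeries_sq (n : ℕ) (u a b : ℝ) : ∃ r : ℝ[X], ∀ z : ℝ,
    (∑ k ∈ Finset.range (n + 1), wCoeff k u a b * z ^ k) ^ 2 * ((1 - a * z) * (1 - b * z)) =
      (1 - u * z) + z ^ (n + 1) * r.eval z := by
  set T : ℝ[X] := PowerSeries.trunc (n + 1) (wSeries u a b) with hT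
  have hd : (X : ℝ[X]) ^ (n + 1) ∣ T ^ 2 * ((1 - Polynomial.C a * X) * (1 - Polynomial.C b * X)) -
      (1 - Polynomial.C u * X) := by
    rw [X_pow_dvd_iff]
    have hps : (PowerSeries.X : PowerSeries ℝ) ^ (n + 1) ∣
        ((T ^ 2 * ((1 - Polynomial.C a * X) * (1 - Polynomial.C b * X)) -
          (1 - Polynomial.C u * X) : ℝ[X]) : PowerSeries ℝ) := by
      have h1 := PowerSeries.eq_X_pow_mul_shift_add_trunc (n + 1) (wSeries u a b)
      rw [← hT] at h1
      set V := PowerSeries.mk fun i => PowerSeries.coeff (i + (n + 1)) (wSeries u a b)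
      have hTW : (T : PowerSeries ℝ) = wSeries u a b - PowerSeries.X ^ (n + 1) * V := by
        rw [eq_sub_iff_add_eq, add_comm]; exact h1.symm
      have hW : wSeries u a b ^ 2 * (pow1 1 a * pow1 1 b) = pow1 1 u := by
        have ha : pow1 (-1 / 2) a * pow1 (-1 / 2) a * pow1 1 a = 1 := by
          rw [← pow1_add, ← pow1_add]; norm_num
        have hb : pow1 (-1 / 2) b * pow1 (-1 / 2) b * pow1 1 b = 1 := by
          rw [← pow1_add, ← pow1_add]; norm_num
        have hu : pow1 (1 / 2) u * pow1 (1 / 2) u = pow1 1 u := by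
          rw [← pow1_add]; norm_num
        calc wSeries u a b ^ 2 * (pow1 1 a * pow1 1 b) =
            (pow1 (-1 / 2) a * pow1 (-1 / 2) a * pow1 1 a) *
            (pow1 (-1 / 2) b * pow1 (-1 / 2) b * pow1 1 b) *
            (pow1 (1 / 2) u * pow1 (1 / 2) u) := by unfold wSeries; ring
          _ = _ := by rw [ha, hb, hu]; ring
      simp only [pow1_one] at hW
      have hcoe : ((T ^ 2 * ((1 - Polynomial.C a * X) * (1 - Polynomial.C b * X)) -
          (1 - Polynomial.C u * X) : ℝ[X]) : PowerSeries ℝ) =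
          (T : PowerSeries ℝ) ^ 2 * ((1 - PowerSeries.C a * PowerSeries.X) *
          (1 - PowerSeries.C b * PowerSeries.X)) - (1 - PowerSeries.C u * PowerSeries.X) := by
        simp
      rw [hcoe, hTW]
      refine ⟨(-2 * wSeries u a b * V + PowerSeries.X ^ (n + 1) * V ^ 2) *
        ((1 - PowerSeries.C a * PowerSeries.X) * (1 - PowerSeries.C b * PowerSeries.X)), ?_⟩
      linear_combination hW
    rw [PowerSeries.X_pow_dvd_iff] at hps
    intro d hd
    have := hps d hd
    rwa [Polynomial.coeff_coe] at this
  obtain ⟨r, hr⟩ := hd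
  refine ⟨r, fun z => ?_⟩
  have h := congrArg (Polynomial.eval z) hr
  have hTz : T.eval z = ∑ k ∈ Finset.range (n + 1), wCoeff k u a b * z ^ k := by
    rw [hT]
    exact PowerSeries.eval₂_trunc_eq_sum_range z (RingHom.id ℝ) (n + 1) (wSeries u a b)
  simp only [eval_sub, eval_mul, eval_pow, eval_one, eval_C, eval_X, hTz] at h
  linarith

end Polynomial

/-- Comparison of `√(cubic u a b ξ)` with `ξ ^ (3 / 2)`. -/
lemma sqrt_cubic_eq {u a b ξ : ℝ} (hξ : 0 < ξ) : √(cubic u a b ξ) =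
    ξ * √ξ * √((1 - u * ξ⁻¹) * ((1 - a * ξ⁻¹) * (1 - b * ξ⁻¹))) := by
  have : cubic u a b ξ = ξ ^ 2 * (ξ * ((1 - u * ξ⁻¹) * ((1 - a * ξ⁻¹) * (1 - b * ξ⁻¹)))) := by
    unfold cubic; field_simp
  rw [this, Real.sqrt_mul (sq_nonneg _), Real.sqrt_sq hξ.le, Real.sqrt_mul hξ.le, mul_assoc]

lemma rpow_neg_three_halves {ξ : ℝ} (hξ : 0 < ξ) : ξ ^ (-(3 / 2) : ℝ) = (ξ * √ξ)⁻¹ := by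
  rw [Real.rpow_neg hξ.le, show (3 / 2 : ℝ) = 1 + 1 / 2 by norm_num, Real.rpow_add hξ,
    Real.rpow_one, Real.sqrt_eq_rpow]

lemma rpow_sub_half (n : ℕ) {ξ : ℝ} (hξ : 0 < ξ) : ξ ^ ((n : ℝ) - 1 / 2) = ξ ^ n / √ξ := by
  rw [Real.rpow_sub hξ, Real.rpow_natCast, Real.sqrt_eq_rpow]

/-- With z = 1/ξ, A = (1-az)(1-bz), t the truncated series and ρ = √R/ξ^(3/2), the leading part of
the error is ξ^(n+1) (At - ρ). By `exists_trunc_wSeries_sq`, (At)² - ρ² = z^(n+1) A r, so this part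
equals A r/(At + ρ), which is bounded. -/
lemma explicitP_asymptotics (n : ℕ) (u a b κ : ℝ) :
    (fun ξ : ℝ => (explicitP n u a b κ).eval ξ / √(cubic u a b ξ) - ξ ^ ((n : ℝ) - 1 / 2))
      =O[atTop] fun ξ : ℝ => ξ ^ (-(3 / 2) : ℝ) := by
  obtain ⟨r, hr⟩ := exists_trunc_wSeries_sq n u a b
  set ρ : ℝ → ℝ := fun z => √((1 - u * z) * ((1 - a * z) * (1 - b * z))) with hρ
  set A : ℝ → ℝ := fun z => (1 - a * z) * (1 - b * z) with hA
  set t : ℝ → ℝ := fun z => ∑ k ∈ Finset.range (n + 1), wCoeff k u a b * z ^ k with ht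
  set w := wCoeff n u a b with hw
  -- g(1/ξ) is the error divided by ξ^(-3/2); the middle terms are what A t does not capture of (w ξ
  -- + κ) and the quadratic factor. Continuity of g at 0 gives the bound.
  set g : ℝ → ℝ := fun z => (A z * r.eval z / (A z * t z + ρ z) +
    (w * (a + b) - w * (a * b) * z + κ)) / ρ z with hg
  have hρc : Continuous ρ := by fun_prop
  have hAc : Continuous A := by fun_prop
  have htc : Continuous t := by fun_prop
  have hrc : Continuous fun z => r.eval z := r.continuous
  have hρ0 : ρ 0 = 1 := by simp [hρ]
  have hA0 : A 0 = 1 := by simp [hA]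
  have ht0 : t 0 = 1 := by
    simp only [ht, Finset.sum_range_succ']
    simp
  have hgc : ContinuousAt g 0 := by
    refine ContinuousAt.div (ContinuousAt.add (ContinuousAt.div ?_ ?_ ?_) ?_) ?_ ?_
    · exact (hAc.mul hrc).continuousAt
    · exact ((hAc.mul htc).add hρc).continuousAt
    · rw [hρ0, hA0, ht0]; norm_num
    · fun_prop
    · exact hρc.continuousAt
    · rw [hρ0]; norm_num
  have hO : (fun ξ : ℝ => g ξ⁻¹) =O[atTop] fun _ => (1 : ℝ) :=
    (hgc.tendsto.comp tendsto_inv_atTop_zero).isBigO_one ℝ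
  have hO2 := hO.mul (isBigO_refl (fun ξ : ℝ => ξ ^ (-(3 / 2) : ℝ)) atTop)
  simp only [one_mul] at hO2
  refine hO2.congr' ?_ EventuallyEq.rfl
  have e1 : ∀ᶠ z in 𝓝 (0 : ℝ), 0 < A z * t z + ρ z :=
    ((hAc.mul htc).add hρc).continuousAt.eventually_const_lt
      (show 0 < A 0 * t 0 + ρ 0 by rw [hρ0, hA0, ht0]; norm_num)
  have e2 : ∀ᶠ z in 𝓝 (0 : ℝ), 0 < ρ z :=
    hρc.continuousAt.eventually_const_lt (by rw [hρ0]; norm_num)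
  filter_upwards [tendsto_inv_atTop_zero.eventually e1, tendsto_inv_atTop_zero.eventually e2,
    eventually_gt_atTop 0] with ξ h1 h2 hξ
  have hz : ξ * ξ⁻¹ = 1 := mul_inv_cancel₀ hξ.ne'
  have hsq : ρ ξ⁻¹ ^ 2 = (1 - u * ξ⁻¹) * A ξ⁻¹ :=
    Real.sq_sqrt (Real.sqrt_pos.1 h2).le
  have hrz : t ξ⁻¹ ^ 2 * A ξ⁻¹ = (1 - u * ξ⁻¹) + ξ⁻¹ ^ (n + 1) * r.eval ξ⁻¹ := hr ξ⁻¹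
  have hp : (explicitP n u a b κ).eval ξ = ξ ^ (n + 1) * (A ξ⁻¹ * t ξ⁻¹) +
      (w * (a + b) - w * (a * b) * ξ⁻¹ + κ) := by
    have hS : ξ * wPoly n u a b ξ + w = ξ ^ n * t ξ⁻¹ := by
      simp only [wPoly, ht]
      rw [Finset.sum_range_succ, mul_add, Finset.mul_sum, Finset.mul_sum]
      congr 1
      · refine Finset.sum_congr rfl fun k hk => ?_
        have hk := Finset.mem_range.1 hk
        obtain ⟨d, rfl⟩ : ∃ d, n = k + 1 + d := ⟨n - k - 1, by omega⟩
        rw [show k + 1 + d - 1 - k = d by omega, inv_pow]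
        field_simp
        ring
      · rw [inv_pow]; field_simp; exact hw
    have hAξ : ξ ^ 2 * A ξ⁻¹ = (ξ - a) * (ξ - b) := by
      simp only [hA]; field_simp
    rw [eval_explicitP]
    have hS' : wPoly n u a b ξ = ξ⁻¹ * (ξ ^ n * t ξ⁻¹ - w) := by
      rw [← hS]; field_simp; ring
    rw [hS', ← hAξ, ← hw]
    simp only [hA]
    field_simp
    ring
  have hdiff : ξ ^ (n + 1) * (A ξ⁻¹ * t ξ⁻¹) - ξ ^ (n + 1) * ρ ξ⁻¹ =
      A ξ⁻¹ * r.eval ξ⁻¹ / (A ξ⁻¹ * t ξ⁻¹ + ρ ξ⁻¹) := by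
    rw [eq_div_iff h1.ne']
    have : ξ ^ (n + 1) * ξ⁻¹ ^ (n + 1) = 1 := by rw [← mul_pow, hz, one_pow]
    linear_combination (ξ ^ (n + 1) * A ξ⁻¹) * hrz - ξ ^ (n + 1) * hsq +
      (A ξ⁻¹ * r.eval ξ⁻¹) * this
  have hs : 0 < √ξ := Real.sqrt_pos.2 hξ
  have hss : √ξ ^ 2 = ξ := Real.sq_sqrt hξ.le
  rw [rpow_neg_three_halves hξ, rpow_sub_half n hξ, sqrt_cubic_eq hξ]
  change g ξ⁻¹ * (ξ * √ξ)⁻¹ = _ / (ξ * √ξ * ρ ξ⁻¹) - _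
  simp only [hg]
  rw [← hdiff, hp]
  have h2' := h2.ne'
  generalize ρ ξ⁻¹ = R at *
  generalize A ξ⁻¹ * t ξ⁻¹ = B at *
  generalize w * (a + b) - w * (a * b) * ξ⁻¹ + κ = e at *
  field_simp
  ring

/-- Two Whitham polynomials coincide. -/
lemma IsWhithamPoly.unique {n : ℕ} {u a b : ℝ} (hab : b < a) (hau : a < u) {p p' : Polynomial ℝ}
    (hp : IsWhithamPoly n u a b p) (hp' : IsWhithamPoly n u a b p') : p = p' := by
  -- The difference of the polynomials is O(ξ^(-3/2) √R) = O(1), hence a constant k, whose period 2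
  -- k `ellK` vanishes only for k = 0.
  have hsub := hp.asymptotics.sub hp'.asymptotics
  have hs : (fun ξ : ℝ => √(cubic u a b ξ)) =O[atTop] fun ξ : ℝ => ξ * √ξ := by
    have hc : Continuous fun z : ℝ => √((1 - u * z) * ((1 - a * z) * (1 - b * z))) := by fun_prop
    have h1 := ((hc.tendsto 0).comp tendsto_inv_atTop_zero).isBigO_one ℝ
    have h2 := (isBigO_refl (fun ξ : ℝ => ξ * √ξ) atTop).mul h1
    simp only [mul_one] at h2
    refine h2.congr' ?_ EventuallyEq.rfl
    filter_upwards [eventually_gt_atTop 0] with ξ hξ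
    rw [sqrt_cubic_eq hξ]; rfl
  have hprod := hsub.mul hs
  have hone : (fun ξ : ℝ => (p - p').eval ξ) =O[atTop] fun _ => (1 : ℝ) := by
    refine hprod.congr' ?_ ?_
    · filter_upwards [eventually_gt_atTop (max u (max a b))] with ξ hξ
      simp only [max_lt_iff] at hξ
      have : 0 < √(cubic u a b ξ) := by
        refine Real.sqrt_pos.2 ?_
        unfold cubic
        exact mul_pos (mul_pos (by linarith) (by linarith)) (by linarith)
      simp only [Polynomial.eval_sub]
      field_simp
      ring
    · filter_upwards [eventually_gt_atTop 0] with ξ hξ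
      have hs : 0 < √ξ := Real.sqrt_pos.2 hξ
      rw [rpow_neg_three_halves hξ]
      exact inv_mul_cancel₀ (by positivity)
  have hdeg : (p - p').degree ≤ 0 := by
    rw [← Polynomial.isBoundedUnder_abs_atTop_iff]
    exact (isBigO_one_iff ℝ).1 hone
  have hC := Polynomial.eq_C_of_degree_le_zero hdeg
  set k := (p - p').coeff 0
  have hint : ∫ ξ in b..a, k / √(cubic u a b ξ) = 0 := by
    have h1 := intervalIntegral.integral_sub
      (intervalIntegrable_div_sqrt_cubic hab hau p.continuous)
      (intervalIntegrable_div_sqrt_cubic hab hau p'.continuous)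
    rw [hp.integral_eq_zero, hp'.integral_eq_zero, sub_zero] at h1
    rw [← h1]
    refine intervalIntegral.integral_congr fun ξ _ => ?_
    have := congrArg (Polynomial.eval ξ) hC
    simp only [Polynomial.eval_sub, Polynomial.eval_C] at this
    simp only [← this, sub_div]
  rw [integral_div_sqrt_cubic hab (fun _ => k), intervalIntegral.integral_const_mul] at hint
  have hK := ellK_pos hau (hab.trans hau)
  have hk : k = 0 := by
    have : 2 * (k * ellK u a b) = 0 := hint
    rcases mul_eq_zero.1 this with h | h
    · norm_num at h
    · exact (mul_eq_zero.1 h).resolve_right hK.ne'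
  rw [hk, map_zero] at hC
  exact sub_eq_zero.1 hC

/-- The constant term of `explicitP` which annihilates the period. -/
def constTerm (n : ℕ) (u a b : ℝ) : ℝ :=
  (ellF n u a b / 2 - wCoeff n u a b * (a * ellK u a b - (a - b) * ellJ u b a)) / ellK u a b

lemma isWhithamPoly_explicitP (n : ℕ) {u a b : ℝ} (hab : b < a) (hau : a < u) :
    IsWhithamPoly n u a b (explicitP n u a b (constTerm n u a b)) := by
  obtain ⟨h1, h2⟩ := explicitP_monic_natDegree n u a b (constTerm n u a b)
  refine ⟨h1, h2, explicitP_asymptotics n u a b _, ?_⟩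
  have hbu := hab.trans hau
  have hk := continuous_ker hau hbu
  have hw : Continuous fun θ => wPoly n u a b (arc a b θ) :=
    (continuous_wPoly n).comp (g := fun p : (ℝ × ℝ × ℝ) × ℝ => wPoly n p.1.1 p.1.2.1 p.1.2.2 p.2)
      (f := fun θ => ((u, a, b), arc a b θ)) (by fun_prop)
  rw [integral_div_sqrt_cubic hab]
  have e : ∫ θ in 0..π / 2, (explicitP n u a b (constTerm n u a b)).eval (arc a b θ) *
      ker u a b θ = -(a - b) ^ 2 * ellN n u a b + wCoeff n u a b *
        (∫ θ in 0..π / 2, arc a b θ * ker u a b θ) + constTerm n u a b * ellK u a b := by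
    rw [ellN, ellK, ← intervalIntegral.integral_const_mul, ← intervalIntegral.integral_const_mul,
      ← intervalIntegral.integral_const_mul, ← intervalIntegral.integral_add,
      ← intervalIntegral.integral_add]
    · refine intervalIntegral.integral_congr fun θ _ => ?_
      have e1 := arc_sub a b θ
      have e2 : arc a b θ - a = -((a - b) * cos θ ^ 2) := by rw [← sub_arc]; ring
      simp only [eval_explicitP, e1, e2]
      ring
    all_goals exact Continuous.intervalIntegrable (by fun_prop) _ _
  have hK := (ellK_pos hau hbu).ne'
  rw [e, integral_arc_mul_ker hau hbu, constTerm, div_mul_cancel₀ _ hK, ellF]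
  ring

lemma P_eq_explicitP (n : ℕ) {u a b : ℝ} (hab : b < a) (hau : a < u) :
    P n u a b = explicitP n u a b (constTerm n u a b) := by
  have hex := isWhithamPoly_explicitP n hab hau
  have h : ∃ p, IsWhithamPoly n u a b p := ⟨_, hex⟩
  rw [P, dif_pos h]
  exact h.choose_spec.unique hab hau hex

/-! ### The eigenspeeds in terms of w, F and J. -/

@[simp] lemma ellF_zero (u a b : ℝ) : ellF 0 u a b = 0 := by simp [ellF, ellN, wPoly]

lemma eval_P_left (n : ℕ) {u a b : ℝ} (hab : b < a) (hau : a < u) : (P n u a b).eval a =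
    (ellF n u a b / 2 + wCoeff n u a b * ((a - b) * ellJ u b a)) / ellK u a b := by
  have hK := (ellK_pos hau (hab.trans hau)).ne'
  rw [P_eq_explicitP n hab hau, eval_explicitP, constTerm]
  field_simp
  ring

lemma eval_P_right (n : ℕ) {u a b : ℝ} (hab : b < a) (hau : a < u) : (P n u a b).eval b =
    (ellF n u a b / 2 - wCoeff n u a b * ((a - b) * ellJ u a b)) / ellK u a b := by
  have hK := (ellK_pos hau (hab.trans hau)).ne'
  have := ellJ_add hau (hab.trans hau)
  rw [P_eq_explicitP n hab hau, eval_explicitP, constTerm]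
  field_simp
  rw [← this]
  ring

/-- The denominator P_0 comes from the same evaluation with F = 0 and w_0 = 1. -/
lemma speed₂_eq (m : ℕ) {u a b : ℝ} (hab : b < a) (hau : a < u) :
    speed₂ m u a b = 4 ^ m * (2 * m + 1) *
      (wCoeff m u a b + ellF m u a b / (2 * (a - b) * ellJ u b a)) := by
  have hK := (ellK_pos hau (hab.trans hau)).ne'
  have hJ := (ellJ_pos (hab.trans hau) hau).ne'
  have hd : a - b ≠ 0 := by linarith
  rw [speed₂, eval_P_left m hab hau, eval_P_left 0 hab hau, ellF_zero, wCoeff_zero]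
  congr 1
  field_simp
  ring

lemma speed₃_eq (m : ℕ) {u a b : ℝ} (hab : b < a) (hau : a < u) :
    speed₃ m u a b = 4 ^ m * (2 * m + 1) *
      (wCoeff m u a b - ellF m u a b / (2 * (a - b) * ellJ u a b)) := by
  have hK := (ellK_pos hau (hab.trans hau)).ne'
  have hJ := (ellJ_pos hau (hab.trans hau)).ne'
  have hd : a - b ≠ 0 := by linarith
  rw [speed₃, eval_P_right m hab hau, eval_P_right 0 hab hau, ellF_zero, wCoeff_zero]
  congr 1
  field_simp
  ring

/-- The quotient by a - b is carried out, so that this form extends continuously to the diagonal. -/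
lemma speed₂_eq_ellN (m : ℕ) {u a b : ℝ} (hab : b < a) (hau : a < u) :
    speed₂ m u a b = 4 ^ m * (2 * m + 1) *
      (wCoeff m u a b + (a - b) * ellN m u a b / ellJ u b a) := by
  have hJ := (ellJ_pos (hab.trans hau) hau).ne'
  have hd : a - b ≠ 0 := by linarith
  rw [speed₂_eq m hab hau, ellF]
  congr 2
  field_simp

/-! ### Limits of μ₂ on the diagonal and at the corner (1, 1, 0). -/

lemma tendsto_speed₂_diag (m : ℕ) {c : ℝ} (hc : c < 1) :
    Tendsto (fun p : ℝ × ℝ × ℝ => speed₂ m p.1 p.2.1 p.2.2) (𝓝[domain] (1, c, c))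
      (𝓝 (4 ^ m * (2 * m + 1) * wCoeff m 1 c c)) := by
  have hmem : ((1, c, c) : ℝ × ℝ × ℝ) ∈ region := ⟨hc, hc⟩
  have hnhds := isOpen_region.mem_nhds hmem
  have hN := (continuousOn_ellN m).continuousAt hnhds
  have hJ : ContinuousAt (fun p : ℝ × ℝ × ℝ => ellJ p.1 p.2.2 p.2.1) (1, c, c) :=
    (continuousOn_ellJ.continuousAt hnhds).comp (f := fun p : ℝ × ℝ × ℝ => (p.1, p.2.2, p.2.1))
      (x := (1, c, c)) (by fun_prop)
  have h : ContinuousAt (fun p : ℝ × ℝ × ℝ => 4 ^ m * (2 * m + 1) * (wCoeff m p.1 p.2.1 p.2.2 +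
      (p.2.1 - p.2.2) * ellN m p.1 p.2.1 p.2.2 / ellJ p.1 p.2.2 p.2.1)) (1, c, c) := by
    refine continuousAt_const.mul ((continuous_wCoeff m).continuousAt.add
      (ContinuousAt.div (ContinuousAt.mul (by fun_prop) hN) hJ (ellJ_pos hc hc).ne'))
  have ht := h.tendsto.mono_left (nhdsWithin_le_nhds (s := domain))
  simp only [sub_self, zero_mul, zero_div, add_zero] at ht
  refine ht.congr' ?_
  filter_upwards [self_mem_nhdsWithin] with p hp
  rw [speed₂_eq_ellN m hp.1 hp.2]

/-- From u - ξ ≥ a - ξ = (a-b) cos² θ. The bound is uniform as (u, a) → (1, 1), where `ker` itself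
blows up at θ = π/2, and serves as the dominating function. -/
lemma abs_cos_mul_ker_le {u a b : ℝ} (hab : b + 1 / 2 ≤ a) (hau : a < u) (θ : ℝ) :
    |cos θ| * ker u a b θ ≤ √2 := by
  have h1 := sub_arc a b θ
  have h2 : 0 < u - arc a b θ := sub_pos.2 (arc_lt hau (by linarith) θ)
  have h3 : cos θ ^ 2 ≤ 2 * (u - arc a b θ) := by nlinarith [sq_nonneg (cos θ)]
  have h4 := Real.sqrt_le_sqrt h3
  rw [Real.sqrt_sq_eq_abs, Real.sqrt_mul (by norm_num)] at h4
  rw [ker, ← div_eq_mul_inv, div_le_iff₀ (Real.sqrt_pos.2 h2)]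
  exact h4

/-- Dominated convergence at the corner `(1, 1, 0)` of the domain. -/
lemma tendsto_integral_ker_corner {h : ℝ → ℝ} (hh : Continuous h) (hcos : ∀ θ, |h θ| ≤ |cos θ|)
    {G : (ℝ × ℝ × ℝ) × ℝ → ℝ} (hG : Continuous G) :
    Tendsto (fun p : ℝ × ℝ × ℝ => ∫ θ in 0..π / 2,
      h θ * (G (p, arc p.2.1 p.2.2 θ) * ker p.1 p.2.1 p.2.2 θ)) (𝓝[domain] (1, 1, 0))
      (𝓝 (∫ θ in 0..π / 2, h θ * (G ((1, 1, 0), arc 1 0 θ) * ker 1 1 0 θ))) := by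
  have hcomp : IsCompact (Metric.closedBall ((1, 1, 0) : ℝ × ℝ × ℝ) 1 ×ˢ uIcc 0 (π / 2)) :=
    (isCompact_closedBall _ _).prod isCompact_uIcc
  obtain ⟨M, hM⟩ := hcomp.exists_bound_of_continuousOn
    (f := fun z : (ℝ × ℝ × ℝ) × ℝ => G (z.1, arc z.1.2.1 z.1.2.2 z.2))
    (hG.comp (by fun_prop)).continuousOn
  have hM0 : 0 ≤ M := (norm_nonneg _).trans (hM ((1, 1, 0), 0)
    ⟨Metric.mem_closedBall_self (by norm_num), left_mem_uIcc⟩)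
  refine intervalIntegral.tendsto_integral_filter_of_dominated_convergence (fun _ => M * √2)
    ?_ ?_ (by simp) ?_
  · filter_upwards [self_mem_nhdsWithin] with p hp
    have hk := continuous_ker hp.2 (lt_trans hp.1 hp.2)
    have : Continuous fun θ => G (p, arc p.2.1 p.2.2 θ) := hG.comp (by fun_prop)
    exact (hh.mul (this.mul hk)).aestronglyMeasurable
  · have hnear : ∀ᶠ p : ℝ × ℝ × ℝ in 𝓝 (1, 1, 0), p.2.2 + 1 / 2 < p.2.1 :=
      (isOpen_lt (f := fun p : ℝ × ℝ × ℝ => p.2.2 + 1 / 2) (g := fun p => p.2.1) (by fun_prop)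
        (by fun_prop)).mem_nhds (by simp only [mem_ofPred_eq]; norm_num)
    filter_upwards [self_mem_nhdsWithin, nhdsWithin_le_nhds hnear,
      nhdsWithin_le_nhds (Metric.closedBall_mem_nhds ((1, 1, 0) : ℝ × ℝ × ℝ) one_pos)]
      with p hp hp1 hp2
    refine MeasureTheory.ae_of_all _ fun θ hθ => ?_
    have h1 := hM (p, θ) ⟨hp2, uIoc_subset_uIcc hθ⟩
    have h2 := abs_cos_mul_ker_le hp1.le hp.2 θ
    have hk := (ker_pos hp.2 (lt_trans hp.1 hp.2) θ).le
    rw [norm_mul, norm_mul, Real.norm_eq_abs (ker _ _ _ _), abs_of_nonneg hk]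
    calc ‖h θ‖ * (‖G (p, arc p.2.1 p.2.2 θ)‖ * ker p.1 p.2.1 p.2.2 θ)
        ≤ |cos θ| * (M * ker p.1 p.2.1 p.2.2 θ) := by
          gcongr
          · exact hcos θ
      _ = M * (|cos θ| * ker p.1 p.2.1 p.2.2 θ) := by ring
      _ ≤ M * √2 := by gcongr
  · refine MeasureTheory.ae_of_all _ fun θ _ => ?_
    rcases eq_or_ne (cos θ) 0 with h0 | h0
    · have hz : h θ = 0 := by
        have := hcos θ
        rw [h0, abs_zero] at this
        exact abs_eq_zero.1 (le_antisymm this (abs_nonneg _))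
      simp only [hz, zero_mul]
      exact tendsto_const_nhds
    · have hpos : 0 < √(1 - arc 1 0 θ) := by
        rw [sub_arc]; exact Real.sqrt_pos.2 (by positivity)
      have hc : ContinuousAt (fun p : ℝ × ℝ × ℝ =>
          h θ * (G (p, arc p.2.1 p.2.2 θ) * ker p.1 p.2.1 p.2.2 θ)) (1, 1, 0) := by
        have hGc : Continuous fun p : ℝ × ℝ × ℝ => G (p, arc p.2.1 p.2.2 θ) :=
          hG.comp (by fun_prop)
        have hkc : ContinuousAt (fun p : ℝ × ℝ × ℝ => ker p.1 p.2.1 p.2.2 θ) (1, 1, 0) :=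
          ContinuousAt.inv₀ (Continuous.continuousAt (by fun_prop)) hpos.ne'
        exact continuousAt_const.mul (hGc.continuousAt.mul hkc)
      exact hc.tendsto.mono_left nhdsWithin_le_nhds

lemma wSeries_corner : wSeries 1 1 0 = 1 := by
  rw [wSeries, pow1_zero_right, mul_one, ← pow1_add]; norm_num

lemma wCoeff_corner (k : ℕ) : wCoeff (k + 1) 1 1 0 = 0 := by
  simp [wCoeff, wSeries_corner, PowerSeries.coeff_one]

lemma wPoly_corner (n : ℕ) (ξ : ℝ) : wPoly (n + 1) 1 1 0 ξ = ξ ^ n := by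
  rw [wPoly, Finset.sum_range_succ']
  simp [wCoeff_corner]

lemma cos_mul_ker_corner {θ : ℝ} (hθ : θ ∈ uIcc 0 (π / 2)) :
    cos θ ^ 2 * ker 1 1 0 θ = cos θ := by
  rw [uIcc_of_le (by positivity)] at hθ
  have h0 : 0 ≤ cos θ := cos_nonneg_of_mem_Icc ⟨by linarith [hθ.1, pi_pos], hθ.2⟩
  rw [ker, sub_arc, sub_zero, one_mul, Real.sqrt_sq h0]
  rcases eq_or_ne (cos θ) 0 with h | h
  · simp [h]
  · field_simp

lemma tendsto_ellJ_corner : Tendsto (fun p : ℝ × ℝ × ℝ => ellJ p.1 p.2.2 p.2.1)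
    (𝓝[domain] (1, 1, 0)) (𝓝 1) := by
  have h := tendsto_integral_ker_corner (h := fun θ => cos θ ^ 2) (by fun_prop)
    (fun θ => by
      rw [abs_pow, sq]
      exact mul_le_of_le_one_left (abs_nonneg _) (abs_cos_le_one θ)) (G := fun _ => 1)
    continuous_const
  simp only [one_mul, ← ellJ_symm] at h
  convert h using 2
  rw [ellJ_symm, intervalIntegral.integral_congr fun θ hθ => cos_mul_ker_corner hθ]
  simp

lemma tendsto_ellN_corner (n : ℕ) :
    Tendsto (fun p : ℝ × ℝ × ℝ => ellN (n + 1) p.1 p.2.1 p.2.2)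
    (𝓝[domain] (1, 1, 0)) (𝓝 (1 / (2 * (n + 1 : ℕ) + 1))) := by
  have h := tendsto_integral_ker_corner (h := fun θ => cos θ ^ 2 * sin θ ^ 2) (by fun_prop)
    (fun θ => by
      rw [abs_mul, abs_pow, abs_pow, sq, mul_assoc]
      refine mul_le_of_le_one_right (abs_nonneg _) ?_
      exact mul_le_one₀ (abs_cos_le_one θ) (by positivity)
        (pow_le_one₀ (abs_nonneg _) (abs_sin_le_one θ))) (continuous_wPoly (n + 1))
  refine (?_ : _ = (1 : ℝ) / (2 * (n + 1 : ℕ) + 1)) ▸ h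
  have e : ∀ θ ∈ uIcc 0 (π / 2), cos θ ^ 2 * sin θ ^ 2 *
      (wPoly (n + 1) 1 1 0 (arc 1 0 θ) * ker 1 1 0 θ) = sin θ ^ (2 * (n + 1)) * cos θ := by
    intro θ hθ
    have := cos_mul_ker_corner hθ
    rw [wPoly_corner, arc_eq_add]
    linear_combination sin θ ^ (2 * (n + 1)) * this
  have hd : ∀ θ ∈ uIcc 0 (π / 2), HasDerivAt
      (fun θ => 1 / (2 * (n + 1 : ℕ) + 1) * sin θ ^ (2 * (n + 1) + 1))
      (sin θ ^ (2 * (n + 1)) * cos θ) θ := by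
    intro θ _
    refine (((hasDerivAt_sin θ).pow (2 * (n + 1) + 1)).const_mul _).congr_deriv ?_
    rw [Nat.add_sub_cancel]
    push_cast
    field_simp
  rw [intervalIntegral.integral_congr e, intervalIntegral.integral_eq_sub_of_hasDerivAt hd
    (Continuous.intervalIntegrable (by fun_prop) _ _)]
  simp

/-- At the corner the factors (1-X)^(1/2) and (1-X)^(-1/2) cancel, so w_m → 0 and `wPoly` → ξ^n;
with J → 1 and `ellN` → 1/(2m+1), the factor 2m+1 drops out. -/
lemma tendsto_speed₂_corner (n : ℕ) :
    Tendsto (fun p : ℝ × ℝ × ℝ => speed₂ (n + 1) p.1 p.2.1 p.2.2) (𝓝[domain] (1, 1, 0))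
      (𝓝 (4 ^ (n + 1))) := by
  have hw : Tendsto (fun p : ℝ × ℝ × ℝ => wCoeff (n + 1) p.1 p.2.1 p.2.2) (𝓝[domain] (1, 1, 0))
      (𝓝 0) := by
    have := (continuous_wCoeff (n + 1)).tendsto (1, 1, 0)
    simp only [wCoeff_corner] at this
    exact this.mono_left nhdsWithin_le_nhds
  have hd : Tendsto (fun p : ℝ × ℝ × ℝ => p.2.1 - p.2.2) (𝓝[domain] (1, 1, 0)) (𝓝 1) := by
    have h : Continuous fun p : ℝ × ℝ × ℝ => p.2.1 - p.2.2 := by fun_prop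
    have := h.tendsto (1, 1, 0)
    simp only [sub_zero] at this
    exact this.mono_left nhdsWithin_le_nhds
  have h := (hw.add ((hd.mul (tendsto_ellN_corner n)).div tendsto_ellJ_corner
    one_ne_zero)).const_mul (4 ^ (n + 1) * (2 * ((n + 1 : ℕ) : ℝ) + 1))
  have e : 4 ^ (n + 1) * (2 * ((n + 1 : ℕ) : ℝ) + 1) *
      (0 + 1 * (1 / (2 * ((n + 1 : ℕ) : ℝ) + 1)) / 1) = 4 ^ (n + 1) := by
    field_simp
    simp
  rw [e] at h
  refine h.congr' ?_
  filter_upwards [self_mem_nhdsWithin] with p hp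
  rw [speed₂_eq_ellN (n + 1) hp.1 hp.2]
  rfl

/-! ### The generating function of q and the diagonal values of p₁. -/

lemma integral_eq_integral_arc {a b : ℝ} (hab : b < a) (g : ℝ → ℝ) :
    ∫ ξ in b..a, g ξ = ∫ θ in 0..π / 2, (a - b) * (2 * sin θ * cos θ) * g (arc a b θ) := by
  have hd : 0 < a - b := by linarith
  rw [intervalIntegral.integral_of_le hab.le, MeasureTheory.integral_Ioc_eq_integral_Ioo,
    ← arc_image hab, MeasureTheory.integral_image_eq_integral_abs_deriv_smul measurableSet_Ioo
      (fun θ _ => (hasDerivAt_arc a b θ).hasDerivWithinAt) (arc_injOn hab),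
    intervalIntegral.integral_of_le (by positivity : (0 : ℝ) ≤ π / 2),
    MeasureTheory.integral_Ioc_eq_integral_Ioo]
  refine MeasureTheory.setIntegral_congr_fun measurableSet_Ioo fun θ hθ => ?_
  have h1 : 0 < sin θ := sin_pos_of_pos_of_lt_pi hθ.1 (by linarith [hθ.2, pi_pos])
  have h2 : 0 < cos θ := cos_pos_of_mem_Ioo ⟨by linarith [hθ.1, pi_pos], hθ.2⟩
  simp only [smul_eq_mul]
  rw [abs_of_pos (by positivity)]

/-- The integral of `sin ^ p cos ^ q` over a quarter period. -/
def sinCosMoment (p q : ℕ) : ℝ := ∫ θ in 0..π / 2, sin θ ^ p * cos θ ^ q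

lemma sinCosMoment_add (p q : ℕ) :
    sinCosMoment (p + 2) q + sinCosMoment p (q + 2) = sinCosMoment p q := by
  rw [sinCosMoment, sinCosMoment, ← intervalIntegral.integral_add
    (Continuous.intervalIntegrable (by fun_prop) _ _)
    (Continuous.intervalIntegrable (by fun_prop) _ _), sinCosMoment]
  refine intervalIntegral.integral_congr fun θ _ => ?_
  have := sin_sq_add_cos_sq θ
  linear_combination (sin θ ^ p * cos θ ^ q) * this

lemma sinCosMoment_parts (p q : ℕ) :
    ((p : ℝ) + 1) * sinCosMoment p (q + 2) = ((q : ℝ) + 1) * sinCosMoment (p + 2) q := by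
  have hd : ∀ θ ∈ uIcc 0 (π / 2), HasDerivAt (fun θ => sin θ ^ (p + 1) * cos θ ^ (q + 1))
      ((p + 1) * (sin θ ^ p * cos θ ^ (q + 2)) - (q + 1) * (sin θ ^ (p + 2) * cos θ ^ q)) θ := by
    intro θ _
    refine (((hasDerivAt_sin θ).pow (p + 1)).mul ((hasDerivAt_cos θ).pow (q + 1))).congr_deriv ?_
    simp only [Pi.pow_apply, Nat.add_sub_cancel]
    push_cast
    ring
  have h := intervalIntegral.integral_eq_sub_of_hasDerivAt hd
    (Continuous.intervalIntegrable (by fun_prop) _ _)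
  rw [intervalIntegral.integral_sub (Continuous.intervalIntegrable (by fun_prop) _ _)
    (Continuous.intervalIntegrable (by fun_prop) _ _), intervalIntegral.integral_const_mul,
    intervalIntegral.integral_const_mul] at h
  simp only [sin_zero, cos_pi_div_two, pow_succ, mul_zero, zero_mul, sub_zero] at h
  simp only [sinCosMoment, pow_succ]
  linarith

lemma sinCosMoment_succ_left (p q : ℕ) :
    ((p : ℝ) + q + 2) * sinCosMoment (p + 2) q = (p + 1) * sinCosMoment p q := by
  have h1 := sinCosMoment_add p q
  have h2 := sinCosMoment_parts p q
  linear_combination (p + 1 : ℝ) * h1 - h2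

lemma sinCosMoment_succ_right (p q : ℕ) :
    ((p : ℝ) + q + 2) * sinCosMoment p (q + 2) = (q + 1) * sinCosMoment p q := by
  have h1 := sinCosMoment_add p q
  have h2 := sinCosMoment_parts p q
  linear_combination (q + 1 : ℝ) * h1 + h2

/-- Half the Beta value B(i+1/2, j+1/2), by the two reduction formulas. The odd case below is half
of B(k+1, l+1/2), in a form where the double factorial cancels against C_m. -/
lemma sinCosMoment_even (i j : ℕ) : sinCosMoment (2 * i) (2 * j) * (i + j).factorial =
    π / 2 * (powCoeff (-1 / 2) i * powCoeff (-1 / 2) j) * (i.factorial * j.factorial) := by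
  induction i with
  | zero =>
    induction j with
    | zero => simp [sinCosMoment]
    | succ j ih =>
      have h1 := sinCosMoment_succ_right (2 * 0) (2 * j)
      have h2 := powCoeff_succ (-1 / 2) j
      rw [show 2 * (j + 1) = 2 * j + 2 by ring, show 0 + (j + 1) = (0 + j) + 1 by ring,
        Nat.factorial_succ, Nat.factorial_succ]
      push_cast at h1 h2 ih ⊢
      linear_combination (1 / 2) * ((0 + j).factorial : ℝ) * h1 + (j + 1 / 2 : ℝ) * ih -
        (π / 2 * powCoeff (-1 / 2) 0 * (Nat.factorial 0) * j.factorial) * h2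
  | succ i ih =>
    have h1 := sinCosMoment_succ_left (2 * i) (2 * j)
    have h2 := powCoeff_succ (-1 / 2) i
    rw [show 2 * (i + 1) = 2 * i + 2 by ring, show (i + 1) + j = (i + j) + 1 by ring,
      Nat.factorial_succ, Nat.factorial_succ]
    push_cast at h1 h2 ih ⊢
    linear_combination (1 / 2) * ((i + j).factorial : ℝ) * h1 + (i + 1 / 2 : ℝ) * ih -
      (π / 2 * powCoeff (-1 / 2) j * i.factorial * j.factorial) * h2

lemma sinCosMoment_odd (k l : ℕ) :
    sinCosMoment (2 * k + 1) (2 * l) * (Nat.doubleFactorial (2 * (k + l) + 1)) =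
      2 ^ (k + l) * (k.factorial * l.factorial) * powCoeff (-1 / 2) l := by
  induction k with
  | zero =>
    induction l with
    | zero => simp [sinCosMoment]
    | succ l ih =>
      have h1 := sinCosMoment_succ_right (2 * 0 + 1) (2 * l)
      have h2 := powCoeff_succ (-1 / 2) l
      rw [show 2 * (l + 1) = 2 * l + 2 by ring,
        show 2 * (0 + (l + 1)) + 1 = (2 * (0 + l) + 1) + 2 by ring, Nat.doubleFactorial,
        Nat.factorial_succ]
      push_cast at h1 h2 ih ⊢
      linear_combination (Nat.doubleFactorial (2 * (0 + l) + 1) : ℝ) * h1 + (2 * l + 1 : ℝ) * ih -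
        (2 * 2 ^ (0 + l) * (Nat.factorial 0) * l.factorial) * h2
  | succ k ih =>
    have h1 := sinCosMoment_succ_left (2 * k + 1) (2 * l)
    rw [show 2 * (k + 1) + 1 = 2 * k + 1 + 2 by ring,
      show 2 * (k + 1 + l) + 1 = (2 * (k + l) + 1) + 2 by ring, Nat.doubleFactorial,
      Nat.factorial_succ]
    push_cast at h1 ih ⊢
    linear_combination (Nat.doubleFactorial (2 * (k + l) + 1) : ℝ) * h1 + (2 * k + 2 : ℝ) * ih

lemma sin_cos_pos {θ : ℝ} (hθ : θ ∈ Ioo 0 (π / 2)) : 0 < sin θ ∧ 0 < cos θ :=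
  ⟨sin_pos_of_pos_of_lt_pi hθ.1 (by linarith [hθ.2, pi_pos]),
    cos_pos_of_mem_Ioo ⟨by linarith [hθ.1, pi_pos], hθ.2⟩⟩

lemma integral_congr_Ioo {g h : ℝ → ℝ} (H : ∀ θ ∈ Ioo 0 (π / 2), g θ = h θ) :
    ∫ θ in 0..π / 2, g θ = ∫ θ in 0..π / 2, h θ := by
  rw [intervalIntegral.integral_of_le (by positivity : (0 : ℝ) ≤ π / 2),
    intervalIntegral.integral_of_le (by positivity : (0 : ℝ) ≤ π / 2),
    MeasureTheory.integral_Ioc_eq_integral_Ioo, MeasureTheory.integral_Ioc_eq_integral_Ioo]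
  exact MeasureTheory.setIntegral_congr_fun measurableSet_Ioo H

/-- `q` as an integral of a trigonometric polynomial. -/
lemma q_eq_trig (m : ℕ) (u₁ u₂ u₃ : ℝ) : q m u₁ u₂ u₃ = C m / (2 * √2 * π) * (4 * √2 *
    ∫ θ in 0..π / 2, ∫ φ in 0..π / 2,
      sin θ * (sin θ ^ 2 * (sin φ ^ 2 * u₁ + cos φ ^ 2 * u₂) + cos θ ^ 2 * u₃) ^ m) := by
  rw [q, integral_eq_integral_arc (by norm_num)]
  congr 1
  rw [← intervalIntegral.integral_const_mul]
  refine integral_congr_Ioo fun θ hθ => ?_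
  obtain ⟨hs, hc⟩ := sin_cos_pos hθ
  rw [integral_eq_integral_arc (by norm_num), ← intervalIntegral.integral_const_mul,
    ← intervalIntegral.integral_const_mul]
  refine integral_congr_Ioo fun φ hφ => ?_
  obtain ⟨hs', hc'⟩ := sin_cos_pos hφ
  have e1 := sin_sq_add_cos_sq θ
  have e2 := sin_sq_add_cos_sq φ
  have a1 : (1 + arc 1 (-1) θ) / 2 = sin θ ^ 2 := by unfold arc; linear_combination (-1 / 2) * e1
  have a2 : (1 - arc 1 (-1) θ) / 2 = cos θ ^ 2 := by unfold arc; linear_combination (-1 / 2) * e1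
  have b1 : (1 + arc 1 (-1) φ) / 2 = sin φ ^ 2 := by unfold arc; linear_combination (-1 / 2) * e2
  have b2 : (1 - arc 1 (-1) φ) / 2 = cos φ ^ 2 := by unfold arc; linear_combination (-1 / 2) * e2
  have hsqrt : √((1 - arc 1 (-1) θ) * (1 - arc 1 (-1) φ ^ 2)) =
      √2 * (2 * (cos θ * sin φ * cos φ)) := by
    have : (1 - arc 1 (-1) θ) * (1 - arc 1 (-1) φ ^ 2) =
        2 * (2 * (cos θ * sin φ * cos φ)) ^ 2 := by
      have h1 : 1 - arc 1 (-1) θ = 2 * cos θ ^ 2 := by linarith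
      have h2 : 1 - arc 1 (-1) φ = 2 * cos φ ^ 2 := by linarith
      have h3 : 1 + arc 1 (-1) φ = 2 * sin φ ^ 2 := by linarith
      calc _ = (1 - arc 1 (-1) θ) * ((1 + arc 1 (-1) φ) * (1 - arc 1 (-1) φ)) := by ring
        _ = _ := by rw [h1, h2, h3]; ring
    rw [this, Real.sqrt_mul (by norm_num), Real.sqrt_sq (by positivity)]
  have h2 : √2 * √2 = 2 := Real.mul_self_sqrt (by norm_num)
  rw [hsqrt, a1, a2, b1, b2]
  have hb : sin θ ^ 2 * sin φ ^ 2 * u₁ + sin θ ^ 2 * cos φ ^ 2 * u₂ + cos θ ^ 2 * u₃ =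
    sin θ ^ 2 * (sin φ ^ 2 * u₁ + cos φ ^ 2 * u₂) + cos θ ^ 2 * u₃ := by ring
  rw [hb]
  generalize (sin θ ^ 2 * (sin φ ^ 2 * u₁ + cos φ ^ 2 * u₂) + cos θ ^ 2 * u₃) ^ m = V
  have h0 : √2 ≠ 0 := by positivity
  field_simp
  linear_combination (-4 * V) * h2

lemma integral_trig_inner (k : ℕ) (u₁ u₂ : ℝ) :
    ∫ φ in 0..π / 2, (sin φ ^ 2 * u₁ + cos φ ^ 2 * u₂) ^ k =
      ∑ j ∈ Finset.range (k + 1),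
        u₁ ^ j * u₂ ^ (k - j) * k.choose j * sinCosMoment (2 * j) (2 * (k - j)) := by
  simp only [add_pow, sinCosMoment, ← intervalIntegral.integral_const_mul]
  rw [← intervalIntegral.integral_finsetSum]
  · refine intervalIntegral.integral_congr fun φ _ => Finset.sum_congr rfl fun j _ => ?_
    simp only [mul_pow, ← pow_mul]
    ring
  · intro j _
    exact Continuous.intervalIntegrable (by fun_prop) _ _

/-- The generating series of `q`. -/
def qSeries (u₁ u₂ u₃ : ℝ) : PowerSeries ℝ :=
  pow1 (-1 / 2) u₁ * pow1 (-1 / 2) u₂ * pow1 (-1 / 2) u₃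

/-- Two binomial expansions reduce the double integral to Beta values, which supply the coefficients
of the three factors (1 - u_i X)^(-1/2); C_m absorbs the remaining factorials. Symmetry of q and the
value at (1, 1, 0) become evident. -/
lemma q_eq_coeff (m : ℕ) (u₁ u₂ u₃ : ℝ) :
    q m u₁ u₂ u₃ = 4 ^ m * PowerSeries.coeff m (qSeries u₁ u₂ u₃) := by
  have hint : ∫ θ in 0..π / 2, ∫ φ in 0..π / 2,
      sin θ * (sin θ ^ 2 * (sin φ ^ 2 * u₁ + cos φ ^ 2 * u₂) + cos θ ^ 2 * u₃) ^ m =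
      ∑ k ∈ Finset.range (m + 1), (∫ φ in 0..π / 2, (sin φ ^ 2 * u₁ + cos φ ^ 2 * u₂) ^ k) *
        (u₃ ^ (m - k) * m.choose k * sinCosMoment (2 * k + 1) (2 * (m - k))) := by
    have h1 : ∀ θ, ∫ φ in 0..π / 2,
        sin θ * (sin θ ^ 2 * (sin φ ^ 2 * u₁ + cos φ ^ 2 * u₂) + cos θ ^ 2 * u₃) ^ m =
        ∑ k ∈ Finset.range (m + 1), ((∫ φ in 0..π / 2, (sin φ ^ 2 * u₁ + cos φ ^ 2 * u₂) ^ k) *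
          (u₃ ^ (m - k) * m.choose k)) * (sin θ ^ (2 * k + 1) * cos θ ^ (2 * (m - k))) := by
      intro θ
      simp only [add_pow _ (cos θ ^ 2 * u₃), ← intervalIntegral.integral_mul_const]
      rw [← intervalIntegral.integral_finsetSum]
      · refine intervalIntegral.integral_congr fun φ _ => ?_
        simp only [Finset.mul_sum]
        refine Finset.sum_congr rfl fun j _ => ?_
        simp only [mul_pow, ← pow_mul]
        ring
      · intro j _
        exact Continuous.intervalIntegrable (by fun_prop) _ _
    simp only [h1, sinCosMoment]
    rw [intervalIntegral.integral_finsetSum]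
    · refine Finset.sum_congr rfl fun k _ => ?_
      rw [intervalIntegral.integral_const_mul, mul_assoc]
    · intro j _
      exact Continuous.intervalIntegrable (by fun_prop) _ _
  rw [q_eq_trig, hint, qSeries, PowerSeries.coeff_mul,
    Finset.Nat.sum_antidiagonal_eq_sum_range_succ_mk, Finset.mul_sum, Finset.mul_sum,
    Finset.mul_sum]
  refine Finset.sum_congr rfl fun k hk => ?_
  have hk := Nat.lt_succ_iff.1 (Finset.mem_range.1 hk)
  obtain ⟨l, rfl⟩ := Nat.exists_eq_add_of_le hk
  rw [integral_trig_inner, PowerSeries.coeff_mul,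
    Finset.Nat.sum_antidiagonal_eq_sum_range_succ_mk, Finset.sum_mul, Finset.sum_mul,
    Finset.mul_sum, Finset.mul_sum, Finset.mul_sum]
  refine Finset.sum_congr rfl fun j hj => ?_
  have hj := Nat.lt_succ_iff.1 (Finset.mem_range.1 hj)
  obtain ⟨i, rfl⟩ := Nat.exists_eq_add_of_le hj
  simp only [Nat.add_sub_cancel_left, coeff_pow1]
  have hA := sinCosMoment_even j i
  have hB := sinCosMoment_odd (j + i) l
  have c1 : (((j + i + l).choose (j + i) : ℕ) : ℝ) * ((j + i).factorial * l.factorial) =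
      (j + i + l).factorial := by
    have := Nat.choose_mul_factorial_mul_factorial (Nat.le_add_right (j + i) l)
    rw [Nat.add_sub_cancel_left] at this
    rw [← mul_assoc]; exact_mod_cast this
  have c2 : (((j + i).choose j : ℕ) : ℝ) * (j.factorial * i.factorial) =
      (j + i).factorial := by
    have := Nat.choose_mul_factorial_mul_factorial (Nat.le_add_right j i)
    rw [Nat.add_sub_cancel_left] at this
    rw [← mul_assoc]; exact_mod_cast this
  have hf0 : ((j + i).factorial : ℝ) ≠ 0 := by positivity
  have hf1 : ((j + i + l).factorial : ℝ) ≠ 0 := by positivity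
  have hd0 : (Nat.doubleFactorial (2 * (j + i + l) + 1) : ℝ) ≠ 0 := by
    exact_mod_cast (Nat.doubleFactorial_pos _).ne'
  have hA' : sinCosMoment (2 * j) (2 * i) = π / 2 *
      (powCoeff (-1 / 2) j * powCoeff (-1 / 2) i) * (j.factorial * i.factorial) /
      (j + i).factorial := by rw [eq_div_iff hf0, hA]
  have hB' : sinCosMoment (2 * (j + i) + 1) (2 * l) = 2 ^ (j + i + l) *
      ((j + i).factorial * l.factorial) * powCoeff (-1 / 2) l /
      (Nat.doubleFactorial (2 * (j + i + l) + 1)) := by rw [eq_div_iff hd0, hB]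
  have hcomb : (((j + i).choose j : ℕ) : ℝ) * (((j + i + l).choose (j + i) : ℕ) : ℝ) *
      (j.factorial * i.factorial * l.factorial) = (j + i + l).factorial := by
    rw [← c1, ← c2]; ring
  have h4 : (4 : ℝ) ^ (j + i + l) = 2 ^ (j + i + l) * 2 ^ (j + i + l) := by
    rw [← mul_pow]; norm_num
  have hs2 : √2 ≠ 0 := by positivity
  rw [hA', hB', C, h4]
  rw [← hcomb] at hf1 ⊢
  have hch : (((j + i).choose j : ℕ) : ℝ) ≠ 0 := fun h => hf1 (by rw [h]; ring)
  have hch' : (((j + i + l).choose (j + i) : ℕ) : ℝ) ≠ 0 := fun h => hf1 (by rw [h]; ring)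
  field_simp
  ring

lemma q_one_one_zero (m : ℕ) : q m 1 1 0 = 4 ^ m := by
  rw [q_eq_coeff, qSeries, pow1_zero_right, mul_one, ← pow1_add]
  norm_num

open PowerSeries in
lemma derivative_pow1 (r u : ℝ) :
    d⁄dX ℝ (pow1 r u) = PowerSeries.C (-r * u) * pow1 (r - 1) u := by
  ext k
  rw [PowerSeries.coeff_derivative, PowerSeries.coeff_C_mul, coeff_pow1, coeff_pow1]
  have := powCoeff_succ' r k
  linear_combination u ^ (k + 1) * this

lemma pow1_neg_three_halves (u : ℝ) : pow1 (-3 / 2) u =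
    pow1 (-1 / 2) u + PowerSeries.C u * PowerSeries.X * pow1 (-3 / 2) u := by
  have h : pow1 (-1 / 2) u = pow1 1 u * pow1 (-3 / 2) u := by rw [← pow1_add]; norm_num
  rw [h, pow1_one]; ring

open PowerSeries in
lemma coeff_X_mul_derivative (n : ℕ) (f : PowerSeries ℝ) :
    coeff n (X * d⁄dX ℝ f) = n * coeff n f := by
  cases n with
  | zero => simp
  | succ n => rw [coeff_succ_X_mul, coeff_derivative]; push_cast; ring

open PowerSeries in
/-- The divergence of the generating series. -/
lemma coeff_div_qSeries (n : ℕ) (u₁ u₂ u₃ : ℝ) :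
    coeff n (pow1 (-3 / 2) u₁ * pow1 (-1 / 2) u₂ * pow1 (-1 / 2) u₃) +
    coeff n (pow1 (-1 / 2) u₁ * pow1 (-3 / 2) u₂ * pow1 (-1 / 2) u₃) +
    coeff n (pow1 (-1 / 2) u₁ * pow1 (-1 / 2) u₂ * pow1 (-3 / 2) u₃) =
      (2 * n + 3) * coeff n (qSeries u₁ u₂ u₃) := by
  -- Euler's operator 2X d/dX acts on each factor by 2X d/dX (1-uX)^(-1/2) = uX (1-uX)^(-3/2) =
  -- (1-uX)^(-3/2) - (1-uX)^(-1/2).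
  have hd : PowerSeries.C 2 * (X * d⁄dX ℝ (qSeries u₁ u₂ u₃)) =
      pow1 (-3 / 2) u₁ * pow1 (-1 / 2) u₂ * pow1 (-1 / 2) u₃ +
      pow1 (-1 / 2) u₁ * pow1 (-3 / 2) u₂ * pow1 (-1 / 2) u₃ +
      pow1 (-1 / 2) u₁ * pow1 (-1 / 2) u₂ * pow1 (-3 / 2) u₃ -
      PowerSeries.C 3 * qSeries u₁ u₂ u₃ := by
    have h2 : ∀ u : ℝ, PowerSeries.C 2 * PowerSeries.C (-(-1 / 2) * u) = PowerSeries.C u := by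
      intro u; rw [← map_mul]; congr 1; ring
    have h3 : (PowerSeries.C 3 : PowerSeries ℝ) = 3 := map_ofNat PowerSeries.C 3
    have e1 := pow1_neg_three_halves u₁
    have e2 := pow1_neg_three_halves u₂
    have e3 := pow1_neg_three_halves u₃
    simp only [qSeries, Derivation.leibniz, smul_eq_mul, derivative_pow1]
    rw [show (-1 / 2 - 1 : ℝ) = -3 / 2 by norm_num, h3]
    linear_combination
      (X * pow1 (-3 / 2) u₁ * pow1 (-1 / 2) u₂ * pow1 (-1 / 2) u₃) * h2 u₁ +
      (X * pow1 (-1 / 2) u₁ * pow1 (-3 / 2) u₂ * pow1 (-1 / 2) u₃) * h2 u₂ +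
      (X * pow1 (-1 / 2) u₁ * pow1 (-1 / 2) u₂ * pow1 (-3 / 2) u₃) * h2 u₃ -
      (pow1 (-1 / 2) u₂ * pow1 (-1 / 2) u₃) * e1 - (pow1 (-1 / 2) u₁ * pow1 (-1 / 2) u₃) * e2 -
      (pow1 (-1 / 2) u₁ * pow1 (-1 / 2) u₂) * e3
  have h := congrArg (coeff n) hd
  simp only [coeff_C_mul, coeff_X_mul_derivative, map_add, map_sub] at h
  linarith

lemma deriv_q_first (n : ℕ) (u₁ u₂ u₃ : ℝ) : deriv (fun y => q (n + 1) y u₂ u₃) u₁ =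
    4 ^ (n + 1) * (1 / 2 * PowerSeries.coeff n
      (pow1 (-3 / 2) u₁ * pow1 (-1 / 2) u₂ * pow1 (-1 / 2) u₃)) := by
  simp only [q_eq_coeff, qSeries, mul_assoc (pow1 _ _)]
  have h := hasDerivAt_coeff_pow1_mul (-1 / 2) u₁ (pow1 (-1 / 2) u₂ * pow1 (-1 / 2) u₃) (n + 1)
  rw [PowerSeries.coeff_succ_X_mul] at h
  rw [(h.const_mul (4 ^ (n + 1))).deriv]
  norm_num

lemma q_swap₁₂ (m : ℕ) (u₁ u₂ u₃ : ℝ) : q m u₁ u₂ u₃ = q m u₂ u₁ u₃ := by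
  rw [q_eq_coeff, q_eq_coeff, qSeries, qSeries, mul_comm (pow1 _ u₁)]

lemma q_swap₁₃ (m : ℕ) (u₁ u₂ u₃ : ℝ) : q m u₁ u₂ u₃ = q m u₃ u₂ u₁ := by
  rw [q_eq_coeff, q_eq_coeff, qSeries, qSeries]
  congr 2; ring

lemma divq_succ (n : ℕ) (u₁ u₂ u₃ : ℝ) : divq (n + 1) u₁ u₂ u₃ =
    2 * (2 * n + 3) * 4 ^ n * PowerSeries.coeff n (qSeries u₁ u₂ u₃) := by
  have h := coeff_div_qSeries n u₁ u₂ u₃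
  simp only [divq, q_swap₁₂ _ u₁ _ u₃, q_swap₁₃ _ u₁ u₂ _, deriv_q_first]
  rw [mul_comm (pow1 (-3 / 2) u₂), show pow1 (-3 / 2) u₃ * pow1 (-1 / 2) u₂ * pow1 (-1 / 2) u₁ =
    pow1 (-1 / 2) u₁ * pow1 (-1 / 2) u₂ * pow1 (-3 / 2) u₃ by ring, pow_succ]
  linear_combination (4 ^ n * 2) * h

/-- Since (1-ξX) - (1-ξ)X = 1 - X, the combination defining p₁ raises (1-X)^(-1/2) to (1-X)^(1/2),
which is σ on the diagonal. -/
lemma p₁_diag (n : ℕ) (ξ : ℝ) :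
    p₁ (n + 1) 1 ξ ξ = -(2 * (2 * n + 3) * 4 ^ n) * signPoly n (-3 / 2) ξ ξ := by
  have hd : HasDerivAt (fun y => divq (n + 1) 1 y ξ) (2 * (2 * n + 3) * 4 ^ n *
      (1 / 2 * PowerSeries.coeff n (PowerSeries.X *
        (pow1 (-3 / 2) ξ * (pow1 (-1 / 2) 1 * pow1 (-1 / 2) ξ))))) ξ := by
    have e : (fun y => divq (n + 1) 1 y ξ) = fun y => 2 * (2 * n + 3) * 4 ^ n *
        PowerSeries.coeff n (pow1 (-1 / 2) y * (pow1 (-1 / 2) 1 * pow1 (-1 / 2) ξ)) := by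
      funext y
      rw [divq_succ, qSeries]
      congr 2; ring
    rw [e]
    have h := (hasDerivAt_coeff_pow1_mul (-1 / 2) ξ (pow1 (-1 / 2) 1 * pow1 (-1 / 2) ξ) n).const_mul
      (2 * (2 * n + 3) * 4 ^ n : ℝ)
    refine h.congr_deriv ?_
    norm_num
  rw [p₁, hd.deriv, divq_succ, signPoly]
  have hseries : qSeries 1 ξ ξ - PowerSeries.C (1 - ξ) * (PowerSeries.X *
      (pow1 (-3 / 2) ξ * (pow1 (-1 / 2) 1 * pow1 (-1 / 2) ξ))) =
      pow1 (-3 / 2) ξ * (pow1 (1 / 2) 1 * pow1 (-1 / 2) ξ) := by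
    have h1 : pow1 (1 / 2) 1 = pow1 1 1 * pow1 (-1 / 2) 1 := by rw [← pow1_add]; norm_num
    have h2 := pow1_neg_three_halves ξ
    rw [h1, pow1_one, qSeries, map_sub]
    linear_combination (-pow1 (-1 / 2) 1 * pow1 (-1 / 2) ξ) * h2
  have h := congrArg (PowerSeries.coeff n) hseries
  rw [map_sub, PowerSeries.coeff_C_mul] at h
  linear_combination (-(2 * (2 * n + 3) * 4 ^ n : ℝ)) * h

/-- On the diagonal b moves along with x; merging the two powers fixes b = 0, so that the
one-variable sign rule applies. -/
lemma signPoly_diag (n : ℕ) (x : ℝ) : signPoly n (-3 / 2) x x = signPoly n (-2) 0 x := by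
  have h : pow1 (-2) x = pow1 (-3 / 2) x * pow1 (-1 / 2) x := by rw [← pow1_add]; norm_num
  rw [signPoly, signPoly, pow1_zero_right, h]
  congr 1; ring

lemma continuous_signPoly_diag (n : ℕ) (r : ℝ) {f g : ℝ → ℝ} (hf : Continuous f)
    (hg : Continuous g) : Continuous fun x => signPoly n r (f x) (g x) :=
  (continuous_signPoly n r).comp (hf.prodMk hg)

/-! ### The sign of F in the triangle 0 ≤ b < a < 1. -/

section Sign

variable {n : ℕ} (hn : 1 ≤ n)

lemma continuousAt_ellF {a b : ℝ} (ha : a < 1) (hb : b < 1) :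
    ContinuousAt (fun y => ellF (n + 1) 1 y b) a :=
  (hasDerivAt_ellF_one n ha hb).continuousAt

lemma ellF_strictAntiOn_right {b p q : ℝ} (hb : b < 1) (hbp : b ≤ p) (hq : q < 1)
    (hs : ∀ x ∈ Ioo p q, signPoly n (-3 / 2) b x < 0) :
    StrictAntiOn (fun x => ellF (n + 1) 1 x b) (Icc p q) := by
  refine strictAntiOn_of_deriv_neg (convex_Icc p q)
    (fun x hx => (continuousAt_ellF (hx.2.trans_lt hq) hb).continuousWithinAt) fun x hx => ?_
  rw [interior_Icc] at hx
  have hx1 := hx.2.trans hq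
  rw [(hasDerivAt_ellF_one n hx1 hb).deriv]
  exact mul_neg_of_neg_of_pos
    (mul_neg_of_pos_of_neg (by linarith [hx.1]) (hs x hx)) (ellJ_pos hx1 hb)

lemma ellF_strictMonoOn_right {b p q : ℝ} (hb : b < 1) (hbp : b ≤ p) (hq : q < 1)
    (hs : ∀ x ∈ Ioo p q, 0 < signPoly n (-3 / 2) b x) :
    StrictMonoOn (fun x => ellF (n + 1) 1 x b) (Icc p q) := by
  refine strictMonoOn_of_deriv_pos (convex_Icc p q)
    (fun x hx => (continuousAt_ellF (hx.2.trans_lt hq) hb).continuousWithinAt) fun x hx => ?_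
  rw [interior_Icc] at hx
  have hx1 := hx.2.trans hq
  rw [(hasDerivAt_ellF_one n hx1 hb).deriv]
  exact mul_pos (mul_pos (by linarith [hx.1]) (hs x hx)) (ellJ_pos hx1 hb)

/-- Here the moving variable lies below the fixed one, so the factor a - b in the derivative is
negative. By symmetry of F this describes its dependence on u₃. -/
lemma ellF_strictMonoOn_left {b p q : ℝ} (hb : b < 1) (hq : q ≤ b)
    (hs : ∀ x ∈ Ioo p q, signPoly n (-3 / 2) b x < 0) :
    StrictMonoOn (fun x => ellF (n + 1) 1 x b) (Icc p q) := by
  refine strictMonoOn_of_deriv_pos (convex_Icc p q)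
    (fun x hx => (continuousAt_ellF ((hx.2.trans hq).trans_lt hb) hb).continuousWithinAt)
    fun x hx => ?_
  rw [interior_Icc] at hx
  have hx1 := (hx.2.trans_le hq).trans hb
  rw [(hasDerivAt_ellF_one n hx1 hb).deriv]
  exact mul_pos (mul_pos_of_neg_of_neg (by linarith [hx.2]) (hs x hx)) (ellJ_pos hx1 hb)

lemma ellF_strictAntiOn_left {b p q : ℝ} (hb : b < 1) (hq : q ≤ b)
    (hs : ∀ x ∈ Ioo p q, 0 < signPoly n (-3 / 2) b x) :
    StrictAntiOn (fun x => ellF (n + 1) 1 x b) (Icc p q) := by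
  refine strictAntiOn_of_deriv_neg (convex_Icc p q)
    (fun x hx => (continuousAt_ellF ((hx.2.trans hq).trans_lt hb) hb).continuousWithinAt)
    fun x hx => ?_
  rw [interior_Icc] at hx
  have hx1 := (hx.2.trans_le hq).trans hb
  rw [(hasDerivAt_ellF_one n hx1 hb).deriv]
  exact mul_neg_of_neg_of_pos
    (mul_neg_of_neg_of_pos (by linarith [hx.2]) (hs x hx)) (ellJ_pos hx1 hb)

include hn

/-- If σ ≤ 0 at x, then σ < 0 on (b, x), and F would decrease from its value 0 on the diagonal. -/
lemma signPoly_pos_of_ellF_nonneg {b x : ℝ} (hb : 0 ≤ b) (hbx : b < x) (hx : x < 1)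
    (h : 0 ≤ ellF (n + 1) 1 x b) : 0 < signPoly n (-3 / 2) b x := by
  by_contra h0
  have hb1 := hbx.trans hx
  have := ellF_strictAntiOn_right hb1 le_rfl hx (fun y hy =>
    signPoly_neg_of_nonpos hn (by norm_num) hb hb1 (hb.trans hy.1.le) hy.2 (not_lt.1 h0))
    (left_mem_Icc.2 hbx.le) (right_mem_Icc.2 hbx.le) hbx
  simp only [ellF_self] at this
  linarith

/-- Once F is nonnegative, σ is positive from there on. Thus F(·, b) has at most one zero beyond b;
the two lemmas after this one are the mirror image for u₃. -/
lemma ellF_lt_of_nonneg {b x y : ℝ} (hb : 0 ≤ b) (hbx : b < x) (hxy : x < y) (hy : y < 1)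
    (h : 0 ≤ ellF (n + 1) 1 x b) : ellF (n + 1) 1 x b < ellF (n + 1) 1 y b := by
  have hb1 := hbx.trans (hxy.trans hy)
  have hs := signPoly_pos_of_ellF_nonneg hn hb hbx (hxy.trans hy) h
  exact ellF_strictMonoOn_right hb1 hbx.le hy (fun z hz =>
    signPoly_pos_of_nonneg hn (by norm_num) hb hb1 (hb.trans hbx.le) hz.1 hs.le)
    (left_mem_Icc.2 hxy.le) (right_mem_Icc.2 hxy.le) hxy

lemma signPoly_neg_of_ellF_nonpos {b x : ℝ} (hx : 0 ≤ x) (hxb : x < b) (hb1 : b < 1)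
    (h : ellF (n + 1) 1 x b ≤ 0) : signPoly n (-3 / 2) b x < 0 := by
  by_contra h0
  have hb : 0 ≤ b := hx.trans hxb.le
  have := ellF_strictAntiOn_left hb1 le_rfl (fun y hy =>
    signPoly_pos_of_nonneg hn (by norm_num) hb hb1 hx hy.1 (not_lt.1 h0))
    (left_mem_Icc.2 hxb.le) (right_mem_Icc.2 hxb.le) hxb
  simp only [ellF_self] at this
  linarith

lemma ellF_lt_of_nonpos {b x y : ℝ} (hx : 0 ≤ x) (hxy : x < y) (hyb : y < b) (hb1 : b < 1)
    (h : ellF (n + 1) 1 y b ≤ 0) : ellF (n + 1) 1 x b < ellF (n + 1) 1 y b := by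
  have hs := signPoly_neg_of_ellF_nonpos hn (hx.trans hxy.le) hyb hb1 h
  exact ellF_strictMonoOn_left hb1 hyb.le (fun z hz =>
    signPoly_neg_of_nonpos hn (by norm_num) (hx.trans (hxy.trans hyb).le) hb1
      (hx.trans hz.1.le) hz.2 hs.le)
    (left_mem_Icc.2 hxy.le) (right_mem_Icc.2 hxy.le) hxy

/-- With σ ≤ 0 at the diagonal point, F(a, ·) increases all the way up to the value 0 there. This
excludes zeros with a ≤ u*. -/
lemma ellF_neg_of_diag_nonpos {a b : ℝ} (hb : 0 ≤ b) (hba : b < a) (ha : a < 1)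
    (h : signPoly n (-2) 0 a ≤ 0) : ellF (n + 1) 1 a b < 0 := by
  rw [← signPoly_diag] at h
  rw [← ellF_symm]
  have := ellF_strictMonoOn_left ha le_rfl (fun z hz =>
    signPoly_neg_of_nonpos hn (by norm_num) (hb.trans hba.le) ha
      (hb.trans hz.1.le) hz.2 h)
    (left_mem_Icc.2 hba.le) (right_mem_Icc.2 hba.le) hba
  simpa using this

lemma ellF_pos_of_diag_nonneg {a b : ℝ} (hb : 0 ≤ b) (hba : b < a) (ha : a < 1)
    (h : 0 ≤ signPoly n (-2) 0 b) : 0 < ellF (n + 1) 1 a b := by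
  rw [← signPoly_diag] at h
  have := ellF_strictMonoOn_right (hba.trans ha) le_rfl ha (fun z hz =>
    signPoly_pos_of_nonneg hn (by norm_num) hb (hba.trans ha) hb hz.1 h)
    (left_mem_Icc.2 hba.le) (right_mem_Icc.2 hba.le) hba
  simpa using this

omit hn in
lemma exists_ellF_pos_of_diag_pos {a : ℝ} (ha0 : 0 < a) (ha : a < 1)
    (h : 0 < signPoly n (-2) 0 a) : ∃ b, 0 ≤ b ∧ b < a ∧ 0 < ellF (n + 1) 1 a b := by
  rw [← signPoly_diag] at h
  have hc : Continuous fun x => signPoly n (-3 / 2) a x :=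
    continuous_signPoly_diag n _ continuous_const continuous_id
  have hev : ∀ᶠ x in 𝓝 a, 0 < signPoly n (-3 / 2) a x := hc.continuousAt.eventually_const_lt h
  obtain ⟨l, hl, hlu⟩ := (mem_nhdsLE_iff_exists_Ioc_subset).1 (nhdsWithin_le_nhds hev)
  refine ⟨max 0 ((l + a) / 2), le_max_left _ _, max_lt ha0 (by simp only [mem_Iio] at hl; linarith),
    ?_⟩
  have hlt : max 0 ((l + a) / 2) < a := max_lt ha0 (by simp only [mem_Iio] at hl; linarith)
  rw [← ellF_symm]
  have := ellF_strictAntiOn_left (n := n) (p := max 0 ((l + a) / 2)) ha le_rfl (fun z hz => hlu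
    ⟨by
      have := (le_max_right 0 ((l + a) / 2)).trans_lt hz.1
      simp only [mem_Iio] at hl
      linarith, hz.2.le⟩)
    (left_mem_Icc.2 hlt.le) (right_mem_Icc.2 hlt.le) hlt
  simpa using this

lemma exists_diag_zero : ∃ us ∈ Ioo (0 : ℝ) 1, signPoly n (-2) 0 us = 0 := by
  have hc : ContinuousOn (fun x => signPoly n (-2) 0 x) (Icc 0 1) :=
    (continuous_signPoly_diag n _ continuous_const continuous_id).continuousOn
  have h0 : signPoly n (-2) 0 0 < 0 := signPoly_zero_neg hn le_rfl one_pos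
  -- At x = 1 the series collapses to (1-X)^(-3/2).
  have h1 : 0 < signPoly n (-2) 0 1 := by
    rw [signPoly, pow1_zero_right, mul_one, ← pow1_add, coeff_pow1]
    have := powCoeff_pos (r := -2 + 1 / 2) (by norm_num) n
    simpa using this
  obtain ⟨x, hx, hx0⟩ := intermediate_value_Ioo zero_le_one hc ⟨h0, h1⟩
  exact ⟨x, hx, hx0⟩

omit hn in
lemma wCoeff_neg {a : ℝ} (ha : 0 ≤ a) (ha1 : a < 1) : wCoeff (n + 1) 1 a 0 < 0 := by
  rw [wCoeff, wSeries, pow1_zero_right, mul_one, mul_comm]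
  exact coeff_half_mul_neg ha ha1 n

omit hn in
lemma tendsto_speed₂_one : Tendsto (fun a => speed₂ (n + 1) 1 a 0) (𝓝[<] 1) (𝓝 (4 ^ (n + 1))) := by
  have h : Tendsto (fun a : ℝ => ((1, a, 0) : ℝ × ℝ × ℝ)) (𝓝[<] 1) (𝓝[domain] (1, 1, 0)) := by
    refine tendsto_nhdsWithin_iff.2 ⟨?_, ?_⟩
    · have : Continuous fun a : ℝ => ((1, a, 0) : ℝ × ℝ × ℝ) := by fun_prop
      exact (this.tendsto 1).mono_left nhdsWithin_le_nhds
    · filter_upwards [Ioo_mem_nhdsLT (zero_lt_one' ℝ)] with a ha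
      exact ⟨ha.1, ha.2⟩
  exact (tendsto_speed₂_corner n).comp h

lemma exists_ellF_zero {us : ℝ} (hus : us ∈ Ioo (0 : ℝ) 1) (hz : signPoly n (-2) 0 us = 0) :
    ∃ uss ∈ Ioo us 1, ellF (n + 1) 1 uss 0 = 0 := by
  have h1 : ellF (n + 1) 1 us 0 < 0 := ellF_neg_of_diag_nonpos hn le_rfl hus.1 hus.2 hz.le
  -- Near a = 1 the speed is close to 4^m > 0 although w_m < 0, so the term with F must be positive.
  have h2 : ∃ a ∈ Ioo us 1, 0 < ellF (n + 1) 1 a 0 := by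
    have hev := (tendsto_speed₂_one (n := n)).eventually_const_lt (u := 0) (by positivity)
    obtain ⟨a, ha, haI⟩ := (hev.and (Ioo_mem_nhdsLT hus.2)).exists
    refine ⟨a, haI, ?_⟩
    have ha0 : 0 < a := hus.1.trans haI.1
    rw [speed₂_eq (n + 1) ha0 haI.2] at ha
    have h3 := pos_of_mul_pos_right ha (by positivity)
    have h4 := wCoeff_neg (n := n) ha0.le haI.2
    have hJ := ellJ_pos (zero_lt_one' ℝ) haI.2
    have h5 : 0 < ellF (n + 1) 1 a 0 / (2 * (a - 0) * ellJ 1 0 a) := by linarith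
    by_contra h6
    exact absurd (div_nonpos_of_nonpos_of_nonneg (not_lt.1 h6)
      (by rw [sub_zero]; positivity)) (not_le.2 h5)
  obtain ⟨a, haI, ha⟩ := h2
  obtain ⟨x, hx, hx0⟩ := intermediate_value_Ioo haI.1.le
    (fun x hx => (continuousAt_ellF (n := n) (b := 0) (hx.2.trans_lt haI.2)
      one_pos).continuousWithinAt) ⟨h1, ha⟩
  exact ⟨x, ⟨hx.1, hx.2.trans haI.2⟩, hx0⟩

end Sign

/-! ### The zero curve of F: existence, monotonicity, continuity, completeness. -/

/-- The zero curve `b = B a` of `ellF` over `[us, uss]`, continued by `0`. -/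
structure IsZeroCurve (n : ℕ) (us uss : ℝ) (B : ℝ → ℝ) : Prop where
  one_le : 1 ≤ n
  us_pos : 0 < us
  us_lt : us < uss
  uss_lt : uss < 1
  diag : signPoly n (-2) 0 us = 0
  axis : ellF (n + 1) 1 uss 0 = 0
  apply_us : B us = us
  apply_of_le : ∀ a, uss ≤ a → B a = 0
  nonneg : ∀ a ∈ Ioc us uss, 0 ≤ B a
  lt : ∀ a ∈ Ioc us uss, B a < a
  zero : ∀ a ∈ Ioc us uss, ellF (n + 1) 1 a (B a) = 0

/-- For a in (u*, u**], F(a, ·) is nonpositive at 0 and positive at some b below the diagonal,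
because σ > 0 at the diagonal point; a zero lies between. -/
lemma exists_isZeroCurve {n : ℕ} (hn : 1 ≤ n) : ∃ us uss B, IsZeroCurve n us uss B := by
  obtain ⟨us, hus, hz⟩ := exists_diag_zero hn
  obtain ⟨uss, huss, hz'⟩ := exists_ellF_zero hn hus hz
  have hex : ∀ a ∈ Ioc us uss, ∃ b, 0 ≤ b ∧ b < a ∧ ellF (n + 1) 1 a b = 0 := by
    intro a ha
    have ha0 : 0 < a := hus.1.trans ha.1
    have ha1 : a < 1 := ha.2.trans_lt huss.2
    have h0 : ellF (n + 1) 1 a 0 ≤ 0 := by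
      rcases ha.2.lt_or_eq with h | h
      · by_contra h1
        have := ellF_lt_of_nonneg hn le_rfl ha0 h huss.2 (not_le.1 h1).le
        linarith
      · rw [h, hz']
    have hd := signPoly_pos_of_nonneg hn (r := -2) (by norm_num) le_rfl one_pos hus.1.le ha.1 hz.ge
    obtain ⟨b, hb0, hba, hb⟩ := exists_ellF_pos_of_diag_pos ha0 ha1 hd
    rw [← ellF_symm] at h0 hb
    obtain ⟨x, hx, hx0⟩ := intermediate_value_Icc hb0
      (fun x hx => (continuousAt_ellF (n := n) (b := a) ((hx.2.trans hba.le).trans_lt ha1)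
        ha1).continuousWithinAt) ⟨h0, hb.le⟩
    exact ⟨x, hx.1, hx.2.trans_lt hba, by rw [← ellF_symm]; exact hx0⟩
  choose! b hb0 hb1 hb2 using hex
  -- The value 0 from u** on lets a single B give u₃ in both regions.
  refine ⟨us, uss, fun a => if a ≤ us then us else if a < uss then b a else 0,
    hn, hus.1, huss.1, huss.2, hz, hz', by simp, ?_, ?_, ?_, ?_⟩
  · intro a ha
    rw [if_neg (by linarith [huss.1]), if_neg (by linarith)]
  all_goals
    intro a ha
    rw [if_neg (by linarith [ha.1])]
    split_ifs with h
  · exact hb0 a ha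
  · exact le_rfl
  · exact hb1 a ha
  · exact hus.1.trans ha.1
  · exact hb2 a ha
  · rw [le_antisymm ha.2 (not_lt.1 h)]; exact hz'

namespace IsZeroCurve

variable {n : ℕ} {us uss : ℝ} {B : ℝ → ℝ} (D : IsZeroCurve n us uss B)

include D

lemma us_lt_one : us < 1 := D.us_lt.trans D.uss_lt

lemma lt_one_of_mem {a : ℝ} (ha : a ∈ Ioc us uss) : a < 1 := ha.2.trans_lt D.uss_lt

lemma ellF_neg {a b : ℝ} (ha : a ∈ Ioc us uss) (hb : 0 ≤ b) (hba : b < B a) :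
    ellF (n + 1) 1 a b < 0 := by
  have h := D.zero a ha
  rw [← ellF_symm] at h ⊢
  have := ellF_lt_of_nonpos D.one_le hb hba (D.lt a ha) (D.lt_one_of_mem ha) h.le
  linarith

lemma ellF_pos {a b : ℝ} (ha : a ∈ Ioc us uss) (hb : B a < b) (hba : b < a) :
    0 < ellF (n + 1) 1 a b := by
  by_contra h0
  have h := D.zero a ha
  rw [← ellF_symm] at h h0
  have := ellF_lt_of_nonpos D.one_le (D.nonneg a ha) hb hba (D.lt_one_of_mem ha) (not_lt.1 h0)
  linarith

/-- For b ≥ u* the sign rule makes σ positive beyond b, so F(·, b) has no zero there. -/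
lemma B_lt_us {a : ℝ} (ha : a ∈ Ioc us uss) : B a < us := by
  by_contra h
  rw [not_lt] at h
  have hd : 0 ≤ signPoly n (-2) 0 (B a) := by
    rcases h.lt_or_eq with h | h
    · exact (signPoly_pos_of_nonneg D.one_le (by norm_num) le_rfl one_pos D.us_pos.le h
        D.diag.ge).le
    · rw [← h, D.diag]
  have := ellF_pos_of_diag_nonneg D.one_le (D.nonneg a ha) (D.lt a ha) (D.lt_one_of_mem ha) hd
  linarith [D.zero a ha]

/-- F(·, B a₁) increases past its zero a₁, hence is positive at a₂ > a₁; the sign of F(a₂, ·) on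
either side of its zero then places B a₂ below B a₁. -/
lemma strictAntiOn : StrictAntiOn B (Icc us uss) := by
  intro a₁ h₁ a₂ h₂ h
  have h₂' : a₂ ∈ Ioc us uss := ⟨h₁.1.trans_lt h, h₂.2⟩
  rcases h₁.1.eq_or_lt with h0 | h0
  · rw [← h0, D.apply_us]; exact D.B_lt_us h₂'
  · have h₁' : a₁ ∈ Ioc us uss := ⟨h0, h₁.2⟩
    have hpos := ellF_lt_of_nonneg D.one_le (D.nonneg a₁ h₁') (D.lt a₁ h₁') h (D.lt_one_of_mem h₂')
      (D.zero a₁ h₁').ge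
    rw [D.zero a₁ h₁'] at hpos
    by_contra hle
    rcases (not_lt.1 hle).lt_or_eq with h3 | h3
    · linarith [D.ellF_neg h₂' (D.nonneg a₁ h₁') h3]
    · rw [h3, D.zero a₂ h₂'] at hpos; exact lt_irrefl _ hpos

lemma apply_uss : B uss = 0 := D.apply_of_le uss le_rfl

lemma B_nonneg {a : ℝ} (ha : a ∈ Icc us uss) : 0 ≤ B a := by
  rcases ha.1.eq_or_lt with h | h
  · rw [← h, D.apply_us]; exact D.us_pos.le
  · exact D.nonneg a ⟨h, ha.2⟩

lemma B_le {a : ℝ} (ha : a ∈ Icc us uss) : B a ≤ a := by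
  rcases ha.1.eq_or_lt with h | h
  · rw [← h, D.apply_us]
  · exact (D.lt a ⟨h, ha.2⟩).le

/-- A strict sign of F(a₀, ·) at a level below or above B a₀ persists for nearby a and keeps B a on
the right side of that level. The end point u* uses monotonicity, as F vanishes on the diagonal. -/
lemma continuousOn : ContinuousOn B (Icc us uss) := by
  intro a₀ h₀
  have ha1 : a₀ < 1 := h₀.2.trans_lt D.uss_lt
  refine tendsto_order.2 ⟨fun l hl => ?_, fun r hr => ?_⟩
  · rcases lt_or_ge l 0 with hl0 | hl0
    · filter_upwards [self_mem_nhdsWithin] with a ha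
      exact hl0.trans_le (D.B_nonneg ha)
    · have hla := hl.trans_le (D.B_le h₀)
      have hneg : ellF (n + 1) 1 a₀ l < 0 := by
        rcases h₀.1.eq_or_lt with h | h
        · rw [← h] at hla ha1 ⊢
          exact ellF_neg_of_diag_nonpos D.one_le hl0 hla ha1 D.diag.le
        · exact D.ellF_neg ⟨h, h₀.2⟩ hl0 hl
      have hev := (continuousAt_ellF (n := n) ha1 (hla.trans ha1)).eventually_lt_const hneg
      filter_upwards [self_mem_nhdsWithin, nhdsWithin_le_nhds hev,
        nhdsWithin_le_nhds (Ioi_mem_nhds hla)] with a ha h1 h2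
      rcases ha.1.eq_or_lt with h | h
      · rw [← h, D.apply_us]
        refine hl.trans_le ?_
        have := D.strictAntiOn.antitoneOn (left_mem_Icc.2 D.us_lt.le) h₀ h₀.1
        rwa [D.apply_us] at this
      · by_contra h3
        rcases (not_lt.1 h3).lt_or_eq with h4 | h4
        · linarith [D.ellF_pos ⟨h, ha.2⟩ h4 h2]
        · rw [← h4, D.zero a ⟨h, ha.2⟩] at h1; exact lt_irrefl _ h1
  · rcases h₀.1.eq_or_lt with h | h
    · filter_upwards [self_mem_nhdsWithin] with a ha
      have := D.strictAntiOn.antitoneOn (left_mem_Icc.2 D.us_lt.le) ha ha.1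
      rw [← h] at hr
      exact this.trans_lt hr
    · have h₀' : a₀ ∈ Ioc us uss := ⟨h, h₀.2⟩
      obtain ⟨r', hr1, hr2⟩ := exists_between (lt_min hr (D.lt a₀ h₀'))
      obtain ⟨hr3, hr4⟩ := lt_min_iff.1 hr2
      have hpos := D.ellF_pos h₀' hr1 hr4
      have hev := (continuousAt_ellF (n := n) ha1 (hr4.trans ha1)).eventually_const_lt hpos
      filter_upwards [self_mem_nhdsWithin, nhdsWithin_le_nhds hev,
        nhdsWithin_le_nhds (Ioi_mem_nhds hr4), nhdsWithin_le_nhds (Ioi_mem_nhds h)]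
        with a ha h1 h2 h3
      by_contra h4
      have h4 := not_lt.1 h4
      have hr0 : 0 ≤ r' := (D.B_nonneg h₀).trans hr1.le
      linarith [D.ellF_neg ⟨h3, ha.2⟩ hr0 (hr3.trans_le h4)]

lemma ellF_axis_pos {a : ℝ} (ha : uss < a) (ha1 : a < 1) : 0 < ellF (n + 1) 1 a 0 := by
  have := ellF_lt_of_nonneg D.one_le le_rfl (D.us_pos.trans D.us_lt) ha ha1 D.axis.ge
  rwa [D.axis] at this

lemma eq_uss_of_zero {a : ℝ} (ha : 0 < a) (ha1 : a < 1) (h : ellF (n + 1) 1 a 0 = 0) :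
    a = uss := by
  rcases lt_trichotomy a uss with h1 | h1 | h1
  · have := ellF_lt_of_nonneg D.one_le le_rfl ha h1 D.uss_lt h.ge
    rw [h, D.axis] at this
    exact absurd this (lt_irrefl _)
  · exact h1
  · linarith [D.ellF_axis_pos h1 ha1]

/-- The zeros of `ellF` in the triangle are exactly the points of the curve. -/
lemma eq_of_zero {a b : ℝ} (hb : 0 ≤ b) (hba : b < a) (ha : a < 1)
    (h : ellF (n + 1) 1 a b = 0) : a ∈ Ioc us uss ∧ b = B a := by
  have h1 : us < a := by
    by_contra h1
    have hd : signPoly n (-2) 0 a ≤ 0 := by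
      rcases (not_lt.1 h1).lt_or_eq with h2 | h2
      · exact (signPoly_neg_of_nonpos D.one_le (by norm_num) le_rfl one_pos (hb.trans hba.le) h2
          D.diag.le).le
      · rw [h2, D.diag]
    linarith [ellF_neg_of_diag_nonpos D.one_le hb hba ha hd]
  have h2 : a ≤ uss := by
    by_contra h2
    have hpos := D.ellF_axis_pos (not_le.1 h2) ha
    rcases hb.eq_or_lt with h3 | h3
    · rw [← h3] at h; linarith
    · rw [← ellF_symm] at h hpos
      linarith [ellF_lt_of_nonpos D.one_le le_rfl h3 hba ha h.le]
  refine ⟨⟨h1, h2⟩, ?_⟩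
  rcases lt_trichotomy b (B a) with h3 | h3 | h3
  · linarith [D.ellF_neg ⟨h1, h2⟩ hb h3]
  · exact h3
  · linarith [D.ellF_pos ⟨h1, h2⟩ h3 hba]

end IsZeroCurve

/-! ### Implicit differentiation and C¹ inverses. -/

/-- Implicit differentiation along a continuous zero curve. -/
lemma hasDerivAt_of_zero_curve {F Fa Fb : ℝ → ℝ → ℝ} {B : ℝ → ℝ} {a₀ : ℝ} {O : Set ℝ}
    (hO : IsOpen O) (ha₀ : a₀ ∈ O) (hb₀ : B a₀ ∈ O) (hconv : Convex ℝ O)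
    (hFa : HasDerivAt (fun a => F a (B a₀)) (Fa a₀ (B a₀)) a₀)
    (hFb : ∀ a ∈ O, ∀ b ∈ O, HasDerivAt (fun b => F a b) (Fb a b) b)
    (hFbc : ContinuousAt (fun z : ℝ × ℝ => Fb z.1 z.2) (a₀, B a₀))
    (hne : Fb a₀ (B a₀) ≠ 0) (hB : ContinuousAt B a₀) (hz : ∀ᶠ a in 𝓝 a₀, F a (B a) = 0) :
    HasDerivAt B (-Fa a₀ (B a₀) / Fb a₀ (B a₀)) a₀ := by
  -- The mean value theorem in b alone, with η between B a₀ and B a; in a only the derivative along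
  -- the line b = B a₀ is then needed.
  have hmv : ∀ a, ∃ η, a ∈ O → B a ∈ O →
      η ∈ uIcc (B a₀) (B a) ∧ F a (B a) - F a (B a₀) = Fb a η * (B a - B a₀) := by
    intro a
    by_cases ha : a ∈ O ∧ B a ∈ O
    · obtain ⟨ha, hBa⟩ := ha
      rcases eq_or_ne (B a) (B a₀) with h | h
      · exact ⟨B a₀, fun _ _ => ⟨left_mem_uIcc, by rw [h]; ring⟩⟩
      · have hsub : uIcc (B a₀) (B a) ⊆ O := by
          rw [← segment_eq_uIcc]; exact hconv.segment_subset hb₀ hBa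
        have hlt : min (B a₀) (B a) < max (B a₀) (B a) := by
          rw [min_lt_max]; exact h.symm
        obtain ⟨η, hη, he⟩ := exists_hasDerivAt_eq_slope (fun b => F a b) (fun b => Fb a b) hlt
          (fun b hb => (hFb a ha b (hsub hb)).continuousAt.continuousWithinAt)
          (fun b hb => hFb a ha b (hsub (Ioo_subset_Icc_self hb)))
        refine ⟨η, fun _ _ => ⟨Ioo_subset_Icc_self hη, ?_⟩⟩
        rcases le_total (B a₀) (B a) with h1 | h1
        · rw [min_eq_left h1, max_eq_right h1] at he
          have : B a - B a₀ ≠ 0 := sub_ne_zero.2 h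
          rw [he]; field_simp
        · rw [min_eq_right h1, max_eq_left h1] at he
          have : B a₀ - B a ≠ 0 := sub_ne_zero.2 h.symm
          rw [he]; field_simp; ring
    · exact ⟨0, fun h1 h2 => absurd ⟨h1, h2⟩ ha⟩
  choose η hη using hmv
  have hev : ∀ᶠ a in 𝓝 a₀, a ∈ O ∧ B a ∈ O :=
    Filter.Eventually.and (hO.mem_nhds ha₀) (hB (hO.mem_nhds hb₀))
  have hηt : Tendsto η (𝓝 a₀) (𝓝 (B a₀)) := by
    rw [tendsto_iff_dist_tendsto_zero]
    have h1 : Tendsto (fun a => dist (B a) (B a₀)) (𝓝 a₀) (𝓝 0) :=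
      tendsto_iff_dist_tendsto_zero.1 hB
    refine squeeze_zero' (Eventually.of_forall fun _ => dist_nonneg) ?_ h1
    filter_upwards [hev] with a ha
    have := (hη a ha.1 ha.2).1
    rw [Real.dist_eq, Real.dist_eq]
    exact abs_sub_left_of_mem_uIcc this
  have hFbt : Tendsto (fun a => Fb a (η a)) (𝓝 a₀) (𝓝 (Fb a₀ (B a₀))) :=
    hFbc.tendsto.comp (tendsto_id.prodMk_nhds hηt)
  have hne' : ∀ᶠ a in 𝓝 a₀, Fb a (η a) ≠ 0 := hFbt.eventually_ne hne
  rw [hasDerivAt_iff_tendsto_slope] at hFa ⊢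
  have hq := hFa.neg.div (hFbt.mono_left nhdsWithin_le_nhds) hne
  refine hq.congr' ?_
  filter_upwards [nhdsWithin_le_nhds hev, nhdsWithin_le_nhds hne', nhdsWithin_le_nhds hz,
    self_mem_nhdsWithin] with a h1 h2 h3 h4
  have h5 := (hη a h1.1 h1.2).2
  have h6 : F a₀ (B a₀) = 0 := hz.self_of_nhds
  have h7 : a - a₀ ≠ 0 := sub_ne_zero.2 h4
  rw [Pi.div_apply, slope_def_field, slope_def_field, h6]
  rw [h3] at h5
  field_simp
  linarith

/-- The inverse of a strictly increasing continuous function on a compact interval. -/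
lemma exists_inverse_Icc {f : ℝ → ℝ} {p q : ℝ} (hpq : p ≤ q) (hm : StrictMonoOn f (Icc p q))
    (hc : ContinuousOn f (Icc p q)) : ∃ g : ℝ → ℝ,
      (∀ y ∈ Icc (f p) (f q), g y ∈ Icc p q ∧ f (g y) = y) ∧ (∀ x ∈ Icc p q, g (f x) = x) ∧
      StrictMonoOn g (Icc (f p) (f q)) ∧ ContinuousOn g (Icc (f p) (f q)) := by
  have hex : ∀ y ∈ Icc (f p) (f q), ∃ x ∈ Icc p q, f x = y := fun y hy => by
    obtain ⟨x, hx, h⟩ := intermediate_value_Icc hpq hc hy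
    exact ⟨x, hx, h⟩
  choose! g hg1 hg2 using hex
  have hmaps : ∀ x ∈ Icc p q, f x ∈ Icc (f p) (f q) := fun x hx =>
    ⟨hm.monotoneOn (left_mem_Icc.2 hpq) hx hx.1, hm.monotoneOn hx (right_mem_Icc.2 hpq) hx.2⟩
  have hlt : ∀ x ∈ Icc p q, ∀ y ∈ Icc (f p) (f q), (f x < y ↔ x < g y) ∧ (y < f x ↔ g y < x) := by
    intro x hx y hy
    have h := hg2 y hy
    constructor
    · conv_lhs => rw [← h]
      exact hm.lt_iff_lt hx (hg1 y hy)
    · conv_lhs => rw [← h]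
      exact hm.lt_iff_lt (hg1 y hy) hx
  refine ⟨g, fun y hy => ⟨hg1 y hy, hg2 y hy⟩, fun x hx => ?_, ?_, ?_⟩
  · exact hm.injOn (hg1 _ (hmaps x hx)) hx (hg2 _ (hmaps x hx))
  · intro y hy z hz hyz
    rw [← (hlt _ (hg1 y hy) z hz).1, hg2 y hy]; exact hyz
  · intro y hy
    refine tendsto_order.2 ⟨fun l hl => ?_, fun r hr => ?_⟩
    · rcases lt_or_ge l p with h | h
      · filter_upwards [self_mem_nhdsWithin] with z hz
        exact h.trans_le (hg1 z hz).1
      · have hl' : l ∈ Icc p q := ⟨h, hl.le.trans (hg1 y hy).2⟩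
        filter_upwards [self_mem_nhdsWithin,
          nhdsWithin_le_nhds (Ioi_mem_nhds ((hlt l hl' y hy).1.2 hl))] with z hz h1
        exact (hlt l hl' z hz).1.1 h1
    · rcases lt_or_ge q r with h | h
      · filter_upwards [self_mem_nhdsWithin] with z hz
        exact (hg1 z hz).2.trans_lt h
      · have hr' : r ∈ Icc p q := ⟨(hg1 y hy).1.trans hr.le, h⟩
        filter_upwards [self_mem_nhdsWithin,
          nhdsWithin_le_nhds (Iio_mem_nhds ((hlt r hr' y hy).2.2 hr))] with z hz h1
        exact (hlt r hr' z hz).2.1 h1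

/-- A function with continuous derivative on an open set is `C¹` there. -/
lemma contDiffOn_one_of_hasDerivAt {f f' : ℝ → ℝ} {O : Set ℝ} (hO : IsOpen O)
    (hf : ∀ x ∈ O, HasDerivAt f (f' x) x) (hf' : ContinuousOn f' O) : ContDiffOn ℝ 1 f O := by
  have h := (contDiffOn_succ_iff_deriv_of_isOpen (𝕜 := ℝ) (f := f) (n := 0) hO).2
  rw [zero_add] at h
  refine h ⟨fun x hx => (hf x hx).differentiableAt.differentiableWithinAt, by simp, ?_⟩
  rw [contDiffOn_zero]
  exact hf'.congr fun x hx => (hf x hx).deriv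

/-- The inverse of a `C¹` function with nonvanishing derivative is `C¹`. -/
lemma contDiffOn_one_inverse {f f' g : ℝ → ℝ} {I J : Set ℝ} (hJ : IsOpen J)
    (hf : ∀ x ∈ I, HasDerivAt f (f' x) x) (hf' : ContinuousOn f' I) (hne : ∀ x ∈ I, f' x ≠ 0)
    (hg : ContinuousOn g J) (hmaps : MapsTo g J I) (hfg : ∀ y ∈ J, f (g y) = y) :
    ContDiffOn ℝ 1 g J := by
  refine contDiffOn_one_of_hasDerivAt (f' := fun y => (f' (g y))⁻¹) hJ (fun y hy => ?_) ?_
  · refine HasDerivAt.of_local_left_inverse (hg.continuousAt (hJ.mem_nhds hy))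
      (hf _ (hmaps hy)) (hne _ (hmaps hy)) ?_
    filter_upwards [hJ.mem_nhds hy] with z hz using hfg z hz
  · exact (hf'.comp hg hmaps).inv₀ fun y hy => hne _ (hmaps hy)

lemma hasDerivAt_coeff_mul {f g : ℝ → PowerSeries ℝ} {f' g' : PowerSeries ℝ} {a : ℝ}
    (hf : ∀ k, HasDerivAt (fun y => PowerSeries.coeff k (f y)) (PowerSeries.coeff k f') a)
    (hg : ∀ k, HasDerivAt (fun y => PowerSeries.coeff k (g y)) (PowerSeries.coeff k g') a) (k : ℕ) :
    HasDerivAt (fun y => PowerSeries.coeff k (f y * g y))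
      (PowerSeries.coeff k (f' * g a + f a * g')) a := by
  simp only [map_add, PowerSeries.coeff_mul, ← Finset.sum_add_distrib]
  exact HasDerivAt.fun_sum fun p _ => (hf p.1).mul (hg p.2)

lemma hasDerivAt_coeff_pow1_comp (r : ℝ) {B : ℝ → ℝ} {B' a : ℝ} (hB : HasDerivAt B B' a) (k : ℕ) :
    HasDerivAt (fun y => PowerSeries.coeff k (pow1 r (B y)))
      (PowerSeries.coeff k (PowerSeries.C (-r * B') * (PowerSeries.X * pow1 (r - 1) (B a)))) a := by
  have h := hasDerivAt_coeff_pow1_mul r (B a) 1 k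
  simp only [mul_one] at h
  refine (h.comp a hB).congr_deriv ?_
  rw [PowerSeries.coeff_C_mul]; ring

lemma hasDerivAt_wCoeff_comp (n : ℕ) {B : ℝ → ℝ} {B' a : ℝ} (hB : HasDerivAt B B' a) :
    HasDerivAt (fun y => wCoeff (n + 1) 1 y (B y))
      (1 / 2 * (signPoly n (-3 / 2) (B a) a + signPoly n (-3 / 2) a (B a) * B')) a := by
  have h := hasDerivAt_coeff_mul (hasDerivAt_coeff_pow1_comp (-1 / 2) (hasDerivAt_id a))
    (hasDerivAt_coeff_mul (f := fun _ => pow1 (1 / 2) 1) (f' := 0)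
      (fun k => by simpa using hasDerivAt_const a _)
      (hasDerivAt_coeff_pow1_comp (-1 / 2) hB)) (n + 1)
  refine h.congr_deriv ?_
  have e : PowerSeries.C (-(-1 / 2) * 1) * (PowerSeries.X * pow1 (-1 / 2 - 1) (id a)) *
      (pow1 (1 / 2) 1 * pow1 (-1 / 2) (B a)) +
      pow1 (-1 / 2) (id a) * (0 * pow1 (-1 / 2) (B a) + pow1 (1 / 2) 1 *
      (PowerSeries.C (-(-1 / 2) * B') * (PowerSeries.X * pow1 (-1 / 2 - 1) (B a)))) =
      PowerSeries.X * (PowerSeries.C (1 / 2) * (pow1 (-3 / 2) a *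
        (pow1 (1 / 2) 1 * pow1 (-1 / 2) (B a))) + PowerSeries.C (1 / 2 * B') *
        (pow1 (-3 / 2) (B a) * (pow1 (1 / 2) 1 * pow1 (-1 / 2) a))) := by
    norm_num
    ring
  rw [e, PowerSeries.coeff_succ_X_mul, map_add, PowerSeries.coeff_C_mul, PowerSeries.coeff_C_mul]
  simp only [signPoly]
  ring

lemma continuousOn_ellJ_comp {f g : ℝ → ℝ} {O : Set ℝ} (hf : ContinuousOn f O)
    (hg : ContinuousOn g O) (hf1 : ∀ x ∈ O, f x < 1) (hg1 : ∀ x ∈ O, g x < 1) :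
    ContinuousOn (fun x => ellJ 1 (f x) (g x)) O :=
  continuousOn_ellJ.comp (f := fun x => ((1, f x, g x) : ℝ × ℝ × ℝ))
    (continuousOn_const.prodMk (hf.prodMk hg)) fun x hx => ⟨hf1 x hx, hg1 x hx⟩

lemma continuousOn_signPoly_comp (n : ℕ) (r : ℝ) {f g : ℝ → ℝ} {O : Set ℝ} (hf : ContinuousOn f O)
    (hg : ContinuousOn g O) : ContinuousOn (fun x => signPoly n r (f x) (g x)) O :=
  (continuous_signPoly n r).comp_continuousOn (g := fun z : ℝ × ℝ => signPoly n r z.1 z.2)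
    (f := fun x => (f x, g x)) (hf.prodMk hg)

/-! ### Growth of the speed along the zero curve and along the axis. -/

namespace IsZeroCurve

variable {n : ℕ} {us uss : ℝ} {B : ℝ → ℝ} (D : IsZeroCurve n us uss B)

include D

lemma signPoly_pos {a : ℝ} (ha : a ∈ Ioc us uss) : 0 < signPoly n (-3 / 2) (B a) a :=
  signPoly_pos_of_ellF_nonneg D.one_le (D.nonneg a ha) (D.lt a ha) (D.lt_one_of_mem ha)
    (D.zero a ha).ge

lemma signPoly_neg {a : ℝ} (ha : a ∈ Ioc us uss) : signPoly n (-3 / 2) a (B a) < 0 :=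
  signPoly_neg_of_ellF_nonpos D.one_le (D.nonneg a ha) (D.lt a ha) (D.lt_one_of_mem ha)
    (by rw [ellF_symm, D.zero a ha])

lemma B_lt_one {a : ℝ} (ha : a ∈ Icc us uss) : B a < 1 :=
  (D.B_le ha).trans_lt (ha.2.trans_lt D.uss_lt)

/-- The factor a - b of F_a and the factor b - a of F_b cancel against the minus sign of implicit
differentiation. -/
lemma hasDerivAt_B {a : ℝ} (ha : a ∈ Ioo us uss) :
    HasDerivAt B (signPoly n (-3 / 2) (B a) a * ellJ 1 a (B a) /
      (signPoly n (-3 / 2) a (B a) * ellJ 1 (B a) a)) a := by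
  have ha' : a ∈ Ioc us uss := ⟨ha.1, ha.2.le⟩
  have ha1 := D.lt_one_of_mem ha'
  have hBa := D.lt a ha'
  have hB1 := hBa.trans ha1
  have hσ := D.signPoly_neg ha'
  have hJ := ellJ_pos hB1 ha1
  have h := hasDerivAt_of_zero_curve (F := fun a b => ellF (n + 1) 1 a b)
    (Fa := fun a b => (a - b) * signPoly n (-3 / 2) b a * ellJ 1 a b)
    (Fb := fun a b => (b - a) * signPoly n (-3 / 2) a b * ellJ 1 b a) (B := B) (a₀ := a)
    isOpen_Iio ha1 hB1 (convex_Iio 1) (hasDerivAt_ellF_one n ha1 hB1)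
    (fun x hx y hy => by
      simp only [ellF_symm (n + 1) 1 _ x]
      exact hasDerivAt_ellF_one n hy hx) ?_ ?_
    (D.continuousOn.continuousAt (Icc_mem_nhds ha.1 ha.2)) ?_
  · refine h.congr_deriv ?_
    have h1 : a - B a ≠ 0 := by linarith
    have h2 : B a - a ≠ 0 := by linarith
    have h3 := hσ.ne
    have h4 := hJ.ne'
    field_simp
    ring
  · refine ContinuousAt.mul (ContinuousAt.mul (by fun_prop) ?_) ?_
    · exact (continuous_signPoly n _).continuousAt
    · exact (continuousOn_ellJ.continuousAt (x := (1, B a, a)) (isOpen_region.mem_nhds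
        ⟨hB1, ha1⟩)).comp (f := fun z : ℝ × ℝ => ((1, z.2, z.1) : ℝ × ℝ × ℝ)) (x := (a, B a))
        (by fun_prop)
  · exact mul_ne_zero (mul_ne_zero (by linarith) hσ.ne) hJ.ne'
  · filter_upwards [Ioo_mem_nhds ha.1 ha.2] with y hy using D.zero y ⟨hy.1, hy.2.le⟩

lemma contDiffOn_B : ContDiffOn ℝ 1 B (Ioo us uss) := by
  refine contDiffOn_one_of_hasDerivAt isOpen_Ioo (fun a ha => D.hasDerivAt_B ha) ?_
  have hBc := D.continuousOn.mono Ioo_subset_Icc_self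
  have h1 : ∀ x ∈ Ioo us uss, x < 1 := fun x hx => hx.2.trans D.uss_lt
  have h2 : ∀ x ∈ Ioo us uss, B x < 1 := fun x hx => D.B_lt_one (Ioo_subset_Icc_self hx)
  refine ContinuousOn.div ?_ ?_ fun x hx => ?_
  · exact (continuousOn_signPoly_comp n _ hBc continuousOn_id).mul
      (continuousOn_ellJ_comp continuousOn_id hBc h1 h2)
  · exact (continuousOn_signPoly_comp n _ continuousOn_id hBc).mul
      (continuousOn_ellJ_comp hBc continuousOn_id h2 h1)
  · exact mul_ne_zero (D.signPoly_neg ⟨hx.1, hx.2.le⟩).ne (ellJ_pos (h2 x hx) (h1 x hx)).ne'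

/-- The factor σ of ∂w_m/∂b is the one in the denominator of B', so it cancels and only positive
quantities remain. -/
lemma hasDerivAt_wCoeff_curve {a : ℝ} (ha : a ∈ Ioo us uss) :
    HasDerivAt (fun y => wCoeff (n + 1) 1 y (B y))
      (1 / 2 * signPoly n (-3 / 2) (B a) a * (1 + ellJ 1 a (B a) / ellJ 1 (B a) a)) a := by
  have ha' : a ∈ Ioc us uss := ⟨ha.1, ha.2.le⟩
  have h3 := (D.signPoly_neg ha').ne
  have h4 := (ellJ_pos (D.B_lt_one ⟨ha.1.le, ha.2.le⟩) (D.lt_one_of_mem ha')).ne'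
  refine (hasDerivAt_wCoeff_comp n (D.hasDerivAt_B ha)).congr_deriv ?_
  generalize signPoly n (-3 / 2) a (B a) = σ at *
  field_simp

lemma wCoeff_curve_deriv_pos {a : ℝ} (ha : a ∈ Ioo us uss) :
    0 < 1 / 2 * signPoly n (-3 / 2) (B a) a * (1 + ellJ 1 a (B a) / ellJ 1 (B a) a) := by
  have ha' : a ∈ Ioc us uss := ⟨ha.1, ha.2.le⟩
  have hB1 := D.B_lt_one ⟨ha.1.le, ha.2.le⟩
  have ha1 := D.lt_one_of_mem ha'
  have h1 := D.signPoly_pos ha'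
  have h2 := ellJ_pos hB1 ha1
  have h3 := ellJ_pos ha1 hB1
  positivity

lemma continuousOn_wCoeff_curve_deriv : ContinuousOn (fun a =>
    1 / 2 * signPoly n (-3 / 2) (B a) a * (1 + ellJ 1 a (B a) / ellJ 1 (B a) a)) (Ioo us uss) := by
  have hBc := D.continuousOn.mono Ioo_subset_Icc_self
  have h1 : ∀ x ∈ Ioo us uss, x < 1 := fun x hx => hx.2.trans D.uss_lt
  have h2 : ∀ x ∈ Ioo us uss, B x < 1 := fun x hx => D.B_lt_one (Ioo_subset_Icc_self hx)
  exact (continuousOn_const.mul (continuousOn_signPoly_comp n _ hBc continuousOn_id)).mul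
    (continuousOn_const.add ((continuousOn_ellJ_comp continuousOn_id hBc h1 h2).div
      (continuousOn_ellJ_comp hBc continuousOn_id h2 h1)
      fun x hx => (ellJ_pos (h2 x hx) (h1 x hx)).ne'))

lemma continuousOn_wCoeff_curve : ContinuousOn (fun a => wCoeff (n + 1) 1 a (B a)) (Icc us uss) :=
  (continuous_wCoeff (n + 1)).comp_continuousOn (f := fun a => ((1, a, B a) : ℝ × ℝ × ℝ))
    (continuousOn_const.prodMk (continuousOn_id.prodMk D.continuousOn))

omit D in
/-- On the axis `u₃ = 0`, `wPoly` is at most its value at the right end point. -/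
lemma ellN_lt (hn : 1 ≤ n) {a : ℝ} (ha : 0 < a) (ha1 : a < 1)
    (hσ : 0 < signPoly n (-3 / 2) 0 a) :
    ellN (n + 1) 1 a 0 < signPoly n (-3 / 2) 0 a * ellJ 1 0 a := by
  have hk := continuous_ker ha1 one_pos
  have hw : Continuous fun θ => wPoly (n + 1) 1 a 0 (arc a 0 θ) :=
    (continuous_wPoly (n + 1)).comp
      (g := fun p : (ℝ × ℝ × ℝ) × ℝ => wPoly (n + 1) p.1.1 p.1.2.1 p.1.2.2 p.2)
      (f := fun θ => ((1, a, 0), arc a 0 θ)) (by fun_prop)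
  rw [← sub_pos, ellJ_symm, ellN, ← intervalIntegral.integral_const_mul,
    ← intervalIntegral.integral_sub (Continuous.intervalIntegrable (by fun_prop) _ _)
      (Continuous.intervalIntegrable (by fun_prop) _ _)]
  refine intervalIntegral.intervalIntegral_pos_of_pos_on
    (Continuous.intervalIntegrable (by fun_prop) _ _) (fun θ hθ => ?_) (by positivity)
  obtain ⟨hs, hc⟩ := sin_cos_pos hθ
  have hker := ker_pos ha1 one_pos θ
  have harc : arc a 0 θ < a := by
    have := sub_arc a 0 θ
    have h1 : 0 < (a - 0) * cos θ ^ 2 := by rw [sub_zero]; positivity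
    linarith
  have harc0 : 0 ≤ arc a 0 θ := le_arc ha.le le_rfl θ
  have hself := wPoly_self n a 0
  rw [wPoly_succ_zero] at hself
  -- Negative values of `wPoly` are harmless; once nonnegative, `wPoly` increases up to ξ = a, where
  -- it equals σ.
  have hS : sin θ ^ 2 * signPoly n (-1) a (arc a 0 θ) < signPoly n (-3 / 2) 0 a := by
    rcases lt_or_ge (signPoly n (-1) a (arc a 0 θ)) 0 with h | h
    · exact (mul_neg_of_pos_of_neg (by positivity) h).trans hσ
    · have h1 := signPoly_lt_of_nonneg hn (by norm_num) ha.le ha1 harc0 harc h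
      rw [hself] at h1
      refine lt_of_le_of_lt (mul_le_of_le_one_left h ?_) h1
      exact sin_sq_le_one θ
  have hfact : signPoly n (-3 / 2) 0 a * (cos θ ^ 2 * ker 1 a 0 θ) - cos θ ^ 2 * sin θ ^ 2 *
      (wPoly (n + 1) 1 a 0 (arc a 0 θ) * ker 1 a 0 θ) = (signPoly n (-3 / 2) 0 a -
      sin θ ^ 2 * signPoly n (-1) a (arc a 0 θ)) * (cos θ ^ 2 * ker 1 a 0 θ) := by
    rw [wPoly_succ_zero]; ring
  rw [hfact]
  exact mul_pos (by linarith) (by positivity)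

omit D in
-- Quotient rule with (2(a-b) J(b,a))' = K. Adding w_m' = σ/2 and using J(a,b) + J(b,a) = K makes K
-- a common factor.
lemma hasDerivAt_speed₂_axis {a : ℝ} (ha : 0 < a) (ha1 : a < 1) :
    HasDerivAt (fun y => speed₂ (n + 1) 1 y 0)
      (4 ^ (n + 1) * (2 * ((n + 1 : ℕ) : ℝ) + 1) * (ellK 1 a 0 *
        (signPoly n (-3 / 2) 0 a * ellJ 1 0 a - ellN (n + 1) 1 a 0) / (2 * ellJ 1 0 a ^ 2))) a := by
  have hJ := ellJ_pos one_pos ha1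
  have hd : 2 * (a - 0) * ellJ 1 0 a ≠ 0 := by rw [sub_zero]; positivity
  have h := ((hasDerivAt_wCoeff_succ n a 0).add
    ((hasDerivAt_ellF_one n ha1 one_pos).div (hasDerivAt_ellJ ha1 one_pos) hd)).const_mul
    (4 ^ (n + 1) * (2 * ((n + 1 : ℕ) : ℝ) + 1))
  refine (h.congr_of_eventuallyEq ?_).congr_deriv ?_
  · filter_upwards [Ioo_mem_nhds ha ha1] with y hy
    exact speed₂_eq (n + 1) hy.1 hy.2
  · have ha' := ha.ne'
    rw [← ellJ_add ha1 one_pos, ellF, sub_zero]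
    field_simp
    ring

lemma speed₂_axis_deriv_pos {a : ℝ} (ha : uss ≤ a) (ha1 : a < 1) :
    0 < 4 ^ (n + 1) * (2 * ((n + 1 : ℕ) : ℝ) + 1) * (ellK 1 a 0 *
        (signPoly n (-3 / 2) 0 a * ellJ 1 0 a - ellN (n + 1) 1 a 0) / (2 * ellJ 1 0 a ^ 2)) := by
  have ha0 : 0 < a := D.us_pos.trans (D.us_lt.trans_le ha)
  have hF : 0 ≤ ellF (n + 1) 1 a 0 := by
    rcases ha.eq_or_lt with h | h
    · rw [← h, D.axis]
    · exact (D.ellF_axis_pos h ha1).le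
  have hσ := signPoly_pos_of_ellF_nonneg D.one_le le_rfl ha0 ha1 hF
  have hN := sub_pos.2 (ellN_lt D.one_le ha0 ha1 hσ)
  have hJ := ellJ_pos one_pos ha1
  have hK := ellK_pos ha1 one_pos
  positivity

omit D in
lemma continuousOn_speed₂_axis_deriv : ContinuousOn (fun a =>
    4 ^ (n + 1) * (2 * ((n + 1 : ℕ) : ℝ) + 1) * (ellK 1 a 0 *
      (signPoly n (-3 / 2) 0 a * ellJ 1 0 a - ellN (n + 1) 1 a 0) / (2 * ellJ 1 0 a ^ 2)))
    (Ioo uss 1) := by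
  have h1 : ∀ x ∈ Ioo uss 1, x < 1 := fun x hx => hx.2
  have h0 : ∀ x ∈ Ioo uss 1, (0 : ℝ) < 1 := fun x hx => one_pos
  have hJ := continuousOn_ellJ_comp continuousOn_const continuousOn_id h0 h1
  have hJ' := continuousOn_ellJ_comp continuousOn_id continuousOn_const h1 h0
  have hK : ContinuousOn (fun a => ellK 1 a 0) (Ioo uss 1) :=
    (hJ'.add hJ).congr fun x hx => (ellJ_add hx.2 one_pos).symm
  have hN : ContinuousOn (fun a => ellN (n + 1) 1 a 0) (Ioo uss 1) :=
    (continuousOn_ellN (n + 1)).comp (f := fun x => ((1, x, 0) : ℝ × ℝ × ℝ)) (by fun_prop)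
      fun x hx => ⟨hx.2, one_pos⟩
  exact continuousOn_const.mul ((hK.mul (((continuousOn_signPoly_comp n _ continuousOn_const
    continuousOn_id).mul hJ).sub hN)).div (continuousOn_const.mul (hJ.pow 2))
    fun x hx => (mul_pos two_pos (pow_pos (ellJ_pos one_pos hx.2) 2)).ne')

end IsZeroCurve

/-! ### The variable x/t as an increasing function of u₂. -/

/-- The self-similarity variable `x / t` as a function of `u₂`. -/
def curveSpeed (n : ℕ) (uss : ℝ) (B : ℝ → ℝ) (a : ℝ) : ℝ :=
  if a ≤ uss then 4 ^ (n + 1) * (2 * ((n + 1 : ℕ) : ℝ) + 1) * wCoeff (n + 1) 1 a (B a)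
  else if a < 1 then speed₂ (n + 1) 1 a 0 else 4 ^ (n + 1)

lemma speed_eq_of_zero {m : ℕ} {a b : ℝ} (hba : b < a) (ha : a < 1) (h : ellF m 1 a b = 0) :
    speed₂ m 1 a b = 4 ^ m * (2 * (m : ℝ) + 1) * wCoeff m 1 a b ∧
      speed₃ m 1 a b = 4 ^ m * (2 * (m : ℝ) + 1) * wCoeff m 1 a b := by
  rw [speed₂_eq m hba ha, speed₃_eq m hba ha, h]
  simp

lemma ellF_eq_zero_of_speed_eq {m : ℕ} {a b : ℝ} (hba : b < a) (ha : a < 1)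
    (h : speed₂ m 1 a b = speed₃ m 1 a b) : ellF m 1 a b = 0 := by
  rw [speed₂_eq m hba ha, speed₃_eq m hba ha] at h
  have hc : (4 ^ m * (2 * (m : ℝ) + 1)) ≠ 0 := by positivity
  have h1 := mul_left_cancel₀ hc h
  have hd : 0 < a - b := by linarith
  have hJ := ellJ_pos (hba.trans ha) ha
  have hJ' := ellJ_pos ha (hba.trans ha)
  have h2 : ellF m 1 a b * (1 / (2 * (a - b) * ellJ 1 b a) + 1 / (2 * (a - b) * ellJ 1 a b)) = 0 := by
    linear_combination h1
  exact (mul_eq_zero.1 h2).resolve_right (by positivity)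

namespace IsZeroCurve

variable {n : ℕ} {us uss : ℝ} {B : ℝ → ℝ} (D : IsZeroCurve n us uss B)

include D

lemma uss_pos : 0 < uss := D.us_pos.trans D.us_lt

lemma curveSpeed_curve {a : ℝ} (ha : a ∈ Ioc us uss) :
    curveSpeed n uss B a = speed₂ (n + 1) 1 a (B a) ∧
      curveSpeed n uss B a = speed₃ (n + 1) 1 a (B a) := by
  obtain ⟨h1, h2⟩ := speed_eq_of_zero (D.lt a ha) (D.lt_one_of_mem ha) (D.zero a ha)
  rw [h1, h2, curveSpeed, if_pos ha.2]
  exact ⟨rfl, rfl⟩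

lemma curveSpeed_axis {a : ℝ} (ha : uss ≤ a) (ha1 : a < 1) :
    curveSpeed n uss B a = speed₂ (n + 1) 1 a 0 := by
  rcases ha.eq_or_lt with h | h
  · rw [← h, (D.curveSpeed_curve ⟨D.us_lt, le_rfl⟩).1, D.apply_uss]
  · rw [curveSpeed, if_neg (not_le.2 h), if_pos ha1]

lemma curveSpeed_one : curveSpeed n uss B 1 = 4 ^ (n + 1) := by
  rw [curveSpeed, if_neg (not_le.2 D.uss_lt), if_neg (lt_irrefl _)]

lemma hasDerivAt_curveSpeed_curve {a : ℝ} (ha : a ∈ Ioo us uss) :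
    HasDerivAt (curveSpeed n uss B) (4 ^ (n + 1) * (2 * ((n + 1 : ℕ) : ℝ) + 1) *
      (1 / 2 * signPoly n (-3 / 2) (B a) a * (1 + ellJ 1 a (B a) / ellJ 1 (B a) a))) a := by
  refine ((D.hasDerivAt_wCoeff_curve ha).const_mul _).congr_of_eventuallyEq ?_
  filter_upwards [Iio_mem_nhds ha.2] with y hy
  rw [curveSpeed, if_pos (le_of_lt hy)]

lemma hasDerivAt_curveSpeed_axis {a : ℝ} (ha : a ∈ Ioo uss 1) :
    HasDerivAt (curveSpeed n uss B) (4 ^ (n + 1) * (2 * ((n + 1 : ℕ) : ℝ) + 1) * (ellK 1 a 0 *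
        (signPoly n (-3 / 2) 0 a * ellJ 1 0 a - ellN (n + 1) 1 a 0) / (2 * ellJ 1 0 a ^ 2))) a := by
  refine (hasDerivAt_speed₂_axis (D.uss_pos.trans ha.1) ha.2).congr_of_eventuallyEq ?_
  filter_upwards [Ioo_mem_nhds ha.1 ha.2] with y hy using D.curveSpeed_axis hy.1.le hy.2

lemma continuousOn_curveSpeed_curve : ContinuousOn (curveSpeed n uss B) (Icc us uss) :=
  (D.continuousOn_wCoeff_curve.const_mul _).congr fun a ha => by rw [curveSpeed, if_pos ha.2]

lemma continuousOn_curveSpeed_axis : ContinuousOn (curveSpeed n uss B) (Icc uss 1) := by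
  intro a ha
  rcases ha.2.lt_or_eq with h | h
  · have hc := (hasDerivAt_speed₂_axis (n := n) (D.uss_pos.trans_le ha.1) h).continuousAt
    refine (hc.continuousWithinAt (s := Icc uss 1)).congr_of_eventuallyEq ?_
      (D.curveSpeed_axis ha.1 h)
    filter_upwards [self_mem_nhdsWithin, nhdsWithin_le_nhds (Iio_mem_nhds h)] with y hy hy1
    exact D.curveSpeed_axis hy.1 hy1
  · subst h
    have h1 : ContinuousWithinAt (curveSpeed n uss B) (Iio 1) 1 := by
      rw [ContinuousWithinAt, D.curveSpeed_one]
      refine (tendsto_speed₂_one (n := n)).congr' ?_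
      filter_upwards [Ioo_mem_nhdsLT D.uss_lt] with y hy
      exact (D.curveSpeed_axis hy.1.le hy.2).symm
    rw [← continuousWithinAt_insert_self, Iio_insert] at h1
    exact h1.mono fun x hx => hx.2

lemma continuousOn_curveSpeed : ContinuousOn (curveSpeed n uss B) (Icc us 1) := by
  rw [← Icc_union_Icc_eq_Icc D.us_lt.le D.uss_lt.le]
  exact D.continuousOn_curveSpeed_curve.union_of_isClosed D.continuousOn_curveSpeed_axis
    isClosed_Icc isClosed_Icc

lemma strictMonoOn_curveSpeed : StrictMonoOn (curveSpeed n uss B) (Icc us 1) := by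
  have h1 : StrictMonoOn (curveSpeed n uss B) (Icc us uss) := by
    refine strictMonoOn_of_deriv_pos (convex_Icc _ _) D.continuousOn_curveSpeed_curve
      fun a ha => ?_
    rw [interior_Icc] at ha
    rw [(D.hasDerivAt_curveSpeed_curve ha).deriv]
    have := D.wCoeff_curve_deriv_pos ha
    positivity
  have h2 : StrictMonoOn (curveSpeed n uss B) (Icc uss 1) := by
    refine strictMonoOn_of_deriv_pos (convex_Icc _ _) D.continuousOn_curveSpeed_axis
      fun a ha => ?_
    rw [interior_Icc] at ha
    rw [(D.hasDerivAt_curveSpeed_axis ha).deriv]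
    exact D.speed₂_axis_deriv_pos ha.1.le ha.2
  have h := h1.union h2 (isGreatest_Icc D.us_lt.le) (isLeast_Icc D.uss_lt.le)
  rwa [Icc_union_Icc_eq_Icc D.us_lt.le D.uss_lt.le] at h

lemma continuousOn_B : ContinuousOn B (Icc us 1) := by
  rw [← Icc_union_Icc_eq_Icc D.us_lt.le D.uss_lt.le]
  refine D.continuousOn.union_of_isClosed ?_ isClosed_Icc isClosed_Icc
  exact continuousOn_const.congr fun a ha => D.apply_of_le a ha.1

end IsZeroCurve

/-! ### Self-similar solutions and locally constant ones. -/

/-- A function of `x / t` is transported with any speed which equals `x / t` wherever the function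
is not stationary. -/
lemma transported_selfSimilar {v : ℝ → ℝ} {c : ℝ → ℝ → ℝ} {J : Set ℝ} {Ω : Set (ℝ × ℝ)}
    (hJ : IsOpen J) (hv : ContDiffOn ℝ 1 v J)
    (hΩ : ∀ x t, (x, t) ∈ Ω → 0 < t ∧ x / t ∈ J)
    (hc : ∀ x t, (x, t) ∈ Ω → c x t = x / t ∨ deriv v (x / t) = 0) :
    Transported (fun x t => v (x / t)) c Ω := by
  constructor
  · refine hv.comp (f := fun z : ℝ × ℝ => z.1 / z.2) (t := J) ?_ fun z hz => (hΩ z.1 z.2 hz).2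
    exact contDiffOn_fst.div contDiffOn_snd fun z hz => (hΩ z.1 z.2 hz).1.ne'
  · intro x t h
    obtain ⟨ht, hxt⟩ := hΩ x t h
    have hd : HasDerivAt v (deriv v (x / t)) (x / t) :=
      ((hv.differentiableOn one_ne_zero).differentiableAt (hJ.mem_nhds hxt)).hasDerivAt
    have h1 : HasDerivAt (fun s => x / s) (-x / t ^ 2) t :=
      ((hasDerivAt_const t x).fun_div (hasDerivAt_id' t) ht.ne').congr_deriv (by simp)
    have h2 : HasDerivAt (fun y => y / t) (1 / t) x := (hasDerivAt_id x).div_const t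
    have h3 : HasDerivAt (fun s => v (x / s)) (deriv v (x / t) * (-x / t ^ 2)) t :=
      HasDerivAt.comp t hd h1
    have h4 : HasDerivAt (fun y => v (y / t)) (deriv v (x / t) * (1 / t)) x :=
      HasDerivAt.comp x (h₂ := v) hd h2
    rw [h3.deriv, h4.deriv]
    rcases hc x t h with h5 | h5
    · rw [h5]; field_simp; ring
    · rw [h5]; ring

lemma transported_const (k : ℝ) (c : ℝ → ℝ → ℝ) (Ω : Set (ℝ × ℝ)) :
    Transported (fun _ _ => k) c Ω :=
  ⟨contDiffOn_const, fun x t _ => by simp⟩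

/-- A locally constant function solves the Burgers type equation. -/
lemma isBurgersSolution_of_locally_const {m : ℕ} {u : ℝ → ℝ → ℝ} {Ω : Set (ℝ × ℝ)} (hΩ : IsOpen Ω)
    (h : ∀ z ∈ Ω, ∃ k : ℝ, (fun z : ℝ × ℝ => u z.1 z.2) =ᶠ[𝓝 z] fun _ => k) :
    IsBurgersSolution m u Ω := by
  refine ⟨hΩ, fun z hz => ?_, fun x t hxt => ?_⟩
  · obtain ⟨k, hk⟩ := h z hz
    exact (contDiffAt_const.congr_of_eventuallyEq hk).contDiffWithinAt
  · obtain ⟨k, hk⟩ := h _ hxt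
    have h1 : (fun s => u x s) =ᶠ[𝓝 t] fun _ => k :=
      ((Continuous.prodMk_right x).tendsto t).eventually hk
    have h2 : (fun y => C m / (m + 1) * u y t ^ (m + 1)) =ᶠ[𝓝 x]
        fun _ => C m / (m + 1) * k ^ (m + 1) := by
      have : (fun y => u y t) =ᶠ[𝓝 x] fun _ => k :=
        ((Continuous.prodMk_left t).tendsto x).eventually hk
      filter_upwards [this] with y hy
      rw [hy]
    rw [h1.deriv_eq, h2.deriv_eq]
    simp

end Whitham

end

/-! ### The self-similar solution by inversion of x/t. -/

theorem theorem3p1 (m : ℕ) (hm : 2 ≤ m) :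
    ∃ us uss α β : ℝ,
      -- `us` is the unique zero of `p₁(1, ξ, ξ)` in `(0, 1)`
      (us ∈ Ioo (0 : ℝ) 1 ∧ Whitham.p₁ m 1 us us = 0 ∧
        ∀ ξ ∈ Ioo (0 : ℝ) 1, Whitham.p₁ m 1 ξ ξ = 0 → ξ = us) ∧
      -- `uss` is the unique zero of `μ₂(1, ξ, 0) - μ₃(1, ξ, 0)` in `(0, 1)`
      (uss ∈ Ioo (0 : ℝ) 1 ∧ Whitham.speed₂ m 1 uss 0 - Whitham.speed₃ m 1 uss 0 = 0 ∧
        ∀ ξ ∈ Ioo (0 : ℝ) 1, Whitham.speed₂ m 1 ξ 0 - Whitham.speed₃ m 1 ξ 0 = 0 → ξ = uss) ∧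
      -- `α = μ₂(1, us, us)`, the continuous extension of `μ₂` to the boundary of `u₁ > u₂ > u₃`
      Tendsto (fun u : ℝ × ℝ × ℝ => Whitham.speed₂ m u.1 u.2.1 u.2.2)
        (𝓝[Whitham.domain] (1, us, us)) (𝓝 α) ∧
      -- `β = μ₂(1, uss, 0)`
      β = Whitham.speed₂ m 1 uss 0 ∧
      -- `μ₂(1, 1, 0) = q(1, 1, 0) = 4 ^ m`, again by continuous extension
      Tendsto (fun u : ℝ × ℝ × ℝ => Whitham.speed₂ m u.1 u.2.1 u.2.2)
        (𝓝[Whitham.domain] (1, 1, 0)) (𝓝 (4 ^ m)) ∧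
      Whitham.q m 1 1 0 = 4 ^ m ∧
      α < β ∧ β < 4 ^ m ∧
      -- the self-similar solution: `u₁ = 1`, `u₂ = v₂(x / t)`, `u₃ = v₃(x / t)`
      ∃ v₂ v₃ : ℝ → ℝ,
        -- the first region: the equations have exactly one solution
        (∀ x t : ℝ, 0 < t → α * t < x → x ≤ β * t →
          (0 ≤ v₃ (x / t) ∧ v₃ (x / t) < v₂ (x / t) ∧ v₂ (x / t) < 1 ∧
            x = Whitham.speed₂ m 1 (v₂ (x / t)) (v₃ (x / t)) * t ∧
            x = Whitham.speed₃ m 1 (v₂ (x / t)) (v₃ (x / t)) * t) ∧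
          ∀ a b : ℝ, 0 ≤ b → b < a → a < 1 →
            x = Whitham.speed₂ m 1 a b * t → x = Whitham.speed₃ m 1 a b * t →
            a = v₂ (x / t) ∧ b = v₃ (x / t)) ∧
        -- the second region: the equation has exactly one solution with `uss ≤ u₂ < 1`
        (∀ x t : ℝ, 0 < t → β * t ≤ x → x < 4 ^ m * t →
          (uss ≤ v₂ (x / t) ∧ v₂ (x / t) < 1 ∧ v₃ (x / t) = 0 ∧
            x = Whitham.speed₂ m 1 (v₂ (x / t)) 0 * t) ∧
          ∀ a : ℝ, uss ≤ a → a < 1 → x = Whitham.speed₂ m 1 a 0 * t → a = v₂ (x / t)) ∧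
        -- monotonicity and continuity in the self-similarity variable
        StrictMonoOn v₂ (Icc α (4 ^ m)) ∧ StrictAntiOn v₃ (Icc α β) ∧
        ContinuousOn v₂ (Icc α (4 ^ m)) ∧ ContinuousOn v₃ (Icc α (4 ^ m)) ∧
        -- the Whitham equations hold
        Whitham.IsWhithamSolution m (fun _ _ => 1) (fun x t => v₂ (x / t)) (fun x t => v₃ (x / t))
          {z | 0 < z.2 ∧ α * z.2 < z.1 ∧ z.1 < 4 ^ m * z.2 ∧ z.1 ≠ β * z.2} ∧
        -- the Burgers type solution outside, its initial data, and the matching at the two edges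
        ∃ u : ℝ → ℝ → ℝ,
          (∀ x t : ℝ, 0 < t → x ≤ α * t → u x t = 1) ∧
          (∀ x t : ℝ, 0 < t → 4 ^ m * t ≤ x → u x t = 0) ∧
          Whitham.IsBurgersSolution m u {z | 0 < z.2 ∧ (z.1 < α * z.2 ∨ 4 ^ m * z.2 < z.1)} ∧
          (∀ x : ℝ, x < 0 → ∀ᶠ t in 𝓝[>] (0 : ℝ), x < α * t ∧ u x t = 1) ∧
          (∀ x : ℝ, 0 < x → ∀ᶠ t in 𝓝[>] (0 : ℝ), 4 ^ m * t < x ∧ u x t = 0) ∧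
          (v₂ α = us ∧ v₃ α = us ∧ ∀ t : ℝ, 0 < t → u (α * t) t = 1) ∧
          (v₂ (4 ^ m) = 1 ∧ ∀ t : ℝ, 0 < t → u (4 ^ m * t) t = v₃ (4 ^ m)) := by
  obtain ⟨n, rfl⟩ : ∃ n, m = n + 1 := ⟨m - 1, by omega⟩
  -- For n = 0 the polynomial σ is the constant 1 and has no sign change; this is where m ≥ 2
  -- enters.
  have hn : 1 ≤ n := by omega
  obtain ⟨us, uss, B, D⟩ := Whitham.exists_isZeroCurve hn
  set s := Whitham.curveSpeed n uss B with hs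
  -- The inverse g of the speed serves as v₂, and B ∘ g as v₃.
  obtain ⟨g, hg, hgs, hgm, hgc⟩ := Whitham.exists_inverse_Icc D.us_lt_one.le
    D.strictMonoOn_curveSpeed D.continuousOn_curveSpeed
  rw [D.curveSpeed_one, ← hs] at hg hgm hgc
  rw [← hs] at hgs
  have mem_us : us ∈ Icc us 1 := left_mem_Icc.2 D.us_lt_one.le
  have mem_uss : uss ∈ Icc us 1 := ⟨D.us_lt.le, D.uss_lt.le⟩
  have mem_one : (1 : ℝ) ∈ Icc us 1 := right_mem_Icc.2 D.us_lt_one.le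
  have hsm : StrictMonoOn s (Icc us 1) := D.strictMonoOn_curveSpeed
  have hs1 : s 1 = 4 ^ (n + 1) := D.curveSpeed_one
  have hαβ : s us < s uss := hsm mem_us mem_uss D.us_lt
  have hβ1 : s uss < 4 ^ (n + 1) := hs1 ▸ hsm mem_uss mem_one D.uss_lt
  have hguss : g (s uss) = uss := hgs uss mem_uss
  have hgus : g (s us) = us := hgs us mem_us
  have hgone : g (4 ^ (n + 1)) = 1 := by rw [← hs1]; exact hgs 1 mem_one
  have mem_β : s uss ∈ Icc (s us) (4 ^ (n + 1)) := ⟨hαβ.le, hβ1.le⟩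
  have mem_α : s us ∈ Icc (s us) (4 ^ (n + 1)) := ⟨le_rfl, (hαβ.trans hβ1).le⟩
  have mem_4 : (4 : ℝ) ^ (n + 1) ∈ Icc (s us) (4 ^ (n + 1)) := ⟨(hαβ.trans hβ1).le, le_rfl⟩
  have g_curve : ∀ y, s us < y → y ≤ s uss → g y ∈ Ioc us uss := by
    intro y h1 h2
    have hy : y ∈ Icc (s us) (4 ^ (n + 1)) := ⟨h1.le, h2.trans hβ1.le⟩
    have h3 := hgm mem_α hy h1
    have h4 := hgm.monotoneOn hy mem_β h2
    rw [hgus] at h3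
    rw [hguss] at h4
    exact ⟨h3, h4⟩
  have g_axis : ∀ y, s uss ≤ y → y < 4 ^ (n + 1) → uss ≤ g y ∧ g y < 1 := by
    intro y h1 h2
    have hy : y ∈ Icc (s us) (4 ^ (n + 1)) := ⟨hαβ.le.trans h1, h2.le⟩
    have h3 := hgm hy mem_4 h2
    have h4 := hgm.monotoneOn mem_β hy h1
    rw [hgone] at h3
    rw [hguss] at h4
    exact ⟨h4, h3⟩
  have hβ : s uss = Whitham.speed₂ (n + 1) 1 uss 0 := D.curveSpeed_axis le_rfl D.uss_lt
  have hα : s us = 4 ^ (n + 1) * (2 * ((n + 1 : ℕ) : ℝ) + 1) * Whitham.wCoeff (n + 1) 1 us us := by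
    rw [hs, Whitham.curveSpeed, if_pos D.us_lt.le, D.apply_us]
  -- regularity
  have hg_curve : ContDiffOn ℝ 1 g (Ioo (s us) (s uss)) := by
    refine Whitham.contDiffOn_one_inverse isOpen_Ioo
      (fun a ha => D.hasDerivAt_curveSpeed_curve ha)
      (continuousOn_const.mul D.continuousOn_wCoeff_curve_deriv)
      (fun a ha => ?_) (hgc.mono fun y hy => ⟨hy.1.le, (hy.2.trans hβ1).le⟩) ?_
      fun y hy => (hg y ⟨hy.1.le, (hy.2.trans hβ1).le⟩).2
    · have := D.wCoeff_curve_deriv_pos ha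
      positivity
    · intro y hy
      have h1 := g_curve y hy.1 hy.2.le
      refine ⟨h1.1, ?_⟩
      have := hgm ⟨hy.1.le, (hy.2.trans hβ1).le⟩ mem_β hy.2
      rwa [hguss] at this
  have hg_axis : ContDiffOn ℝ 1 g (Ioo (s uss) (4 ^ (n + 1))) := by
    refine Whitham.contDiffOn_one_inverse isOpen_Ioo
      (fun a ha => D.hasDerivAt_curveSpeed_axis ha)
      Whitham.IsZeroCurve.continuousOn_speed₂_axis_deriv
      (fun a ha => (D.speed₂_axis_deriv_pos ha.1.le ha.2).ne')
      (hgc.mono fun y hy => ⟨(hαβ.trans hy.1).le, hy.2.le⟩) ?_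
      fun y hy => (hg y ⟨(hαβ.trans hy.1).le, hy.2.le⟩).2
    intro y hy
    refine ⟨?_, (g_axis y hy.1.le hy.2).2⟩
    have := hgm mem_β ⟨(hαβ.trans hy.1).le, hy.2.le⟩ hy.1
    rwa [hguss] at this
  have hB_curve : ContDiffOn ℝ 1 (fun y => B (g y)) (Ioo (s us) (s uss)) := by
    refine D.contDiffOn_B.comp hg_curve fun y hy => ?_
    refine ⟨(g_curve y hy.1 hy.2.le).1, ?_⟩
    have := hgm ⟨hy.1.le, (hy.2.trans hβ1).le⟩ mem_β hy.2
    rwa [hguss] at this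
  have hB0 : ∀ y ∈ Ioo (s uss) (4 ^ (n + 1)), B (g y) = 0 := fun y hy =>
    D.apply_of_le _ (g_axis y hy.1.le hy.2).1
  have hB_axis : ContDiffOn ℝ 1 (fun y => B (g y)) (Ioo (s uss) (4 ^ (n + 1))) :=
    contDiffOn_const.congr hB0
  -- At β = `s uss` the branches are joined only continuously, so this value is left out.
  set J : Set ℝ := Ioo (s us) (s uss) ∪ Ioo (s uss) (4 ^ (n + 1)) with hJdef
  have hJ : IsOpen J := isOpen_Ioo.union isOpen_Ioo
  have hgJ : ContDiffOn ℝ 1 g J := hg_curve.union_of_isOpen hg_axis isOpen_Ioo isOpen_Ioo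
  have hBJ : ContDiffOn ℝ 1 (fun y => B (g y)) J :=
    hB_curve.union_of_isOpen hB_axis isOpen_Ioo isOpen_Ioo
  have hΩJ : ∀ x t : ℝ, (x, t) ∈ {z : ℝ × ℝ | 0 < z.2 ∧ s us * z.2 < z.1 ∧
      z.1 < 4 ^ (n + 1) * z.2 ∧ z.1 ≠ s uss * z.2} → 0 < t ∧ x / t ∈ J := by
    rintro x t ⟨ht, h1, h2, h3⟩
    simp only at ht h1 h2 h3
    refine ⟨ht, ?_⟩
    have h1' : s us < x / t := (lt_div_iff₀ ht).2 h1
    have h2' : x / t < 4 ^ (n + 1) := (div_lt_iff₀ ht).2 h2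
    have h3' : x / t ≠ s uss := fun h => h3 ((div_eq_iff ht.ne').1 h)
    rcases h3'.lt_or_gt with h | h
    · exact Or.inl ⟨h1', h⟩
    · exact Or.inr ⟨h, h2'⟩
  have hsg : ∀ y ∈ J, s (g y) = y := by
    rintro y (hy | hy)
    · exact (hg y ⟨hy.1.le, (hy.2.trans hβ1).le⟩).2
    · exact (hg y ⟨(hαβ.trans hy.1).le, hy.2.le⟩).2
  have hspeed₂ : ∀ y ∈ J, Whitham.speed₂ (n + 1) 1 (g y) (B (g y)) = y := by
    rintro y (hy | hy)
    · rw [← (D.curveSpeed_curve (g_curve y hy.1 hy.2.le)).1]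
      exact hsg y (Or.inl hy)
    · have h := g_axis y hy.1.le hy.2
      rw [hB0 y hy, ← D.curveSpeed_axis h.1 h.2]
      exact hsg y (Or.inr hy)
  have hdiag : ∀ ξ, Whitham.p₁ (n + 1) 1 ξ ξ = 0 ↔ Whitham.signPoly n (-2) 0 ξ = 0 := by
    intro ξ
    have hc : -(2 * (2 * (n : ℝ) + 3) * 4 ^ n) ≠ 0 := by
      have : 0 < 2 * (2 * (n : ℝ) + 3) * 4 ^ n := by positivity
      linarith
    rw [Whitham.p₁_diag, Whitham.signPoly_diag, mul_eq_zero]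
    exact or_iff_right hc
  refine ⟨us, uss, s us, s uss, ⟨⟨D.us_pos, D.us_lt_one⟩, (hdiag us).2 D.diag, ?_⟩,
    ⟨⟨D.uss_pos, D.uss_lt⟩, ?_, ?_⟩, ?_, hβ, Whitham.tendsto_speed₂_corner n,
    Whitham.q_one_one_zero _, hαβ, hβ1, g, fun y => B (g y), ?_, ?_, hgm, ?_, hgc, ?_, ?_,
    -- The value between the two edges plays no role.
    fun x t => if x ≤ s us * t then 1 else 0, ?_, ?_, ?_, ?_, ?_, ?_, ?_⟩
  · intro ξ hξ h
    rw [hdiag] at h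
    rcases lt_trichotomy ξ us with h1 | h1 | h1
    · have := Whitham.signPoly_pos_of_nonneg hn (by norm_num) le_rfl one_pos hξ.1.le h1 h.ge
      rw [D.diag] at this
      exact absurd this (lt_irrefl _)
    · exact h1
    · have := Whitham.signPoly_pos_of_nonneg hn (by norm_num) le_rfl one_pos D.us_pos.le h1
        D.diag.ge
      rw [h] at this
      exact absurd this (lt_irrefl _)
  · obtain ⟨h1, h2⟩ := Whitham.speed_eq_of_zero D.uss_pos D.uss_lt D.axis
    rw [h1, h2, sub_self]
  · intro ξ hξ h
    exact D.eq_uss_of_zero hξ.1 hξ.2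
      (Whitham.ellF_eq_zero_of_speed_eq hξ.1 hξ.2 (sub_eq_zero.1 h))
  · rw [hα]
    exact Whitham.tendsto_speed₂_diag (n + 1) D.us_lt_one
  · intro x t ht h1 h2
    have h1' : s us < x / t := (lt_div_iff₀ ht).2 h1
    have h2' : x / t ≤ s uss := (div_le_iff₀ ht).2 h2
    have hmem := g_curve _ h1' h2'
    have hsgy : s (g (x / t)) = x / t := (hg _ ⟨h1'.le, h2'.trans hβ1.le⟩).2
    obtain ⟨e2, e3⟩ := D.curveSpeed_curve hmem
    rw [← hs, hsgy] at e2 e3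
    refine ⟨⟨D.nonneg _ hmem, D.lt _ hmem, D.lt_one_of_mem hmem, ?_, ?_⟩, ?_⟩
    · rw [← e2, div_mul_cancel₀ _ ht.ne']
    · rw [← e3, div_mul_cancel₀ _ ht.ne']
    · intro a b hb hba ha hx2 hx3
      -- Equal speeds force F = 0, so (a, b) lies on the zero curve; injectivity of the speed along
      -- it fixes a.
      have hF := Whitham.ellF_eq_zero_of_speed_eq hba ha
        (mul_right_cancel₀ ht.ne' (hx2.symm.trans hx3))
      obtain ⟨hamem, rfl⟩ := D.eq_of_zero hb hba ha hF
      have hsa : s a = s (g (x / t)) := by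
        rw [hsgy, hs, (D.curveSpeed_curve hamem).1, eq_div_iff ht.ne', ← hx2]
      have : a = g (x / t) := hsm.injOn ⟨hamem.1.le, ha.le⟩
        ⟨hmem.1.le, (D.lt_one_of_mem hmem).le⟩ hsa
      exact ⟨this, congrArg B this⟩
  · intro x t ht h1 h2
    have h1' : s uss ≤ x / t := (le_div_iff₀ ht).2 h1
    have h2' : x / t < 4 ^ (n + 1) := (div_lt_iff₀ ht).2 h2
    obtain ⟨e1, e2⟩ := g_axis _ h1' h2'
    have hsgy : s (g (x / t)) = x / t := (hg _ ⟨hαβ.le.trans h1', h2'.le⟩).2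
    refine ⟨⟨e1, e2, D.apply_of_le _ e1, ?_⟩, ?_⟩
    · rw [← D.curveSpeed_axis e1 e2, ← hs, hsgy, div_mul_cancel₀ _ ht.ne']
    · intro a ha ha1 hx
      have hsa : s a = s (g (x / t)) := by
        rw [hsgy, hs, D.curveSpeed_axis ha ha1, eq_div_iff ht.ne', ← hx]
      exact hsm.injOn ⟨D.us_lt.le.trans ha, ha1.le⟩ ⟨D.us_lt.le.trans e1, e2.le⟩ hsa
  · refine D.strictAntiOn.comp_strictMonoOn (hgm.mono (Icc_subset_Icc_right hβ1.le)) fun y hy => ?_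
    have hy' : y ∈ Icc (s us) (4 ^ (n + 1)) := ⟨hy.1, hy.2.trans hβ1.le⟩
    refine ⟨(hg y hy').1.1, ?_⟩
    have := hgm.monotoneOn hy' mem_β hy.2
    rwa [hguss] at this
  · exact D.continuousOn_B.comp hgc fun y hy => (hg y hy).1
  · refine ⟨?_, ?_, Whitham.transported_const 1 _ _, ?_, ?_⟩
    · refine IsOpen.inter (isOpen_lt continuous_const continuous_snd) (IsOpen.inter
        (isOpen_lt (by fun_prop) continuous_fst) (IsOpen.inter
        (isOpen_lt continuous_fst (by fun_prop)) (isOpen_ne_fun continuous_fst (by fun_prop))))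
    · intro x t h
      rcases (hΩJ x t h).2 with hy | hy
      · have hmem := g_curve _ hy.1 hy.2.le
        exact ⟨D.lt _ hmem, D.lt_one_of_mem hmem⟩
      · have h1 := g_axis _ hy.1.le hy.2
        refine ⟨?_, h1.2⟩
        change B (g (x / t)) < g (x / t)
        rw [hB0 _ hy]
        exact D.uss_pos.trans_le h1.1
    · exact Whitham.transported_selfSimilar hJ hgJ hΩJ
        fun x t h => Or.inl (hspeed₂ _ (hΩJ x t h).2)
    · refine Whitham.transported_selfSimilar hJ hBJ hΩJ fun x t h => ?_
      rcases (hΩJ x t h).2 with hy | hy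
      · left
        simp only
        rw [← (D.curveSpeed_curve (g_curve _ hy.1 hy.2.le)).2]
        exact hsg _ (Or.inl hy)
      -- Here u₃ = 0 is stationary, so its equation holds whatever the value of μ₃.
      · right
        have : (fun y => B (g y)) =ᶠ[𝓝 (x / t)] fun _ => 0 := by
          filter_upwards [isOpen_Ioo.mem_nhds hy] with y hy using hB0 y hy
        rw [this.deriv_eq, deriv_const]
  · intro x t _ h
    exact if_pos h
  · intro x t ht h
    refine if_neg (not_le.2 ?_)
    have : s us * t < 4 ^ (n + 1) * t := mul_lt_mul_of_pos_right (hαβ.trans hβ1) ht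
    linarith
  · refine Whitham.isBurgersSolution_of_locally_const ?_ ?_
    · exact IsOpen.inter (isOpen_lt continuous_const continuous_snd) (IsOpen.union
        (isOpen_lt continuous_fst (by fun_prop)) (isOpen_lt (by fun_prop) continuous_fst))
    · rintro ⟨x, t⟩ ⟨ht, h | h⟩
      · refine ⟨1, ?_⟩
        have ho : IsOpen {z : ℝ × ℝ | z.1 < s us * z.2} :=
          isOpen_lt continuous_fst (by fun_prop)
        filter_upwards [ho.mem_nhds h] with z hz
        exact if_pos (le_of_lt hz)
      · refine ⟨0, ?_⟩
        have ho : IsOpen {z : ℝ × ℝ | s us * z.2 < z.1} :=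
          isOpen_lt (by fun_prop) continuous_fst
        have hmem : (x, t) ∈ {z : ℝ × ℝ | s us * z.2 < z.1} :=
          (mul_lt_mul_of_pos_right (hαβ.trans hβ1) ht).trans h
        filter_upwards [ho.mem_nhds hmem] with z hz
        exact if_neg (not_le.2 hz)
  · intro x hx
    have hc : Tendsto (fun t : ℝ => s us * t) (𝓝[>] 0) (𝓝 0) := by
      have : Continuous fun t : ℝ => s us * t := by fun_prop
      have := this.tendsto 0
      rw [mul_zero] at this
      exact this.mono_left nhdsWithin_le_nhds
    filter_upwards [hc.eventually_const_lt hx] with t ht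
    exact ⟨ht, if_pos ht.le⟩
  · intro x hx
    have hc : Tendsto (fun t : ℝ => 4 ^ (n + 1) * t) (𝓝[>] 0) (𝓝 0) := by
      have : Continuous fun t : ℝ => 4 ^ (n + 1) * t := by fun_prop
      have := this.tendsto 0
      rw [mul_zero] at this
      exact this.mono_left nhdsWithin_le_nhds
    filter_upwards [hc.eventually_lt_const hx, self_mem_nhdsWithin] with t h ht
    refine ⟨h, if_neg (not_le.2 ?_)⟩
    exact (mul_lt_mul_of_pos_right (hαβ.trans hβ1) ht).trans h
  · refine ⟨hgus, ?_, fun t _ => if_pos le_rfl⟩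
    simp only [hgus, D.apply_us]
  · refine ⟨hgone, fun t ht => ?_⟩
    simp only [hgone, D.apply_of_le 1 D.uss_lt.le]
    exact if_neg (not_le.2 (mul_lt_mul_of_pos_right (hαβ.trans hβ1) ht))
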